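/- For a fixed graph $H$, the problem BWS-$H$ asks, for a graph $G=(V,E)$, whether $V$ can be partitioned into two non-empty sets $A,B$ such that neither of the induced graphs $G[A]$, $G[B]$ contains $H$ as a (not necessarily induced) subgraph. A tree decomposition of $G$ is a tree $T$ with a bag $X_i\subseteq V$ for each node $i$, such that every vertex lies in some bag, both ends of every edge lie in a common bag, and for each vertex $v$ the nodes whose bags contain $v$ induce a connected subgraph of $T$; its width is $\max_i(|X_i|-1)$. It is nice if $T$ is rooted and every node $i$ is a leaf with $X_i=\emptyset$, or has exactly one child $j$ and $X_i=X_j\cup\{v\}$ with $v\notin X_j$ (introduce node), or has exactly one child $j$ and $X_j=X_i\cup\{v\}$ with $v\notin X_i$ (forget node), or has exactly two children $j_1,j_2$ and $X_i=X_{j_1}=X_{j_2}$ (join node). **Theorem.** For every fixed graph $H$ on $r$ vertices there is an algorithm that solves BWS-$H$ in time $2^{O(t^r)}\cdot n$ on $n$-vertex graphs of tree-width at most $t$ that are given together with a nice tree decomposition of width at most $t$ with $O(n)$ nodes. Precisely: for every graph $H$ on $r$ vertices there is a program $P$ of a random access machine (registers and arrays of natural numbers, indirect addressing, comparison of registers,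 and successor and predecessor as the only arithmetic, each operation taking one step) such that for every $c\in\mathbb N$ there is $C\in\mathbb N$ with the following property. Let $n,t\in\mathbb N$, let $G$ be a graph on $\{0,\dots,n-1\}$, and let $D$ be a nice tree decomposition of $G$ of width at most $t$ with at most $c\,(t+1)\,n$ nodes. Given $G$ as a list of its edges (each edge once, in any order and orientation) and $D$ as the post-order list of its nodes (each with its type and its introduced or forgotten vertex), $P$ halts after at most $C\cdot 2^{C t^r}\cdot n$ steps with the correct answer to BWS-$H$ on $G$. The program $P$ depends only on $H$, and $C$ only on $H$ and $c$. -/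

import Mathlib

/-! ### The problem -/

/-- The question of the problem BWS-`H` for the instance `G`: can the vertex set of `G` be
partitioned into two non-empty sets `A`, `B` such that neither `G[A]` nor `G[B]` contains `H` as a
(not necessarily induced) subgraph? -/
def BWS {W V : Type*} (H : SimpleGraph W) (G : SimpleGraph V) : Prop :=
  ∃ A B : Set V, A.Nonempty ∧ B.Nonempty ∧ Disjoint A B ∧ A ∪ B = Set.univ ∧
    ¬ H.IsContained (G.induce A) ∧ ¬ H.IsContained (G.induce B)

/-! ### Tree decompositions and nice tree decompositions -/

/-- `(T, X)` is a tree decomposition of the graph `G`. -/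
structure IsTreeDecomposition {V I : Type*} (G : SimpleGraph V) (T : SimpleGraph I)
    (X : I → Finset V) : Prop where
  isTree : T.IsTree
  vertex_mem : ∀ v : V, ∃ i, v ∈ X i
  edge_mem : ∀ u v : V, G.Adj u v → ∃ i, u ∈ X i ∧ v ∈ X i
  connected : ∀ v : V, (T.induce {i | v ∈ X i}).Connected

/-- Rooted trees in which every node is labelled as a leaf node, as a node introducing a vertex,
as a node forgetting a vertex, or as a join node; the arguments are the subtrees rooted at the
children. -/
inductive NiceTree (V : Type) : Type
  | leaf : NiceTree V
  | introduce (v : V) (T : NiceTree V) : NiceTree V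
  | forget (v : V) (T : NiceTree V) : NiceTree V
  | join (T₁ T₂ : NiceTree V) : NiceTree V

namespace NiceTree

variable {V : Type}

/-- The nodes of a rooted tree: the root, and the nodes of the subtrees rooted at its children. -/
inductive Node : NiceTree V → Type
  | root (T : NiceTree V) : Node T
  | introduce {v : V} {T : NiceTree V} (i : Node T) : Node (introduce v T)
  | forget {v : V} {T : NiceTree V} (i : Node T) : Node (forget v T)
  | left {T₁ T₂ : NiceTree V} (i : Node T₁) : Node (join T₁ T₂)
  | right {T₁ T₂ : NiceTree V} (i : Node T₂) : Node (join T₁ T₂)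

/-- `IsChild i j`: the node `i` is a child of the node `j`. -/
inductive IsChild : {T : NiceTree V} → Node T → Node T → Prop
  | introduce_root {v : V} {T : NiceTree V} :
      IsChild (.introduce (.root T)) (.root (introduce v T))
  | forget_root {v : V} {T : NiceTree V} :
      IsChild (.forget (.root T)) (.root (forget v T))
  | left_root {T₁ T₂ : NiceTree V} : IsChild (.left (.root T₁)) (.root (join T₁ T₂))
  | right_root {T₁ T₂ : NiceTree V} : IsChild (.right (.root T₂)) (.root (join T₁ T₂))
  | introduce {v : V} {T : NiceTree V} {i j : Node T} :
      IsChild i j → IsChild (T := introduce v T) (.introduce i) (.introduce j)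
  | forget {v : V} {T : NiceTree V} {i j : Node T} :
      IsChild i j → IsChild (T := forget v T) (.forget i) (.forget j)
  | left {T₁ T₂ : NiceTree V} {i j : Node T₁} :
      IsChild i j → IsChild (T := join T₁ T₂) (.left i) (.left j)
  | right {T₁ T₂ : NiceTree V} {i j : Node T₂} :
      IsChild i j → IsChild (T := join T₁ T₂) (.right i) (.right j)

/-- The underlying undirected tree. -/
def graph (T : NiceTree V) : SimpleGraph T.Node :=
  SimpleGraph.fromRel fun i j => IsChild i j

variable [DecidableEq V]

/-- The bag of the root. -/
def rootBag : NiceTree V → Finset V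
  | leaf => ∅
  | introduce v T => insert v T.rootBag
  | forget v T => T.rootBag.erase v
  | join T₁ _ => T₁.rootBag

/-- The bag of a node. -/
def bag : {T : NiceTree V} → Node T → Finset V
  | T, .root _ => T.rootBag
  | _, .introduce i => bag i
  | _, .forget i => bag i
  | _, .left i => bag i
  | _, .right i => bag i

/-- The conditions on the bags at the four types of nodes: an introduced vertex is not in the bag
of the child, a forgotten vertex is in the bag of the child, and the two children of a join node
have the same bag. -/
def LocallyNice : NiceTree V → Prop
  | leaf => True
  | introduce v T => v ∉ T.rootBag ∧ T.LocallyNice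
  | forget v T => v ∈ T.rootBag ∧ T.LocallyNice
  | join T₁ T₂ => T₁.rootBag = T₂.rootBag ∧ T₁.LocallyNice ∧ T₂.LocallyNice

/-- `D` is a nice tree decomposition of `G`. -/
def IsNiceTreeDecomposition (D : NiceTree V) (G : SimpleGraph V) : Prop :=
  IsTreeDecomposition G D.graph bag ∧ D.LocallyNice

/-- The width of `D`, which is the maximum of `|X_i| - 1` over the nodes `i`, is at most `t`. -/
def WidthLE (D : NiceTree V) (t : ℕ) : Prop :=
  ∀ i : D.Node, (bag i).card ≤ t + 1

/-- The list of the nodes in post-order. A node is written as a pair: its type (`0` for leaf, `1`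
for introduce, `2` for forget, `3` for join) and the vertex that is introduced or forgotten (`0` at
leaf nodes and join nodes). -/
def code {n : ℕ} : NiceTree (Fin n) → List (ℕ × ℕ)
  | leaf => [(0, 0)]
  | introduce v T => T.code ++ [(1, (v : ℕ))]
  | forget v T => T.code ++ [(2, (v : ℕ))]
  | join T₁ T₂ => T₁.code ++ T₂.code ++ [(3, 0)]

end NiceTree

/-! ### The machine model

A random access machine whose only arithmetic operations are successor and predecessor. It has
registers and arrays, all of whose cells hold natural numbers. A program is a finite object, so it
names only finitely many registers and arrays; the cells of an array are addressed indirectly.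
Every instruction and every evaluation of a test takes one step. As a number grows by at most one
in a step, registers never hold more than `O(log (N + T))` bits after `T` steps, where `N` bounds
the numbers in the input and the constants in the program. -/

namespace RAM

/-- A memory configuration: `reg x` is the content of register `x`, and `mem k a` is the content of
cell `a` of array `k`. -/
structure State where
  reg : ℕ → ℕ
  mem : ℕ → ℕ → ℕ

/-- Elementary instructions; `x`, `y` are registers and `k` is an array. -/
inductive Instr : Type
  /-- `x := c` -/
  | const (x c : ℕ) : Instr
  /-- `x := y` -/
  | copy (x y : ℕ) : Instr
  /-- `x := x + 1` -/
  | succ (x : ℕ) : Instr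
  /-- `x := max (x - 1) 0` -/
  | pred (x : ℕ) : Instr
  /-- `x := k[y]` -/
  | load (x k y : ℕ) : Instr
  /-- `k[x] := y` -/
  | store (k x y : ℕ) : Instr

/-- Write the value `a` into register `x`. -/
def State.setReg (s : State) (x a : ℕ) : State :=
  { s with reg := Function.update s.reg x a }

/-- Write the value `b` into cell `a` of array `k`. -/
def State.setMem (s : State) (k a b : ℕ) : State :=
  { s with mem := Function.update s.mem k (Function.update (s.mem k) a b) }

/-- The effect of an elementary instruction. -/
def Instr.apply : Instr → State → State
  | const x c, s => s.setReg x c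
  | copy x y, s => s.setReg x (s.reg y)
  | succ x, s => s.setReg x (s.reg x + 1)
  | pred x, s => s.setReg x (s.reg x - 1)
  | load x k y, s => s.setReg x (s.mem k (s.reg y))
  | store k x y, s => s.setMem k (s.reg x) (s.reg y)

/-- Tests: comparisons of the contents of two registers. -/
inductive Test : Type
  | eq (x y : ℕ) : Test
  | lt (x y : ℕ) : Test

/-- The truth value of a test. -/
def Test.holds : Test → State → Prop
  | eq x y, s => s.reg x = s.reg y
  | lt x y, s => s.reg x < s.reg y

/-- Programs. -/
inductive Prog : Type
  | instr (i : Instr) : Prog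
  | seq (p q : Prog) : Prog
  | ite (b : Test) (p q : Prog) : Prog
  | loop (b : Test) (p : Prog) : Prog

/-- `Exec p s T s'`: the program `p`, started in `s`, halts in `s'` after exactly `T` steps. Here
`loop b p` repeats `p` as long as the test `b` holds. -/
inductive Exec : Prog → State → ℕ → State → Prop
  | instr (i : Instr) (s : State) : Exec (.instr i) s 1 (i.apply s)
  | seq {p q : Prog} {s s' s'' : State} {T T' : ℕ} :
      Exec p s T s' → Exec q s' T' s'' → Exec (.seq p q) s (T + T') s''
  | ite_true {b : Test} {p q : Prog} {s s' : State} {T : ℕ} :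
      b.holds s → Exec p s T s' → Exec (.ite b p q) s (T + 1) s'
  | ite_false {b : Test} {p q : Prog} {s s' : State} {T : ℕ} :
      ¬ b.holds s → Exec q s T s' → Exec (.ite b p q) s (T + 1) s'
  | loop_done {b : Test} {p : Prog} {s : State} :
      ¬ b.holds s → Exec (.loop b p) s 1 s
  | loop_step {b : Test} {p : Prog} {s s' s'' : State} {T T' : ℕ} :
      b.holds s → Exec p s T s' → Exec (.loop b p) s' T' s'' →
        Exec (.loop b p) s (T + T' + 1) s''

end RAM

/-! ### Inputs -/

/-- The list `es` contains every edge of `G` exactly once (in one of its two orientations), and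
nothing else. -/
def ListsEdges {V : Type*} (es : List (V × V)) (G : SimpleGraph V) : Prop :=
  (es.map fun e => s(e.1, e.2)).Nodup ∧ ∀ u v : V, G.Adj u v ↔ s(u, v) ∈ es.map fun e => s(e.1, e.2)

/-- The initial configuration for a graph on the vertices `0, …, n - 1` with edge list `es`,
together with the tree `D`. Registers `0`, `1`, `2` hold the number of vertices, of edges and of
nodes of `D`; arrays `0` and `1` hold the first and the second end of each edge; arrays `2` and `3`
hold the type and the vertex of each node of `D`, in post-order. Everything else is `0`. -/
def inputState {n : ℕ} (es : List (Fin n × Fin n)) (D : NiceTree (Fin n)) : RAM.State where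
  reg := fun x => [n, es.length, D.code.length].getD x 0
  mem := fun k a =>
    match k with
    | 0 => (es.map fun e => (e.1 : ℕ)).getD a 0
    | 1 => (es.map fun e => (e.2 : ℕ)).getD a 0
    | 2 => (D.code.map fun p => p.1).getD a 0
    | 3 => (D.code.map fun p => p.2).getD a 0
    | _ => 0

/-- Started on the input `(G, D)`, with `G` given by the edge list `es`, the program `P` halts after
at most `B` steps, and then register `0` holds `1` if the answer to BWS-`H` is yes and `0` if it is
no. -/
def SolvesWithin {r n : ℕ} (P : RAM.Prog) (H : SimpleGraph (Fin r)) (G : SimpleGraph (Fin n))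
    (es : List (Fin n × Fin n)) (D : NiceTree (Fin n)) (B : ℕ) : Prop :=
  ∃ (T : ℕ) (s : RAM.State), RAM.Exec P (inputState es D) T s ∧ T ≤ B ∧
    (BWS H G → s.reg 0 = 1) ∧ (¬ BWS H G → s.reg 0 = 0)

/-!
The problem is solved by dynamic programming over the given decomposition, carried out by a program
of the machine.

**The dynamic program.** Fix a slot below `k` for each vertex, where `k` is the largest size of a
bag that occurs below a forget node, such that vertices in a common bag have different slots. A
*profile* is a colour class together with a map from the vertices of `H` to `k + 2` values: not
mapped yet, mapped to a forgotten vertex, or mapped to the bag vertex in a given slot. A colouring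
of the part of `G` below a node realizes a profile if some partial embedding of `H` into the colour
class has it (`Realizable`). An edge of `H` is checked only when one of its ends gets forgotten.
This suffices, since a forgotten vertex has all its neighbours below the node (`NiceTree.Sep`), and
all vertices are forgotten in the end, once forget nodes for the bag of the root have been appended.
How profiles change along the nodes is the content of `realizable_introduce`, `realizable_forget`
and `realizable_join`.

There are `2 * (k + 2) ^ r` profiles, so the set of profiles realized by a colouring is a number
below `2 ^ (2 * (k + 2) ^ r)`, and the table of a node lists the sets that arise from some colouring
(`IsTable`). The set at a node is a function of the sets at the children and, at an introduce node,
of the colour of the new vertex. At a join node two colourings have to be glued, which is possible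
exactly if they agree on the common bag. This can be seen from the two sets, because a bag vertex
`v` has colour `c` exactly if the profile that maps a single vertex of `H`, to `v`, is realized in
the class `c`. So the tables obey the recursions `encodes_introduce_iff`, `encodes_forget_iff` and
`encodes_join_iff`, and the table of the root decides whether some colouring avoids `H` in both
classes. Such a colouring with a constant colour can be changed at one vertex when `2 ≤ r` and
`1 < n`, since a class with at most one vertex does not contain `H`; hence non-emptiness of the
classes costs only the condition `1 < n` (`IsTable.bws_iff`). If `r ≤ 1`, the answer is always no.

**The machine.** Programs are written in a small language of expressions with bounded quantifiers
and commands with bounded loops; `RAM.Cmd.compile_runs` translates it into the language of the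
machine, with an explicit cost. Addition by counting takes time linear in the second summand, so
large addresses are only ever changed by small offsets. If the registers used for counting stay
below `N`, costs are at most a fixed power of `N` (`RAM.PolyOn`, `RAM.SmallRegs`). Here
`N = 2 ^ (2 * (t + 3) ^ r)` will do for all numbers in the dynamic program, whereas vertices, edges
and nodes may be numerous and are only copied, compared and used as addresses.

Since the machine cannot test adjacency in constant time, a pass over the nodes keeps the current
bag on a stack and records, at the forget node of each vertex, the list of the bag (`Recorded`).
Each edge is then marked in the lists of its two ends, where the other end occurs. This takes time
polynomial in `t` per edge, as the lists have at most `t + 1` entries. A pass from the root down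
assigns the slots greedily: a vertex receives the smallest slot not used in its recorded bag.
Finally the tables are computed in post-order on a stack of tables. Every node and every edge costs
a power of `N`, and the number of edges is bounded by the number of nodes times `(t + 1) ^ 2`
(`NiceTree.edges_length_le`), because both ends of an edge lie in a common bag.
-/

/-! ### Running programs of the machine within a time bound -/

namespace RAM

/-- `Runs p s τ Q`: the program `p`, started in `s`, halts after at most `τ` steps in a state that
satisfies `Q`. -/
def Runs (p : Prog) (s : State) (τ : ℕ) (Q : State → Prop) : Prop :=
  ∃ (T : ℕ) (s' : State), Exec p s T s' ∧ T ≤ τ ∧ Q s'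

theorem Runs.mono {p : Prog} {s : State} {τ τ' : ℕ} {Q Q' : State → Prop}
    (h : Runs p s τ Q) (hτ : τ ≤ τ') (hQ : ∀ s', Q s' → Q' s') : Runs p s τ' Q' := by
  obtain ⟨T, s', he, hT, hq⟩ := h
  exact ⟨T, s', he, hT.trans hτ, hQ _ hq⟩

theorem Runs.instr {i : Instr} {s : State} {Q : State → Prop} (h : Q (i.apply s)) :
    Runs (.instr i) s 1 Q :=
  ⟨1, _, .instr i s, le_rfl, h⟩

theorem Runs.seq {p q : Prog} {s : State} {τ τ' : ℕ} {Q R : State → Prop}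
    (hp : Runs p s τ Q) (hq : ∀ s', Q s' → Runs q s' τ' R) : Runs (.seq p q) s (τ + τ') R := by
  obtain ⟨T, s', he, hT, h⟩ := hp
  obtain ⟨T', s'', he', hT', h'⟩ := hq _ h
  exact ⟨_, _, .seq he he', by omega, h'⟩

/-- An elementary instruction followed by a program. -/
theorem Runs.step {i : Instr} {q : Prog} {s : State} {τ : ℕ} {R : State → Prop}
    (hq : Runs q (i.apply s) τ R) : Runs (.seq (.instr i) q) s (τ + 1) R := by
  obtain ⟨T, s', he, hT, h⟩ := hq
  exact ⟨_, _, .seq (.instr i s) he, by omega, h⟩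

theorem Runs.ite {b : Test} {p q : Prog} {s : State} {τ : ℕ} {Q : State → Prop}
    (hp : b.holds s → Runs p s τ Q) (hq : ¬ b.holds s → Runs q s τ Q) :
    Runs (.ite b p q) s (τ + 1) Q := by
  by_cases hb : b.holds s
  · obtain ⟨T, s', he, hT, h⟩ := hp hb
    exact ⟨_, _, .ite_true hb he, by omega, h⟩
  · obtain ⟨T, s', he, hT, h⟩ := hq hb
    exact ⟨_, _, .ite_false hb he, by omega, h⟩

/-- A counting loop: `x` is the counter and `y` holds the number `B` of iterations. -/
theorem Runs.loop {p : Prog} {x y B : ℕ} {τ : ℕ → ℕ} {I : ℕ → State → Prop}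
    (hI : ∀ i s, I i s → s.reg x = i ∧ s.reg y = B)
    (hp : ∀ i < B, ∀ s, I i s → Runs p s (τ i) (I (i + 1))) {s : State} (h0 : I 0 s) :
    Runs (.loop (.lt x y) p) s ((∑ i ∈ Finset.range B, (τ i + 1)) + 1) (I B) := by
  -- the tail of the loop from iteration `B - j` on, by induction on `j`
  have key : ∀ j ≤ B, ∀ s, I (B - j) s → Runs (.loop (.lt x y) p) s
      ((∑ i ∈ Finset.range j, (τ (B - j + i) + 1)) + 1) (I B) := by
    intro j
    induction j with
    | zero =>
      intro _ s hs
      obtain ⟨h1, h2⟩ := hI _ _ hs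
      refine ⟨1, s, .loop_done ?_, by simp, by simpa using hs⟩
      simp only [Test.holds]
      omega
    | succ j ih =>
      intro hj s hs
      obtain ⟨h1, h2⟩ := hI _ _ hs
      obtain ⟨T, s', he, hT, h⟩ := hp (B - (j + 1)) (by omega) s hs
      rw [show B - (j + 1) + 1 = B - j by omega] at h
      obtain ⟨T', s'', he', hT', h'⟩ := ih (by omega) s' h
      refine ⟨_, _, .loop_step ?_ he he', ?_, h'⟩
      · simp only [Test.holds]
        omega
      · rw [Finset.sum_range_succ']
        have : ∀ i, B - (j + 1) + (i + 1) = B - j + i := fun i => by omega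
        simp only [this, Nat.add_zero]
        omega
  simpa using key B le_rfl s (by simpa using h0)

/-- `Agree d s s'`: the state `s'` has the memory of `s` and the registers below `d` of `s`. -/
def Agree (d : ℕ) (s s' : State) : Prop :=
  (∀ x < d, s'.reg x = s.reg x) ∧ s'.mem = s.mem

theorem Agree.refl (d : ℕ) (s : State) : Agree d s s := ⟨fun _ _ => rfl, rfl⟩

theorem Agree.trans {d : ℕ} {s s' s'' : State} (h : Agree d s s') (h' : Agree d s' s'') :
    Agree d s s'' :=
  ⟨fun x hx => (h'.1 x hx).trans (h.1 x hx), h'.2.trans h.2⟩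

theorem Agree.mono {d e : ℕ} {s s' : State} (h : Agree e s s') (hd : d ≤ e) : Agree d s s' :=
  ⟨fun x hx => h.1 x (hx.trans_le hd), h.2⟩

theorem Agree.setReg_right {d : ℕ} {s s' : State} (h : Agree d s s') {x : ℕ} (hx : d ≤ x)
    (a : ℕ) : Agree d s (s'.setReg x a) :=
  ⟨fun y hy => by
    have : y ≠ x := by omega
    simpa [State.setReg, Function.update_of_ne this] using h.1 y hy, h.2⟩

theorem Agree.setReg_both {d : ℕ} {s s' : State} (h : Agree d s s') (x a : ℕ) :
    Agree d (s.setReg x a) (s'.setReg x a) :=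
  ⟨fun y hy => by
    by_cases hxy : y = x
    · subst hxy; simp [State.setReg]
    · simpa [State.setReg, Function.update_of_ne hxy] using h.1 y hy, h.2⟩

theorem State.setReg_self (s : State) (x : ℕ) : s.setReg x (s.reg x) = s := by
  simp [State.setReg]

@[simp] theorem State.setReg_reg (s : State) (x a y : ℕ) :
    (s.setReg x a).reg y = if y = x then a else s.reg y := by
  simp [State.setReg, Function.update_apply]

@[simp] theorem State.setReg_mem (s : State) (x a : ℕ) : (s.setReg x a).mem = s.mem := rfl

@[simp] theorem State.setMem_reg (s : State) (k a b : ℕ) : (s.setMem k a b).reg = s.reg := rfl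

@[simp] theorem State.setMem_mem (s : State) (k a b k' a' : ℕ) :
    (s.setMem k a b).mem k' a' = if k' = k ∧ a' = a then b else s.mem k' a' := by
  by_cases hk : k' = k
  · subst hk
    by_cases ha : a' = a <;> simp [State.setMem, ha]
  · simp [State.setMem, hk]

/-! ### Arithmetic by counting -/

/-- Binary operations on natural numbers. -/
inductive Op : Type
  | add | sub | mul | div | mod | eq | lt

/-- The value of an operation; `eq` and `lt` are truth values `0`, `1`. -/
def Op.fn : Op → ℕ → ℕ → ℕ
  | add, a, b => a + b
  | sub, a, b => a - b
  | mul, a, b => a * b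
  | div, a, b => a / b
  | mod, a, b => a % b
  | eq, a, b => if a = b then 1 else 0
  | lt, a, b => if a < b then 1 else 0

/-- An upper bound on the number of steps for an operation. It does not depend on the first
argument of `add` and `sub`, so that an offset can be added to an address in time linear in the
offset. -/
def Op.cost : Op → ℕ → ℕ → ℕ
  | add, _, b => 3 * b + 2
  | sub, _, b => 3 * b + 2
  | mul, a, b => 3 * (a * b) + 6 * a + 6
  | div, a, _ => 7 * a + 6
  | mod, a, _ => 7 * a + 6
  | eq, _, _ => 2
  | lt, _, _ => 2

/-- Addition of register `d + 1` to register `d`. -/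
def addFrag (d : ℕ) : Prog :=
  .seq (.instr (.const (d + 2) 0))
    (.loop (.lt (d + 2) (d + 1)) (.seq (.instr (.succ d)) (.instr (.succ (d + 2)))))

/-- Subtraction of register `d + 1` from register `d`. -/
def subFrag (d : ℕ) : Prog :=
  .seq (.instr (.const (d + 2) 0))
    (.loop (.lt (d + 2) (d + 1)) (.seq (.instr (.pred d)) (.instr (.succ (d + 2)))))

/-- Multiplication: register `d + 3` accumulates the multiples of register `d + 1`. -/
def mulFrag (d : ℕ) : Prog :=
  .seq (.instr (.const (d + 2) 0)) (.seq (.instr (.const (d + 3) 0))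
    (.seq (.loop (.lt (d + 2) d) (.seq (.instr (.copy (d + 4) (d + 1)))
      (.seq (addFrag (d + 3)) (.instr (.succ (d + 2))))))
    (.instr (.copy d (d + 3)))))

/-- Division with remainder: counting up to the dividend, the quotient is kept in register `d + 3`
and the remainder in register `d + 4`; `o` is the register that is returned. -/
def divFrag (d o : ℕ) : Prog :=
  .seq (.instr (.const (d + 2) 0)) (.seq (.instr (.const (d + 3) 0))
    (.seq (.instr (.const (d + 4) 0))
    (.seq (.loop (.lt (d + 2) d) (.seq (.instr (.succ (d + 4)))
      (.seq (.ite (.eq (d + 4) (d + 1))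
          (.seq (.instr (.const (d + 4) 0)) (.instr (.succ (d + 3))))
          (.instr (.copy d d)))
        (.instr (.succ (d + 2))))))
    (.instr (.copy d o)))))

/-- The program for an operation: it replaces register `d` by the value of the operation at
registers `d` and `d + 1`. -/
def Op.frag : Op → ℕ → Prog
  | add, d => addFrag d
  | sub, d => subFrag d
  | mul, d => mulFrag d
  | div, d => divFrag d (d + 3)
  | mod, d => divFrag d (d + 4)
  | eq, d => .ite (.eq d (d + 1)) (.instr (.const d 1)) (.instr (.const d 0))
  | lt, d => .ite (.lt d (d + 1)) (.instr (.const d 1)) (.instr (.const d 0))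

theorem addFrag_runs (d : ℕ) (s : State) : Runs (addFrag d) s (3 * s.reg (d + 1) + 2)
    fun s' => s'.reg d = s.reg d + s.reg (d + 1) ∧ Agree d s s' := by
  have := Runs.loop (p := .seq (.instr (.succ d)) (.instr (.succ (d + 2)))) (x := d + 2)
    (y := d + 1) (B := s.reg (d + 1)) (τ := fun _ => 2) (s := s.setReg (d + 2) 0)
    (I := fun i s' => s'.reg (d + 2) = i ∧ s'.reg (d + 1) = s.reg (d + 1) ∧
      s'.reg d = s.reg d + i ∧ Agree d s s') (fun i s' h => ⟨h.1, h.2.1⟩) ?_ ?_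
  · refine (Runs.step (i := .const (d + 2) 0) this).mono (by simp; omega) ?_
    rintro s' ⟨-, -, h, h'⟩
    exact ⟨h, h'⟩
  · rintro i - s' ⟨h1, h2, h3, h4⟩
    refine Runs.step (Runs.instr ?_)
    refine ⟨by simp [Instr.apply, h1], by simp [Instr.apply, h2],
      by simp [Instr.apply, h3, Nat.add_assoc], ?_⟩
    exact (h4.setReg_right le_rfl _).setReg_right (by omega) _
  · exact ⟨by simp, by simp, by simp, (Agree.refl d s).setReg_right (by omega) _⟩

theorem subFrag_runs (d : ℕ) (s : State) : Runs (subFrag d) s (3 * s.reg (d + 1) + 2)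
    fun s' => s'.reg d = s.reg d - s.reg (d + 1) ∧ Agree d s s' := by
  have := Runs.loop (p := .seq (.instr (.pred d)) (.instr (.succ (d + 2)))) (x := d + 2)
    (y := d + 1) (B := s.reg (d + 1)) (τ := fun _ => 2) (s := s.setReg (d + 2) 0)
    (I := fun i s' => s'.reg (d + 2) = i ∧ s'.reg (d + 1) = s.reg (d + 1) ∧
      s'.reg d = s.reg d - i ∧ Agree d s s') (fun i s' h => ⟨h.1, h.2.1⟩) ?_ ?_
  · refine (Runs.step (i := .const (d + 2) 0) this).mono (by simp; omega) ?_
    rintro s' ⟨-, -, h, h'⟩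
    exact ⟨h, h'⟩
  · rintro i - s' ⟨h1, h2, h3, h4⟩
    refine Runs.step (Runs.instr ?_)
    refine ⟨by simp [Instr.apply, h1], by simp [Instr.apply, h2],
      by simp [Instr.apply, h3, Nat.sub_sub], ?_⟩
    exact (h4.setReg_right le_rfl _).setReg_right (by omega) _
  · exact ⟨by simp, by simp, by simp, (Agree.refl d s).setReg_right (by omega) _⟩

theorem mulFrag_runs (d : ℕ) (s : State) :
    Runs (mulFrag d) s (3 * (s.reg d * s.reg (d + 1)) + 6 * s.reg d + 6)
      fun s' => s'.reg d = s.reg d * s.reg (d + 1) ∧ Agree d s s' := by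
  have := Runs.loop (p := .seq (.instr (.copy (d + 4) (d + 1)))
      (.seq (addFrag (d + 3)) (.instr (.succ (d + 2))))) (x := d + 2)
    (y := d) (B := s.reg d) (τ := fun _ => 3 * s.reg (d + 1) + 4)
    (s := (s.setReg (d + 2) 0).setReg (d + 3) 0)
    (I := fun i s' => s'.reg (d + 2) = i ∧ s'.reg d = s.reg d ∧ s'.reg (d + 1) = s.reg (d + 1) ∧
      s'.reg (d + 3) = i * s.reg (d + 1) ∧ Agree d s s') (fun i s' h => ⟨h.1, h.2.1⟩) ?_ ?_
  · refine (Runs.step (i := .const (d + 2) 0) (Runs.step (i := .const (d + 3) 0)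
      (this.seq (R := fun s' => s'.reg d = s.reg d * s.reg (d + 1) ∧ Agree d s s')
        (τ' := 1) ?_))).mono ?_ (fun _ h => h)
    · rintro s' ⟨-, -, -, h, h'⟩
      exact Runs.instr ⟨by simp [Instr.apply, h], h'.setReg_right le_rfl _⟩
    · simp only [Finset.sum_const, Finset.card_range, smul_eq_mul]
      ring_nf
      omega
  · rintro i - s' ⟨h1, h2, h3, h4, h5⟩
    refine (Runs.step (i := .copy (d + 4) (d + 1)) ((addFrag_runs (d + 3) _).seq (τ' := 1)
      ?_)).mono (by simp [Instr.apply, h3]) (fun _ h => h)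
    rintro s'' ⟨h6, h7⟩
    have h8 := h7.1 (d + 2) (by omega)
    have h9 := h7.1 d (by omega)
    have h10 := h7.1 (d + 1) (by omega)
    simp only [Instr.apply, State.setReg_reg] at h6 h8 h9 h10
    refine Runs.instr ⟨by simp [Instr.apply, h8, h1], by simp [Instr.apply, h9, h2],
      by simp [Instr.apply, h10, h3], ?_, ?_⟩
    · simp [Instr.apply, h6, h3, h4, Nat.add_mul]
    · exact ((h5.setReg_right (by omega) _).trans (h7.mono (by omega))).setReg_right (by omega) _
  · exact ⟨by simp, by simp, by simp, by simp,
      ((Agree.refl d s).setReg_right (by omega) _).setReg_right (by omega) _⟩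

theorem divFrag_runs (d o : ℕ) (s : State) (ho : o = d + 3 ∨ o = d + 4) :
    Runs (divFrag d o) s (7 * s.reg d + 6) fun s' =>
      s'.reg d = (if o = d + 3 then s.reg d / s.reg (d + 1) else s.reg d % s.reg (d + 1)) ∧
        Agree d s s' := by
  have := Runs.loop (p := .seq (.instr (.succ (d + 4)))
      (.seq (.ite (.eq (d + 4) (d + 1))
          (.seq (.instr (.const (d + 4) 0)) (.instr (.succ (d + 3))))
          (.instr (.copy d d)))
        (.instr (.succ (d + 2))))) (x := d + 2)
    (y := d) (B := s.reg d) (τ := fun _ => 5)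
    (s := ((s.setReg (d + 2) 0).setReg (d + 3) 0).setReg (d + 4) 0)
    (I := fun i s' => s'.reg (d + 2) = i ∧ s'.reg d = s.reg d ∧ s'.reg (d + 1) = s.reg (d + 1) ∧
      s'.reg (d + 3) = i / s.reg (d + 1) ∧ s'.reg (d + 4) = i % s.reg (d + 1) ∧
      Agree d s s') (fun i s' h => ⟨h.1, h.2.1⟩) ?_ ?_
  · refine (Runs.step (i := .const (d + 2) 0) (Runs.step (i := .const (d + 3) 0)
      (Runs.step (i := .const (d + 4) 0)
      (this.seq (R := fun s' => s'.reg d = (if o = d + 3 then s.reg d / s.reg (d + 1)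
        else s.reg d % s.reg (d + 1)) ∧ Agree d s s')
        (τ' := 1) ?_)))).mono ?_ (fun _ h => h)
    · rintro s' ⟨-, -, -, h, h', h''⟩
      refine Runs.instr ⟨?_, h''.setReg_right le_rfl _⟩
      rcases ho with rfl | rfl <;> simp [Instr.apply, h, h']
    · simp only [Finset.sum_const, Finset.card_range, smul_eq_mul]
      omega
  · rintro i - s' ⟨h1, h2, h3, h4, h5, h6⟩
    -- the quotient grows exactly when the incremented remainder reaches the divisor
    have hq : ((i % s.reg (d + 1) + 1 = s.reg (d + 1)) →
          (i + 1) / s.reg (d + 1) = i / s.reg (d + 1) + 1 ∧ (i + 1) % s.reg (d + 1) = 0) ∧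
        ((i % s.reg (d + 1) + 1 ≠ s.reg (d + 1)) →
          (i + 1) / s.reg (d + 1) = i / s.reg (d + 1) ∧
            (i + 1) % s.reg (d + 1) = i % s.reg (d + 1) + 1) := by
      generalize s.reg (d + 1) = b
      rcases Nat.eq_zero_or_pos b with rfl | hb
      · simp
      have hdm := Nat.div_add_mod i b
      have hlt := Nat.mod_lt i hb
      constructor
      · intro h
        rw [Nat.div_mod_unique hb]
        refine ⟨?_, hb⟩
        rw [Nat.mul_add]
        omega
      · intro h
        rw [Nat.div_mod_unique hb]
        refine ⟨?_, by omega⟩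
        omega
    refine (Runs.step (Runs.seq (τ := 3) (τ' := 1) (Q := fun s'' => s''.reg (d + 2) = i ∧
      s''.reg d = s.reg d ∧ s''.reg (d + 1) = s.reg (d + 1) ∧
      s''.reg (d + 3) = (i + 1) / s.reg (d + 1) ∧ s''.reg (d + 4) = (i + 1) % s.reg (d + 1) ∧
      Agree d s s'') (Runs.ite (τ := 2) ?_ ?_) ?_)).mono (by omega) (fun _ h => h)
    · intro hb
      simp only [Test.holds, Instr.apply, State.setReg_reg, h5, h3] at hb
      obtain ⟨e1, e2⟩ := hq.1 (by simpa using hb)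
      refine Runs.step (Runs.instr ⟨?_, ?_, ?_, ?_, ?_, ?_⟩)
      · simp [Instr.apply, h1]
      · simp [Instr.apply, h2]
      · simp [Instr.apply, h3]
      · simp [Instr.apply, h4, e1]
      · simp [Instr.apply, e2]
      · exact ((h6.setReg_right (by omega) _).setReg_right (by omega) _).setReg_right (by omega) _
    · intro hb
      simp only [Test.holds, Instr.apply, State.setReg_reg, h5, h3] at hb
      obtain ⟨e1, e2⟩ := hq.2 (by simpa using hb)
      refine (Runs.instr ⟨?_, ?_, ?_, ?_, ?_, ?_⟩).mono (by omega) (fun _ h => h)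
      · simp [Instr.apply, h1]
      · simp [Instr.apply, h2]
      · simp [Instr.apply, h3]
      · simp [Instr.apply, h4, e1]
      · simp [Instr.apply, h5, e2]
      · exact (h6.setReg_right (by omega) _).setReg_right (by omega) _
    · rintro s'' ⟨h1, h2, h3, h4, h5, h6⟩
      exact Runs.instr ⟨by simp [Instr.apply, h1], by simp [Instr.apply, h2],
        by simp [Instr.apply, h3], by simp [Instr.apply, h4], by simp [Instr.apply, h5],
        h6.setReg_right (by omega) _⟩
  · exact ⟨by simp, by simp, by simp, by simp, by simp,
      (((Agree.refl d s).setReg_right (by omega) _).setReg_right (by omega) _).setReg_right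
        (by omega) _⟩

theorem Op.frag_runs (o : Op) (d : ℕ) (s : State) :
    Runs (o.frag d) s (o.cost (s.reg d) (s.reg (d + 1))) fun s' =>
      s'.reg d = o.fn (s.reg d) (s.reg (d + 1)) ∧ Agree d s s' := by
  cases o with
  | add => exact addFrag_runs d s
  | sub => exact subFrag_runs d s
  | mul => exact mulFrag_runs d s
  | div => simpa [Op.frag, Op.cost, Op.fn] using divFrag_runs d (d + 3) s (.inl rfl)
  | mod => simpa [Op.frag, Op.cost, Op.fn] using divFrag_runs d (d + 4) s (.inr rfl)
  | eq =>
    refine Runs.ite (fun h => Runs.instr ?_) (fun h => Runs.instr ?_) <;>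
      simp only [Test.holds] at h <;>
      exact ⟨by simp [Instr.apply, Op.fn, h], (Agree.refl d s).setReg_right le_rfl _⟩
  | lt =>
    refine Runs.ite (fun h => Runs.instr ?_) (fun h => Runs.instr ?_) <;>
      simp only [Test.holds] at h <;>
      exact ⟨by simp [Instr.apply, Op.fn, h], (Agree.refl d s).setReg_right le_rfl _⟩

/-! ### A language of bounded expressions and bounded loops -/

/-- Expressions over the registers and arrays: besides arithmetic there are a conditional and a
bounded existential quantifier `ex x b e`, which binds the register `x`. -/
inductive Expr : Type
  | const (c : ℕ) : Expr
  | var (x : ℕ) : Expr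
  | load (k : ℕ) (e : Expr) : Expr
  | op (o : Op) (a b : Expr) : Expr
  | cond (c a b : Expr) : Expr
  | ex (x : ℕ) (b e : Expr) : Expr

/-- The value of an expression. -/
def Expr.eval : Expr → State → ℕ
  | const c, _ => c
  | var x, s => s.reg x
  | load k e, s => s.mem k (e.eval s)
  | op o a b, s => o.fn (a.eval s) (b.eval s)
  | cond c a b, s => if c.eval s ≠ 0 then a.eval s else b.eval s
  | ex x b e, s => if ∃ i < b.eval s, e.eval (s.setReg x i) ≠ 0 then 1 else 0

/-- An upper bound on the number of steps that evaluate an expression. -/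
def Expr.cost : Expr → State → ℕ
  | const _, _ => 1
  | var _, _ => 1
  | load _ e, s => e.cost s + 1
  | op o a b, s => a.cost s + b.cost s + o.cost (a.eval s) (b.eval s)
  | cond c a b, s => c.cost s + (if c.eval s ≠ 0 then a.cost s else b.cost s) + 2
  | ex x b e, s =>
    b.cost s + (∑ i ∈ Finset.range (b.eval s), (e.cost (s.setReg x i) + 6)) + 6

/-- All registers named in the expression are below `m`. -/
def Expr.WF (m : ℕ) : Expr → Prop
  | const _ => True
  | var x => x < m
  | load _ e => e.WF m
  | op _ a b => a.WF m ∧ b.WF m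
  | cond c a b => c.WF m ∧ a.WF m ∧ b.WF m
  | ex x b e => x < m ∧ b.WF m ∧ e.WF m

/-- The program that writes the value of an expression into register `d`; the registers from `d` on
are scratch space. -/
def Expr.compile : Expr → ℕ → Prog
  | const c, d => .instr (.const d c)
  | var x, d => .instr (.copy d x)
  | load k e, d => .seq (e.compile d) (.instr (.load d k d))
  | op o a b, d => .seq (a.compile d) (.seq (b.compile (d + 1)) (o.frag d))
  | cond c a b, d => .seq (c.compile d) (.seq (.instr (.const (d + 1) 0))
      (.ite (.eq d (d + 1)) (b.compile d) (a.compile d)))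
  | ex x b e, d => .seq (b.compile d) (.seq (.instr (.copy (d + 1) x))
      (.seq (.instr (.const (d + 2) 0)) (.seq (.instr (.const (d + 3) 0))
      (.seq (.loop (.lt (d + 2) d) (.seq (.instr (.copy x (d + 2))) (.seq (e.compile (d + 4))
        (.seq (.instr (.const (d + 5) 0))
        (.seq (.ite (.eq (d + 4) (d + 5)) (.instr (.copy d d)) (.instr (.const (d + 3) 1)))
          (.instr (.succ (d + 2))))))))
      (.seq (.instr (.copy x (d + 1))) (.instr (.copy d (d + 3))))))))

/-- Correctness of the compiler for expressions: the program may run in any state that agrees with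
the given state on the named registers. -/
theorem Expr.compile_runs {m : ℕ} (e : Expr) (he : e.WF m) {d : ℕ} (hd : m ≤ d) {s s₁ : State}
    (hs : Agree m s s₁) : Runs (e.compile d) s₁ (e.cost s) fun s₂ =>
      s₂.reg d = e.eval s ∧ Agree d s₁ s₂ := by
  induction e generalizing d s s₁ with
  | const c =>
    exact Runs.instr ⟨by simp [Instr.apply, eval], (Agree.refl d s₁).setReg_right le_rfl _⟩
  | var x =>
    exact Runs.instr ⟨by simp [Instr.apply, eval, hs.1 x he],
      (Agree.refl d s₁).setReg_right le_rfl _⟩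
  | load k e ih =>
    refine (ih he hd hs).seq ?_
    rintro s₂ ⟨h1, h2⟩
    refine Runs.instr ⟨?_, h2.setReg_right le_rfl _⟩
    simp [Instr.apply, eval, h1, h2.2, hs.2]
  | op o a b iha ihb =>
    refine ((iha he.1 hd hs).seq (τ' := b.cost s + o.cost (a.eval s) (b.eval s)) ?_).mono
      (by simp only [cost]; omega) (fun _ h => h)
    rintro s₂ ⟨h1, h2⟩
    refine (ihb he.2 (d := d + 1) (by omega) (hs.trans (h2.mono hd))).seq ?_
    rintro s₃ ⟨h3, h4⟩
    have h5 := h4.1 d (by omega)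
    have := o.frag_runs d s₃
    rw [h3, h5, h1] at this
    exact this.mono le_rfl fun s₄ h => ⟨h.1, (h2.trans (h4.mono (by omega))).trans h.2⟩
  | cond c a b ihc iha ihb =>
    refine ((ihc he.1 hd hs).seq
      (τ' := (if c.eval s ≠ 0 then a.cost s else b.cost s) + 1 + 1) ?_).mono
      (by simp only [cost]; omega) (fun _ h => h)
    rintro s₂ ⟨h1, h2⟩
    refine Runs.step ?_
    have h3 : Agree d s₁ (s₂.setReg (d + 1) 0) := h2.setReg_right (by omega) _
    refine Runs.ite (fun h => ?_) (fun h => ?_) <;>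
      simp only [Test.holds, Instr.apply] at h
    · have : c.eval s = 0 := by simpa [h1] using h
      simp only [eval, this]
      exact (ihb he.2.2 hd (hs.trans (h3.mono hd))).mono (by simp)
        (fun _ h => ⟨by simpa using h.1, h3.trans h.2⟩)
    · have : c.eval s ≠ 0 := by simpa [h1] using h
      simp only [eval, if_pos this]
      exact (iha he.2.1 hd (hs.trans (h3.mono hd))).mono (by simp)
        (fun _ h => ⟨by simpa using h.1, h3.trans h.2⟩)
  | ex x b e ihb ihe =>
    obtain ⟨hx, hb, he⟩ := he
    refine ((ihb hb hd hs).seq (τ' := (∑ i ∈ Finset.range (b.eval s),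
      (e.cost (s.setReg x i) + 6)) + 6) ?_).mono (by simp only [cost]; omega) (fun _ h => h)
    rintro s₂ ⟨h1, h2⟩
    have hxs : s₂.reg x = s₁.reg x := h2.1 x (by omega)
    have hloop := Runs.loop (p := .seq (.instr (.copy x (d + 2))) (.seq (e.compile (d + 4))
        (.seq (.instr (.const (d + 5) 0))
        (.seq (.ite (.eq (d + 4) (d + 5)) (.instr (.copy d d)) (.instr (.const (d + 3) 1)))
          (.instr (.succ (d + 2))))))) (x := d + 2) (y := d) (B := b.eval s)
      (τ := fun i => e.cost (s.setReg x i) + 5)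
      (s := ((s₂.setReg (d + 1) (s₂.reg x)).setReg (d + 2) 0).setReg (d + 3) 0)
      (I := fun i s' => s'.reg (d + 2) = i ∧ s'.reg d = b.eval s ∧ s'.reg (d + 1) = s₁.reg x ∧
        s'.reg (d + 3) = (if ∃ j < i, e.eval (s.setReg x j) ≠ 0 then 1 else 0) ∧
        Agree d s₁ (s'.setReg x (s₁.reg x))) (fun i s' h => ⟨h.1, h.2.1⟩) ?_ ?_
    · refine (Runs.step (Runs.step (Runs.step (hloop.seq (τ' := 2) ?_)))).mono
        (by simp only [Finset.sum_add_distrib]; simp; omega) (fun _ h => h)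
      rintro s₃ ⟨-, -, h3, h4, h5⟩
      refine Runs.step (Runs.instr ⟨?_, ?_⟩)
      · have : d + 3 ≠ x := by omega
        simp [Instr.apply, this, h4, eval]
      · simpa [Instr.apply, h3] using h5.setReg_right le_rfl _
    · rintro i - s₃ ⟨h3, h4, h5, h6, h7⟩
      have h8 : Agree m (s.setReg x i) (s₃.setReg x i) := by
        have := ((hs.trans (h7.mono hd)).setReg_both x i)
        simpa [State.setReg] using this
      refine (Runs.step ((ihe he (d := d + 4) (by omega) (s := s.setReg x i)
        (s₁ := s₃.setReg x i) h8).seq (τ' := 4) ?_ |>.mono le_rfl (fun _ h => h)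
          |> (fun h => by simpa only [Instr.apply, h3] using h))).mono (by omega) (fun _ h => h)
      rintro s₄ ⟨h9, h10⟩
      have e1 := h10.1 (d + 2) (by omega)
      have e2 := h10.1 d (by omega)
      have e3 := h10.1 (d + 1) (by omega)
      have e4 := h10.1 (d + 3) (by omega)
      have n1 : d ≠ x := by omega
      have n2 : d + 1 ≠ x := by omega
      have n3 : d + 2 ≠ x := by omega
      have n4 : d + 3 ≠ x := by omega
      simp only [State.setReg_reg, n1, n2, n3, n4, if_false, h3, h4, h5, h6] at e1 e2 e3 e4
      have h11 : ∀ y a, d ≤ y → y ≠ x → ∀ s₅ : State, Agree d s₁ (s₅.setReg x (s₁.reg x)) →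
          Agree d s₁ ((s₅.setReg y a).setReg x (s₁.reg x)) := by
        intro y a hy hyx s₅ h
        have : (s₅.setReg y a).setReg x (s₁.reg x) = (s₅.setReg x (s₁.reg x)).setReg y a := by
          simp only [State.setReg, Function.update_comm hyx]
        rw [this]
        exact h.setReg_right hy a
      have h12 : Agree d s₁ (s₄.setReg x (s₁.reg x)) := by
        refine h7.trans ?_
        have := (h10.mono (show d ≤ d + 4 by omega)).setReg_both x (s₁.reg x)
        simpa [State.setReg] using this
      have hex : (∃ j < i + 1, e.eval (s.setReg x j) ≠ 0) ↔
          (∃ j < i, e.eval (s.setReg x j) ≠ 0) ∨ e.eval (s.setReg x i) ≠ 0 := by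
        constructor
        · rintro ⟨j, hj, h⟩
          rcases Nat.lt_succ_iff_lt_or_eq.1 hj with hj | rfl
          · exact .inl ⟨j, hj, h⟩
          · exact .inr h
        · rintro (⟨j, hj, h⟩ | h)
          · exact ⟨j, by omega, h⟩
          · exact ⟨i, by omega, h⟩
      refine Runs.step (Runs.seq (τ := 2) (τ' := 1) (Q := fun s' => s'.reg (d + 2) = i ∧
        s'.reg d = b.eval s ∧ s'.reg (d + 1) = s₁.reg x ∧
        s'.reg (d + 3) = (if ∃ j < i + 1, e.eval (s.setReg x j) ≠ 0 then 1 else 0) ∧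
        Agree d s₁ (s'.setReg x (s₁.reg x))) (Runs.ite (fun h => Runs.instr ?_)
        (fun h => Runs.instr ?_)) ?_)
      · simp only [Test.holds, Instr.apply, State.setReg_reg] at h
        have h0 : e.eval (s.setReg x i) = 0 := by simpa [h9] using h
        refine ⟨by simp [Instr.apply, e1], by simp [Instr.apply, e2], by simp [Instr.apply, e3],
          ?_, h11 _ _ le_rfl n1 _ (h11 _ _ (by omega) (by omega) _ h12)⟩
        simp only [Instr.apply, State.setReg_reg]
        rw [if_neg (by omega), if_neg (by omega), e4]
        simp only [hex, h0, ne_eq, not_true_eq_false, or_false]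
      · simp only [Test.holds, Instr.apply, State.setReg_reg] at h
        have h0 : e.eval (s.setReg x i) ≠ 0 := by simpa [h9] using h
        refine ⟨by simp [Instr.apply, e1], by simp [Instr.apply, e2], by simp [Instr.apply, e3],
          ?_, h11 _ _ (by omega) n4 _ (h11 _ _ (by omega) (by omega) _ h12)⟩
        rw [if_pos (hex.2 (.inr h0))]
        simp [Instr.apply]
      · rintro s₅ ⟨k1, k2, k3, k4, k5⟩
        exact Runs.instr ⟨by simp [Instr.apply, k1], by simp [Instr.apply, k2],
          by simp [Instr.apply, k3], by simp [Instr.apply, k4],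
          h11 _ _ (by omega) n3 _ k5⟩
    · refine ⟨by simp, by simp [h1], by simp [hxs], by simp, ?_⟩
      have h3 : Agree d s₁ (((s₂.setReg (d + 1) (s₂.reg x)).setReg (d + 2) 0).setReg (d + 3) 0) :=
        ((h2.setReg_right (by omega) _).setReg_right (by omega) _).setReg_right (by omega) _
      have := h3.setReg_both x (s₁.reg x)
      rwa [State.setReg_self] at this

/-- Commands; `rep e c` runs `c` as many times as the value of `e` says at the beginning. -/
inductive Cmd : Type
  | assign (x : ℕ) (e : Expr) : Cmd
  | store (k : ℕ) (a e : Expr) : Cmd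
  | seq (c c' : Cmd) : Cmd
  | ite (e : Expr) (c c' : Cmd) : Cmd
  | rep (e : Expr) (c : Cmd) : Cmd

/-- The effect of a command. -/
def Cmd.run : Cmd → State → State
  | assign x e, s => s.setReg x (e.eval s)
  | store k a e, s => s.setMem k (a.eval s) (e.eval s)
  | seq c c', s => c'.run (c.run s)
  | ite e c c', s => if e.eval s ≠ 0 then c.run s else c'.run s
  | rep e c, s => c.run^[e.eval s] s

/-- An upper bound on the number of steps that carry out a command. -/
def Cmd.cost : Cmd → State → ℕ
  | assign _ e, s => e.cost s + 1
  | store _ a e, s => a.cost s + e.cost s + 1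
  | seq c c', s => c.cost s + c'.cost (c.run s)
  | ite e c c', s => e.cost s + (if e.eval s ≠ 0 then c.cost s else c'.cost s) + 2
  | rep e c, s => e.cost s + (∑ i ∈ Finset.range (e.eval s), (c.cost (c.run^[i] s) + 2)) + 2

/-- All registers named in the command are below `m`. -/
def Cmd.WF (m : ℕ) : Cmd → Prop
  | assign x e => x < m ∧ e.WF m
  | store _ a e => a.WF m ∧ e.WF m
  | seq c c' => c.WF m ∧ c'.WF m
  | ite e c c' => e.WF m ∧ c.WF m ∧ c'.WF m
  | rep e c => e.WF m ∧ c.WF m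

/-- The program for a command, with the registers from `d` on as scratch space. -/
def Cmd.compile : Cmd → ℕ → Prog
  | assign x e, d => .seq (e.compile d) (.instr (.copy x d))
  | store k a e, d =>
    .seq (a.compile d) (.seq (e.compile (d + 1)) (.instr (.store k d (d + 1))))
  | seq c c', d => .seq (c.compile d) (c'.compile d)
  | ite e c c', d => .seq (e.compile d) (.seq (.instr (.const (d + 1) 0))
      (.ite (.eq d (d + 1)) (c'.compile d) (c.compile d)))
  | rep e c, d => .seq (e.compile d) (.seq (.instr (.const (d + 1) 0))
      (.loop (.lt (d + 1) d) (.seq (c.compile (d + 2)) (.instr (.succ (d + 1))))))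

/-- Correctness of the compiler for commands. The scratch registers between `m` and `d` are
preserved, since the counters of the enclosing loops are kept there. -/
theorem Cmd.compile_runs {m : ℕ} (c : Cmd) (hc : c.WF m) {d : ℕ} (hd : m ≤ d) {s s₁ : State}
    (hs : Agree m s s₁) : Runs (c.compile d) s₁ (c.cost s) fun s₂ =>
      Agree m (c.run s) s₂ ∧ ∀ x, m ≤ x → x < d → s₂.reg x = s₁.reg x := by
  induction c generalizing d s s₁ with
  | assign x e =>
    refine (e.compile_runs hc.2 hd hs).seq ?_
    rintro s₂ ⟨h1, h2⟩
    refine Runs.instr ⟨?_, ?_⟩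
    · simp only [Instr.apply, h1]
      exact (hs.trans (h2.mono hd)).setReg_both x _
    · intro y hy hyd
      have : y ≠ x := by have := hc.1; omega
      simp [Instr.apply, this, h2.1 y hyd]
  | store k a e =>
    refine ((a.compile_runs hc.1 hd hs).seq (τ' := e.cost s + 1) ?_).mono
      (by simp only [cost]; omega) (fun _ h => h)
    rintro s₂ ⟨h1, h2⟩
    refine (e.compile_runs hc.2 (d := d + 1) (by omega) (hs.trans (h2.mono hd))).seq ?_
    rintro s₃ ⟨h3, h4⟩
    have h5 := h4.1 d (by omega)
    have h6 := h2.trans (h4.mono (Nat.le_succ d))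
    refine Runs.instr ⟨⟨?_, ?_⟩, ?_⟩
    · intro y hy
      simpa [Instr.apply, run] using (hs.trans (h6.mono hd)).1 y hy
    · have : s₃.mem = s.mem := (hs.trans (h6.mono hd)).2
      simp [Instr.apply, run, State.setMem, h3, h5, h1, this]
    · intro y hy hyd
      simpa [Instr.apply] using h6.1 y hyd
  | seq c c' ih ih' =>
    refine (ih hc.1 hd hs).seq ?_
    rintro s₂ ⟨h1, h2⟩
    exact (ih' hc.2 hd h1).mono le_rfl fun s₃ h =>
      ⟨h.1, fun x hx hxd => (h.2 x hx hxd).trans (h2 x hx hxd)⟩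
  | ite e c c' ih ih' =>
    refine ((e.compile_runs hc.1 hd hs).seq
      (τ' := (if e.eval s ≠ 0 then c.cost s else c'.cost s) + 1 + 1) ?_).mono
      (by simp only [cost]; omega) (fun _ h => h)
    rintro s₂ ⟨h1, h2⟩
    refine Runs.step ?_
    have h3 : Agree d s₁ (s₂.setReg (d + 1) 0) := h2.setReg_right (by omega) _
    refine Runs.ite (fun h => ?_) (fun h => ?_) <;>
      simp only [Test.holds, Instr.apply] at h
    · have : e.eval s = 0 := by simpa [h1] using h
      refine (ih' hc.2.2 hd (hs.trans (h3.mono hd))).mono (by simp [this]) fun s₃ h => ?_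
      refine ⟨by simpa [run, this] using h.1, fun x hx hxd => (h.2 x hx hxd).trans (h3.1 x hxd)⟩
    · have : e.eval s ≠ 0 := by simpa [h1] using h
      refine (ih hc.2.1 hd (hs.trans (h3.mono hd))).mono (by simp [this]) fun s₃ h => ?_
      refine ⟨by simpa [run, this] using h.1, fun x hx hxd => (h.2 x hx hxd).trans (h3.1 x hxd)⟩
  | rep e c ih =>
    refine ((e.compile_runs hc.1 hd hs).seq (τ' := (∑ i ∈ Finset.range (e.eval s),
      (c.cost (c.run^[i] s) + 2)) + 2) ?_).mono (by simp only [cost]; omega) (fun _ h => h)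
    rintro s₂ ⟨h1, h2⟩
    have hloop := Runs.loop (p := .seq (c.compile (d + 2)) (.instr (.succ (d + 1))))
      (x := d + 1) (y := d) (B := e.eval s) (τ := fun i => c.cost (c.run^[i] s) + 1)
      (s := s₂.setReg (d + 1) 0)
      (I := fun i s' => s'.reg (d + 1) = i ∧ s'.reg d = e.eval s ∧ Agree m (c.run^[i] s) s' ∧
        ∀ x, m ≤ x → x < d → s'.reg x = s₁.reg x) (fun i s' h => ⟨h.1, h.2.1⟩) ?_ ?_
    · refine (Runs.step hloop).mono le_rfl ?_
      rintro s₃ ⟨-, -, h3, h4⟩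
      exact ⟨h3, h4⟩
    · rintro i - s₃ ⟨h3, h4, h5, h6⟩
      refine (ih hc.2 (d := d + 2) (by omega) h5).seq ?_
      rintro s₄ ⟨h7, h8⟩
      refine Runs.instr ⟨by simp [Instr.apply, h8 (d + 1) (by omega) (by omega), h3],
        by simp [Instr.apply, h8 d (by omega) (by omega), h4], ?_, ?_⟩
      · rw [Function.iterate_succ_apply']
        exact h7.setReg_right (by omega) _
      · intro y hy hyd
        have : y ≠ d + 1 := by omega
        simp [Instr.apply, this, h8 y hy (by omega), h6 y hy hyd]
    · exact ⟨by simp, by simp [h1], (hs.trans (h2.mono hd)).setReg_right (by omega) _,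
        fun x hx hxd => by
          have : x ≠ d + 1 := by omega
          simp [this, h2.1 x hxd]⟩

end RAM

namespace RAM

/-! ### Logical connectives and derived commands -/

namespace Expr

/-- Negation. -/
def not (a : Expr) : Expr := op .eq a (const 0)

/-- Conjunction. -/
def and (a b : Expr) : Expr := cond a b (const 0)

/-- Disjunction. -/
def or (a b : Expr) : Expr := cond a (const 1) b

/-- Equivalence. -/
def iff (a b : Expr) : Expr := op .eq a.not b.not

/-- Bounded universal quantification. -/
def all (x : ℕ) (b e : Expr) : Expr := (ex x b e.not).not

/-- Conjunction over a list. -/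
def allList {ι : Type*} (l : List ι) (f : ι → Expr) : Expr :=
  l.foldr (fun i e => (f i).and e) (const 1)

/-- Disjunction over a list. -/
def exList {ι : Type*} (l : List ι) (f : ι → Expr) : Expr :=
  l.foldr (fun i e => (f i).or e) (const 0)

/-- The expression is true, that is, its value is not `0`. -/
def Tr (e : Expr) (s : State) : Prop := e.eval s ≠ 0

variable {s : State} {a b : Expr}

@[simp] theorem tr_not : a.not.Tr s ↔ ¬ a.Tr s := by
  by_cases h : a.eval s = 0 <;> simp [Tr, not, eval, Op.fn, h]

@[simp] theorem tr_and : (a.and b).Tr s ↔ a.Tr s ∧ b.Tr s := by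
  by_cases h : a.eval s = 0 <;> simp [Tr, and, eval, h]

@[simp] theorem tr_or : (a.or b).Tr s ↔ a.Tr s ∨ b.Tr s := by
  by_cases h : a.eval s = 0 <;> simp [Tr, or, eval, h]

@[simp] theorem tr_iff : (a.iff b).Tr s ↔ (a.Tr s ↔ b.Tr s) := by
  by_cases h : a.eval s = 0 <;> by_cases h' : b.eval s = 0 <;>
    simp [Tr, iff, not, eval, Op.fn, h, h']

@[simp] theorem tr_ex {x : ℕ} : (ex x b a).Tr s ↔ ∃ i < b.eval s, a.Tr (s.setReg x i) := by
  simp [Tr, eval]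

@[simp] theorem tr_all {x : ℕ} : (all x b a).Tr s ↔ ∀ i < b.eval s, a.Tr (s.setReg x i) := by
  simp [all]

@[simp] theorem tr_eq : (op .eq a b).Tr s ↔ a.eval s = b.eval s := by
  simp [Tr, eval, Op.fn]

@[simp] theorem tr_lt : (op .lt a b).Tr s ↔ a.eval s < b.eval s := by
  simp [Tr, eval, Op.fn]

@[simp] theorem tr_load {k : ℕ} : (load k a).Tr s ↔ s.mem k (a.eval s) ≠ 0 := Iff.rfl

@[simp] theorem tr_allList {ι : Type*} {l : List ι} {f : ι → Expr} :
    (allList l f).Tr s ↔ ∀ i ∈ l, (f i).Tr s := by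
  induction l with
  | nil => simp [allList, Tr, eval]
  | cons i l ih =>
    have : allList (i :: l) f = (f i).and (allList l f) := rfl
    simp [this, ih]

@[simp] theorem tr_exList {ι : Type*} {l : List ι} {f : ι → Expr} :
    (exList l f).Tr s ↔ ∃ i ∈ l, (f i).Tr s := by
  induction l with
  | nil => simp [exList, Tr, eval]
  | cons i l ih =>
    have : exList (i :: l) f = (f i).or (exList l f) := rfl
    simp [this, ih]

end Expr

namespace Cmd

/-- `fill k y x z e` writes the values of `e` for `x = 0, 1, …` into a segment of array `k`. The
register `y` holds the first address and the register `z` the length of the segment. -/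
def fill (k y x z : ℕ) (e : Expr) : Cmd :=
  .seq (.assign x (.const 0)) (.rep (.var z)
    (.seq (.store k (.op .add (.var y) (.var x)) e)
      (.assign x (.op .add (.var x) (.const 1)))))

/-- The array cells with the values `g` in the segment of length `len` from address `a` on. -/
def segment (f : ℕ → ℕ) (a len : ℕ) (g : ℕ → ℕ) : ℕ → ℕ :=
  fun i => if a ≤ i ∧ i < a + len then g (i - a) else f i

theorem segment_zero (f : ℕ → ℕ) (a : ℕ) (g : ℕ → ℕ) : segment f a 0 g = f := by
  funext i
  simp only [segment]
  rw [if_neg (by omega)]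

theorem segment_succ (f : ℕ → ℕ) (a len : ℕ) (g : ℕ → ℕ) :
    segment f a (len + 1) g = Function.update (segment f a len g) (a + len) (g len) := by
  funext i
  simp only [segment, Function.update_apply]
  by_cases h : i = a + len
  · subst h
    simp
  · rw [if_neg h]
    congr 1
    simp only [eq_iff_iff]
    omega

theorem segment_of_lt {f : ℕ → ℕ} {a len : ℕ} {g : ℕ → ℕ} {i : ℕ} (h : i < len) :
    segment f a len g (a + i) = g i := by
  simp [segment, h]

theorem segment_of_not {f : ℕ → ℕ} {a len : ℕ} {g : ℕ → ℕ} {i : ℕ}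
    (h : i < a ∨ a + len ≤ i) : segment f a len g i = f i := by
  simp only [segment]
  rw [if_neg (by omega)]

/-- The state after `j` rounds of the loop of `fill`. The expression is evaluated while the segment
is being written, so it has to have the right value in each partially written state. -/
theorem fill_iterate {k y x z : ℕ} {e : Expr} {s : State} {g : ℕ → ℕ} (hy : y ≠ x)
    (hg : ∀ j < s.reg z, e.eval ⟨Function.update s.reg x j,
      Function.update s.mem k (segment (s.mem k) (s.reg y) j g)⟩ = g j) {j : ℕ}
    (hj : j ≤ s.reg z) :
    (run (.seq (.store k (.op .add (.var y) (.var x)) e)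
      (.assign x (.op .add (.var x) (.const 1)))))^[j] (s.setReg x 0) =
      ⟨Function.update s.reg x j, Function.update s.mem k (segment (s.mem k) (s.reg y) j g)⟩ := by
  induction j with
  | zero => simp [segment_zero, State.setReg]
  | succ j ih =>
    rw [Function.iterate_succ_apply', ih (by omega)]
    simp only [run, State.setReg, State.setMem, Expr.eval, Op.fn, hg j hj, segment_succ]
    simp [hy]

/-- The effect of `fill`, for an expression whose values do not change while the segment is
written. -/
theorem fill_run {k y x z : ℕ} {e : Expr} {s : State} {g : ℕ → ℕ} (hy : y ≠ x) (hz : z ≠ x)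
    (hg : ∀ j < s.reg z, e.eval ⟨Function.update s.reg x j,
      Function.update s.mem k (segment (s.mem k) (s.reg y) j g)⟩ = g j) :
    (fill k y x z e).run s = ⟨Function.update s.reg x (s.reg z),
      Function.update s.mem k (segment (s.mem k) (s.reg y) (s.reg z) g)⟩ := by
  have : (Expr.var z).eval (s.setReg x 0) = s.reg z := by simp [Expr.eval, hz]
  rw [fill, run, run, run, Expr.eval, this]
  exact fill_iterate hy hg le_rfl

end Cmd

/-! ### Polynomial bounds on running times

Registers from `12` to `31` hold the numbers that may be used as loop bounds and in arithmetic;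
registers below `12` hold addresses, vertices and counters that may be large. -/

/-- The small registers hold numbers that are at most `N`. -/
def SmallRegs (N : ℕ) (s : State) : Prop := ∀ x, 12 ≤ x → x < 32 → s.reg x ≤ N

/-- `f` is bounded by a fixed power of `N` in all states with property `I N`. -/
def PolyOn (I : ℕ → State → Prop) (f : State → ℕ) : Prop :=
  ∃ K, ∀ N, 2 ≤ N → ∀ s, I N s → f s ≤ N ^ K

namespace PolyOn

variable {I J : ℕ → State → Prop} {f g : State → ℕ}

theorem mono (hf : PolyOn I f) (h : ∀ N s, I N s → g s ≤ f s) : PolyOn I g := by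
  obtain ⟨K, hK⟩ := hf
  exact ⟨K, fun N hN s hs => (h N s hs).trans (hK N hN s hs)⟩

theorem weaken (hf : PolyOn J f) (h : ∀ N s, I N s → J N s) : PolyOn I f := by
  obtain ⟨K, hK⟩ := hf
  exact ⟨K, fun N hN s hs => hK N hN s (h N s hs)⟩

theorem const (c : ℕ) : PolyOn I fun _ => c :=
  ⟨c, fun _ hN _ _ => (Nat.lt_two_pow_self).le.trans (Nat.pow_le_pow_left hN c)⟩

theorem of_le (h : ∀ N s, I N s → f s ≤ N) : PolyOn I f :=
  ⟨1, fun N _ s hs => by simpa using h N s hs⟩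

theorem mul (hf : PolyOn I f) (hg : PolyOn I g) : PolyOn I fun s => f s * g s := by
  obtain ⟨K, hK⟩ := hf
  obtain ⟨K', hK'⟩ := hg
  refine ⟨K + K', fun N hN s hs => ?_⟩
  rw [pow_add]
  exact Nat.mul_le_mul (hK N hN s hs) (hK' N hN s hs)

theorem add (hf : PolyOn I f) (hg : PolyOn I g) : PolyOn I fun s => f s + g s := by
  obtain ⟨K, hK⟩ := hf
  obtain ⟨K', hK'⟩ := hg
  refine ⟨K + K' + 1, fun N hN s hs => ?_⟩
  have h1 := hK N hN s hs
  have h2 := hK' N hN s hs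
  have h3 : N ^ K ≤ N ^ (K + K') := Nat.pow_le_pow_right (by omega) (by omega)
  have h4 : N ^ K' ≤ N ^ (K + K') := Nat.pow_le_pow_right (by omega) (by omega)
  rw [pow_succ]
  nlinarith

theorem ite {p : State → Prop} [DecidablePred p] (hf : PolyOn (fun N s => I N s ∧ p s) f)
    (hg : PolyOn (fun N s => I N s ∧ ¬ p s) g) :
    PolyOn I fun s => if p s then f s else g s := by
  obtain ⟨K, hK⟩ := hf
  obtain ⟨K', hK'⟩ := hg
  refine ⟨K + K', fun N hN s hs => ?_⟩
  have h3 : N ^ K ≤ N ^ (K + K') := Nat.pow_le_pow_right (by omega) (by omega)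
  have h4 : N ^ K' ≤ N ^ (K + K') := Nat.pow_le_pow_right (by omega) (by omega)
  by_cases h : p s
  · simpa [h] using (hK N hN s ⟨hs, h⟩).trans h3
  · simpa [h] using (hK' N hN s ⟨hs, h⟩).trans h4

/-- A sum whose terms are values of `f` at states `t s i` with property `J`, possibly for a
polynomially larger bound. -/
theorem sum {t : State → ℕ → State} (hg : PolyOn I g) (hf : PolyOn J f) {K₀ : ℕ}
    (h : ∀ N, 2 ≤ N → ∀ s, I N s → ∀ i < g s, J (N ^ (K₀ + 1)) (t s i)) :
    PolyOn I fun s => ∑ i ∈ Finset.range (g s), f (t s i) := by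
  obtain ⟨K, hK⟩ := hf
  obtain ⟨K', hK'⟩ := hg
  refine ⟨K' + (K₀ + 1) * K, fun N hN s hs => ?_⟩
  have h2 : 2 ≤ N ^ (K₀ + 1) := hN.trans (Nat.le_self_pow (by omega) N)
  calc ∑ i ∈ Finset.range (g s), f (t s i)
      ≤ ∑ i ∈ Finset.range (g s), N ^ ((K₀ + 1) * K) := by
        refine Finset.sum_le_sum fun i hi => ?_
        rw [pow_mul]
        exact hK _ h2 _ (h N hN s hs i (Finset.mem_range.1 hi))
    _ = g s * N ^ ((K₀ + 1) * K) := by simp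
    _ ≤ N ^ (K' + (K₀ + 1) * K) := by
        rw [pow_add]
        exact Nat.mul_le_mul_right _ (hK' N hN s hs)

end PolyOn

theorem SmallRegs.mono {N N' : ℕ} {s : State} (h : SmallRegs N s) (hN : N ≤ N') : SmallRegs N' s :=
  fun x h1 h2 => (h x h1 h2).trans hN

theorem SmallRegs.setReg {N : ℕ} {s : State} (h : SmallRegs N s) {x a : ℕ} (ha : x < 12 ∨ a ≤ N) :
    SmallRegs N (s.setReg x a) := by
  intro y h1 h2
  by_cases hxy : y = x
  · simp only [State.setReg_reg, hxy, if_true]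
    omega
  · simpa [hxy] using h y h1 h2

theorem SmallRegs.of_reg {N : ℕ} {s s' : State} (h : SmallRegs N s) (hr : s'.reg = s.reg) :
    SmallRegs N s' := fun x h1 h2 => by rw [hr]; exact h x h1 h2

namespace Expr

/-- A syntactic condition under which the value of an expression is bounded by a power of a bound
for the small registers. -/
def Sm : Expr → Prop
  | const _ => True
  | var x => 12 ≤ x ∧ x < 32
  | load _ _ => False
  | op .add a b => a.Sm ∧ b.Sm
  | op .mul a b => a.Sm ∧ b.Sm
  | op .sub a _ => a.Sm
  | op .div a _ => a.Sm
  | op .mod a _ => a.Sm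
  | op .eq _ _ => True
  | op .lt _ _ => True
  | cond _ a b => a.Sm ∧ b.Sm
  | ex _ _ _ => True

/-- A syntactic condition under which the cost of an expression is bounded by a power of a bound
for the small registers: numbers from large registers and from arrays are not used as bounds of
quantifiers or for counting. -/
def Ok : Expr → Prop
  | const _ => True
  | var x => x < 32
  | load _ e => e.Ok
  | op .add a b => a.Ok ∧ b.Ok ∧ b.Sm
  | op .sub a b => a.Ok ∧ b.Ok ∧ b.Sm
  | op .mul a b => a.Ok ∧ b.Ok ∧ a.Sm ∧ b.Sm
  | op .div a b => a.Ok ∧ b.Ok ∧ a.Sm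
  | op .mod a b => a.Ok ∧ b.Ok ∧ a.Sm
  | op .eq a b => a.Ok ∧ b.Ok
  | op .lt a b => a.Ok ∧ b.Ok
  | cond c a b => c.Ok ∧ a.Ok ∧ b.Ok
  | ex x b e => 12 ≤ x ∧ x < 32 ∧ b.Ok ∧ b.Sm ∧ e.Ok

theorem Ok.wf {e : Expr} (h : e.Ok) : e.WF 32 := by
  induction e with
  | const => trivial
  | var => exact h
  | load k e ih => exact ih h
  | op o a b iha ihb => cases o <;> exact ⟨iha h.1, ihb (by simp only [Ok] at h; tauto)⟩
  | cond c a b ihc iha ihb => exact ⟨ihc h.1, iha h.2.1, ihb h.2.2⟩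
  | ex x b e ihb ihe => exact ⟨h.2.1, ihb h.2.2.1, ihe h.2.2.2.2⟩

theorem Sm.polyOn {e : Expr} (h : e.Sm) : PolyOn SmallRegs e.eval := by
  induction e with
  | const c => exact .const c
  | var x => exact .of_le fun N s hs => hs x h.1 h.2
  | load k e ih => exact h.elim
  | op o a b iha ihb =>
    cases o with
    | add => exact (iha h.1).add (ihb h.2)
    | mul => exact (iha h.1).mul (ihb h.2)
    | sub => exact (iha h).mono fun N s _ => Nat.sub_le _ _
    | div => exact (iha h).mono fun N s _ => Nat.div_le_self _ _
    | mod => exact (iha h).mono fun N s _ => Nat.mod_le _ _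
    | eq => exact (PolyOn.const 1).mono fun N s _ => by simp only [eval, Op.fn]; split <;> simp
    | lt => exact (PolyOn.const 1).mono fun N s _ => by simp only [eval, Op.fn]; split <;> simp
  | cond c a b ihc iha ihb =>
    exact ((iha h.1).weaken fun N s hs => hs.1).ite ((ihb h.2).weaken fun N s hs => hs.1)
  | ex x b e ihb ihe =>
    exact (PolyOn.const 1).mono fun N s _ => by simp only [eval]; split <;> simp

theorem Ok.polyOn {e : Expr} (h : e.Ok) : PolyOn SmallRegs e.cost := by
  induction e with
  | const c => exact .const 1
  | var x => exact .const 1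
  | load k e ih => exact (ih h).add (.const 1)
  | op o a b iha ihb =>
    have hab : PolyOn SmallRegs fun s => a.cost s + b.cost s := by
      cases o <;> exact (iha h.1).add (ihb (by simp only [Ok] at h; tauto))
    refine hab.add ?_
    cases o with
    | add => exact ((PolyOn.const 3).mul h.2.2.polyOn).add (.const 2)
    | sub => exact ((PolyOn.const 3).mul h.2.2.polyOn).add (.const 2)
    | mul =>
      exact (((PolyOn.const 3).mul (h.2.2.1.polyOn.mul h.2.2.2.polyOn)).add
        ((PolyOn.const 6).mul h.2.2.1.polyOn)).add (.const 6)
    | div => exact ((PolyOn.const 7).mul h.2.2.polyOn).add (.const 6)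
    | mod => exact ((PolyOn.const 7).mul h.2.2.polyOn).add (.const 6)
    | eq => exact .const 2
    | lt => exact .const 2
  | cond c a b ihc iha ihb =>
    exact ((ihc h.1).add (((iha h.2.1).weaken fun N s hs => hs.1).ite
      ((ihb h.2.2).weaken fun N s hs => hs.1))).add (.const 2)
  | ex x b e ihb ihe =>
    obtain ⟨h1, h2, h3, h4, h5⟩ := h
    obtain ⟨K, hK⟩ := h4.polyOn
    refine ((ihb h3).add (PolyOn.sum (J := SmallRegs) (t := fun s i => s.setReg x i)
      (f := fun s => e.cost s + 6) (K₀ := K) h4.polyOn ((ihe h5).add (.const 6)) ?_)).add (.const 6)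
    intro N hN s hs i hi
    have hKN := hK N hN s hs
    have h6 : N ^ K ≤ N ^ (K + 1) := Nat.pow_le_pow_right (by omega) (by omega)
    exact (hs.mono (Nat.le_self_pow (by omega) N)).setReg (.inr (by omega))

@[simp] theorem ok_not {a : Expr} : a.not.Ok ↔ a.Ok := by simp [not, Ok]

@[simp] theorem ok_and {a b : Expr} : (a.and b).Ok ↔ a.Ok ∧ b.Ok := by simp [and, Ok]

@[simp] theorem ok_or {a b : Expr} : (a.or b).Ok ↔ a.Ok ∧ b.Ok := by simp [or, Ok]

@[simp] theorem ok_iff {a b : Expr} : (a.iff b).Ok ↔ a.Ok ∧ b.Ok := by simp [iff, Ok]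

@[simp] theorem ok_all {x : ℕ} {b e : Expr} :
    (all x b e).Ok ↔ 12 ≤ x ∧ x < 32 ∧ b.Ok ∧ b.Sm ∧ e.Ok := by simp [all, Ok]

@[simp] theorem ok_allList {ι : Type*} {l : List ι} {f : ι → Expr} :
    (allList l f).Ok ↔ ∀ i ∈ l, (f i).Ok := by
  induction l with
  | nil => simp [allList, Ok]
  | cons i l ih =>
    have : allList (i :: l) f = (f i).and (allList l f) := rfl
    simp [this, ih]

@[simp] theorem ok_exList {ι : Type*} {l : List ι} {f : ι → Expr} :
    (exList l f).Ok ↔ ∀ i ∈ l, (f i).Ok := by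
  induction l with
  | nil => simp [exList, Ok]
  | cons i l ih =>
    have : exList (i :: l) f = (f i).or (exList l f) := rfl
    simp [this, ih]

end Expr

namespace Cmd

theorem polyOn_assign {x : ℕ} {e : Expr} (he : e.Ok) : PolyOn SmallRegs (assign x e).cost :=
  he.polyOn.add (.const 1)

theorem polyOn_store {k : ℕ} {a e : Expr} (ha : a.Ok) (he : e.Ok) :
    PolyOn SmallRegs (store k a e).cost :=
  (ha.polyOn.add he.polyOn).add (.const 1)

theorem polyOn_seq {I J : ℕ → State → Prop} {c c' : Cmd} (hc : PolyOn I c.cost)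
    (hc' : PolyOn J c'.cost) (h : ∀ N s, I N s → J N (c.run s)) :
    PolyOn I (seq c c').cost := by
  refine hc.add ?_
  obtain ⟨K, hK⟩ := hc'
  exact ⟨K, fun N hN s hs => hK N hN _ (h N s hs)⟩

theorem polyOn_ite {I : ℕ → State → Prop} {e : Expr} {c c' : Cmd} (he : PolyOn I e.cost)
    (hc : PolyOn (fun N s => I N s ∧ e.eval s ≠ 0) c.cost)
    (hc' : PolyOn (fun N s => I N s ∧ ¬ e.eval s ≠ 0) c'.cost) :
    PolyOn I (ite e c c').cost :=
  (he.add (hc.ite hc')).add (.const 2)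

theorem polyOn_rep {I J : ℕ → State → Prop} {e : Expr} {c : Cmd} (he : PolyOn I e.cost)
    (hv : PolyOn I e.eval) (hc : PolyOn J c.cost)
    (h : ∀ N s, I N s → ∀ i < e.eval s, J N (c.run^[i] s)) : PolyOn I (rep e c).cost := by
  refine (he.add (PolyOn.sum (J := fun N s => ∃ M, M ^ 1 = N ∧ J M s) (t := fun s i => c.run^[i] s)
    (f := fun s => c.cost s + 2) (K₀ := 0) hv ?_ ?_)).add (.const 2)
  · refine (hc.add (.const 2)).weaken ?_
    rintro N s ⟨M, rfl, h⟩
    simpa using h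
  · intro N hN s hs i hi
    exact ⟨N, by simp, h N s hs i hi⟩

theorem polyOn_fill {k y x z : ℕ} {e : Expr} (hx : 12 ≤ x) (hx' : x < 32) (hz : 12 ≤ z)
    (hz' : z < 32) (hy : y < 32) (he : e.Ok) :
    PolyOn SmallRegs (fill k y x z e).cost := by
  have key : ∀ (s : State) (j : ℕ), ((run (.seq (.store k (.op .add (.var y) (.var x)) e)
      (.assign x (.op .add (.var x) (.const 1)))))^[j] (s.setReg x 0)).reg =
      Function.update s.reg x j := by
    intro s j
    induction j with
    | zero => rfl
    | succ j ih =>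
      rw [Function.iterate_succ_apply']
      generalize (run (.seq (.store k (.op .add (.var y) (.var x)) e)
        (.assign x (.op .add (.var x) (.const 1)))))^[j] (s.setReg x 0) = s' at ih ⊢
      simp [run, State.setReg, State.setMem, ih, Expr.eval, Op.fn]
  refine polyOn_seq (J := fun N s => SmallRegs N s ∧ s.reg x = 0) (polyOn_assign trivial)
    (polyOn_rep
    (J := SmallRegs) (.const 1) (.of_le fun N s hs => hs.1 z hz hz') ?_ ?_) ?_
  · exact polyOn_seq (J := SmallRegs) (polyOn_store ⟨hy, hx', hx, hx'⟩ he)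
      (polyOn_assign ⟨hx', trivial, trivial⟩) fun N s hs => hs.of_reg rfl
  · rintro N s ⟨hs, h0⟩ i hi
    have h1 := key s i
    have h2 : s.setReg x 0 = s := by
      rw [← h0]
      exact s.setReg_self x
    rw [h2] at h1
    refine SmallRegs.of_reg (hs.setReg (x := x) (a := i) (.inr ?_)) h1
    have := hs z hz hz'
    simp only [Expr.eval] at hi
    omega
  · intro N s hs
    exact ⟨hs.setReg (.inr (Nat.zero_le _)), by simp [run, Expr.eval]⟩

theorem wf_fill {k y x z : ℕ} {e : Expr} (hx : x < 32) (hz : z < 32) (hy : y < 32) (he : e.Ok) :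
    (fill k y x z e).WF 32 := by
  simp [fill, WF, Expr.WF, hx, hy, hz, he.wf]

end Cmd

end RAM

/-! ### Separation in nice tree decompositions -/

namespace NiceTree

section
variable {V : Type} [DecidableEq V]

/-- The vertices that are forgotten somewhere in the tree. -/
def forg : NiceTree V → Finset V
  | leaf => ∅
  | introduce _ T => T.forg
  | forget v T => insert v T.forg
  | join T₁ T₂ => T₁.forg ∪ T₂.forg

/-- The forget nodes in post-order, each given by the forgotten vertex and the bag of the child. -/
def forgets : NiceTree V → List (V × Finset V)
  | leaf => []
  | introduce _ T => T.forgets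
  | forget v T => T.forgets ++ [(v, T.rootBag)]
  | join T₁ T₂ => T₁.forgets ++ T₂.forgets

/-- What the algorithm uses of a nice tree decomposition, as a condition on the nodes: an introduced
vertex is new, a forgotten vertex has all its neighbours in the bags seen so far, and the subtrees
of a join node share exactly the vertices of the common bag. -/
def Sep (G : SimpleGraph V) : NiceTree V → Prop
  | leaf => True
  | introduce v T => v ∉ T.rootBag ∧ v ∉ T.forg ∧ T.Sep G
  | forget v T => v ∈ T.rootBag ∧ (∀ u, G.Adj v u → u ∈ T.rootBag ∪ T.forg) ∧ T.Sep G
  | join T₁ T₂ => T₁.rootBag = T₂.rootBag ∧ Disjoint T₁.forg T₂.forg ∧ T₁.Sep G ∧ T₂.Sep G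

variable {G : SimpleGraph V}

theorem Sep.disjoint {T : NiceTree V} (h : T.Sep G) : Disjoint T.rootBag T.forg := by
  induction T with
  | leaf => simp [rootBag]
  | introduce v T ih => simpa [rootBag, forg, h.2.1] using ih h.2.2
  | forget v T ih =>
    have := ih h.2.2
    rw [Finset.disjoint_left] at this ⊢
    intro u hu hu'
    simp only [rootBag, forg, Finset.mem_erase, Finset.mem_insert] at hu hu'
    exact this hu.2 (hu'.resolve_left hu.1)
  | join T₁ T₂ ih₁ ih₂ =>
    obtain ⟨h1, h2, h3, h4⟩ := h
    simp only [rootBag, forg, Finset.disjoint_union_right]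
    exact ⟨ih₁ h3, h1 ▸ ih₂ h4⟩

/-- The root bag separates the forgotten vertices from the vertices outside the subtree. -/
theorem Sep.adj_mem {T : NiceTree V} (h : T.Sep G) {u w : V} (hu : u ∈ T.forg)
    (huw : G.Adj u w) : w ∈ T.rootBag ∪ T.forg := by
  induction T with
  | leaf => simp [forg] at hu
  | introduce v T ih =>
    have := ih h.2.2 hu
    simp only [rootBag, forg, Finset.mem_union, Finset.mem_insert] at this ⊢
    tauto
  | forget v T ih =>
    have h' : w ∈ T.rootBag ∪ T.forg := by
      rcases Finset.mem_insert.1 hu with rfl | hu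
      · exact h.2.1 w huw
      · exact ih h.2.2 hu
    simp only [rootBag, forg, Finset.mem_union, Finset.mem_insert, Finset.mem_erase] at h' ⊢
    tauto
  | join T₁ T₂ ih₁ ih₂ =>
    obtain ⟨h1, h2, h3, h4⟩ := h
    simp only [rootBag, forg, Finset.mem_union] at *
    rcases hu with hu | hu
    · have := ih₁ h3 hu
      tauto
    · have := ih₂ h4 hu
      rw [← h1] at this
      tauto

/-- A vertex occurs in a bag exactly if it is in the bag of the root or forgotten. -/
theorem LocallyNice.mem_iff {T : NiceTree V} (h : T.LocallyNice) (u : V) :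
    u ∈ T.rootBag ∪ T.forg ↔ ∃ i : T.Node, u ∈ bag i := by
  constructor
  · intro hu
    rcases Finset.mem_union.1 hu with hu | hu
    · exact ⟨.root T, by cases T <;> exact hu⟩
    induction T with
    | leaf => simp [forg] at hu
    | introduce v T ih =>
      obtain ⟨i, hi⟩ := ih h.2 (Finset.mem_union_right _ hu) hu
      exact ⟨.introduce i, hi⟩
    | forget v T ih =>
      rcases Finset.mem_insert.1 hu with rfl | hu
      · exact ⟨.forget (.root T), by cases T <;> exact h.1⟩
      · obtain ⟨i, hi⟩ := ih h.2 (Finset.mem_union_right _ hu) hu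
        exact ⟨.forget i, hi⟩
    | join T₁ T₂ ih₁ ih₂ =>
      rcases Finset.mem_union.1 hu with hu | hu
      · obtain ⟨i, hi⟩ := ih₁ h.2.1 (Finset.mem_union_right _ hu) hu
        exact ⟨.left i, hi⟩
      · obtain ⟨i, hi⟩ := ih₂ h.2.2 (Finset.mem_union_right _ hu) hu
        exact ⟨.right i, hi⟩
  · rintro ⟨i, hi⟩
    induction i with
    | root T => exact Finset.mem_union_left _ (by cases T <;> exact hi)
    | introduce i ih =>
      have := ih h.2 hi
      simp only [rootBag, forg, Finset.mem_union, Finset.mem_insert] at this ⊢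
      tauto
    | forget i ih =>
      have := ih h.2 hi
      simp only [rootBag, forg, Finset.mem_union, Finset.mem_insert, Finset.mem_erase] at this ⊢
      tauto
    | left i ih =>
      have := ih h.2.1 hi
      simp only [rootBag, forg, Finset.mem_union] at this ⊢
      tauto
    | right i ih =>
      have := ih h.2.2 hi
      rw [← h.1] at this
      simp only [rootBag, forg, Finset.mem_union] at this ⊢
      tauto

/-- The nodes whose bags contain `u` are connected, expressed by the absence of a cut: a property
of nodes that does not change along tree edges inside this set is constant on it. -/
def NoCut (u : V) (T : NiceTree V) : Prop :=
  ∀ Q : T.Node → Prop, (∀ i j, IsChild i j → u ∈ bag i → u ∈ bag j → (Q i ↔ Q j)) →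
    ∀ i j, u ∈ bag i → u ∈ bag j → (Q i ↔ Q j)

theorem noCut_of_connected {T : NiceTree V} {u : V}
    (h : (T.graph.induce {i | u ∈ bag i}).Connected) : NoCut u T := by
  intro Q hQ i j hi hj
  have key : ∀ x y : {i : T.Node | u ∈ bag i}, (T.graph.induce {i | u ∈ bag i}).Reachable x y →
      (Q x ↔ Q y) := by
    rintro x y ⟨p⟩
    induction p with
    | nil => rfl
    | @cons a b c hab p ih =>
      refine Iff.trans ?_ ih
      simp only [SimpleGraph.comap_adj, graph, SimpleGraph.fromRel_adj] at hab
      rcases hab.2 with h | h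
      · exact hQ _ _ h a.2 b.2
      · exact (hQ _ _ h b.2 a.2).symm
  exact key ⟨i, hi⟩ ⟨j, hj⟩ (h.preconnected _ _)

theorem NoCut.introduce {u v : V} {T : NiceTree V} (h : NoCut u (introduce v T)) : NoCut u T := by
  intro Q hQ i j hi hj
  let ρ : (NiceTree.introduce v T).Node → T.Node := fun x =>
    match x with
    | .root _ => .root T
    | .introduce y => y
  refine h (fun x => Q (ρ x)) ?_ (.introduce i) (.introduce j) hi hj
  intro x y hxy hx hy
  cases hxy with
  | introduce_root => rfl
  | introduce hxy => exact hQ _ _ hxy hx hy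

theorem NoCut.forget {u v : V} {T : NiceTree V} (h : NoCut u (forget v T)) : NoCut u T := by
  intro Q hQ i j hi hj
  let ρ : (NiceTree.forget v T).Node → T.Node := fun x =>
    match x with
    | .root _ => .root T
    | .forget y => y
  refine h (fun x => Q (ρ x)) ?_ (.forget i) (.forget j) hi hj
  intro x y hxy hx hy
  cases hxy with
  | forget_root => rfl
  | forget hxy => exact hQ _ _ hxy hx hy

theorem NoCut.left {u : V} {T₁ T₂ : NiceTree V} (h : NoCut u (join T₁ T₂)) : NoCut u T₁ := by
  intro Q hQ i j hi hj
  let ρ : (join T₁ T₂).Node → T₁.Node := fun x =>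
    match x with
    | .root _ => .root T₁
    | .left y => y
    | .right _ => .root T₁
  refine h (fun x => Q (ρ x)) ?_ (.left i) (.left j) hi hj
  intro x y hxy hx hy
  cases hxy with
  | left_root => rfl
  | right_root => rfl
  | left hxy => exact hQ _ _ hxy hx hy
  | right hxy => rfl

theorem NoCut.right {u : V} {T₁ T₂ : NiceTree V} (h : NoCut u (join T₁ T₂)) : NoCut u T₂ := by
  intro Q hQ i j hi hj
  let ρ : (join T₁ T₂).Node → T₂.Node := fun x =>
    match x with
    | .root _ => .root T₂
    | .left _ => .root T₂
    | .right y => y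
  refine h (fun x => Q (ρ x)) ?_ (.right i) (.right j) hi hj
  intro x y hxy hx hy
  cases hxy with
  | left_root => rfl
  | right_root => rfl
  | left hxy => rfl
  | right hxy => exact hQ _ _ hxy hx hy

theorem mem_bag_root {T : NiceTree V} {u : V} : u ∈ bag (.root T) ↔ u ∈ T.rootBag := by
  cases T <;> rfl

/-- A vertex cannot be introduced above a bag that contained it before. -/
theorem NoCut.not_introduced {v : V} {T : NiceTree V} (h : NoCut v (NiceTree.introduce v T))
    (hv : v ∉ T.rootBag) (i : T.Node) : v ∉ bag i := by
  intro hi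
  have := h (fun x => ∃ y, x = .introduce y) ?_ (.introduce i) (.root _) hi
    (by simp [mem_bag_root, rootBag])
  · obtain ⟨y, hy⟩ := this.1 ⟨i, rfl⟩
    cases hy
  · intro x y hxy hx hy
    cases hxy with
    | introduce_root => exact absurd (mem_bag_root.1 hx) hv
    | introduce hxy => simp

/-- A vertex that occurs in both subtrees of a join node is in its bag. -/
theorem NoCut.mem_of_both {u : V} {T₁ T₂ : NiceTree V} (h : NoCut u (join T₁ T₂)) {i : T₁.Node}
    (hi : u ∈ bag i) {j : T₂.Node} (hj : u ∈ bag j) : u ∈ T₁.rootBag := by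
  by_contra hu
  have := h (fun x => ∃ y, x = .left y) ?_ (.left i) (.right j) hi hj
  · obtain ⟨y, hy⟩ := this.1 ⟨i, rfl⟩
    cases hy
  · intro x y hxy hx hy
    cases hxy with
    | left_root => exact absurd (mem_bag_root.1 hx) hu
    | right_root => exact absurd (mem_bag_root.1 hy) hu
    | left hxy => simp
    | right hxy => simp

theorem disjoint_of_noCut {T : NiceTree V} (hT : T.LocallyNice) (hc : ∀ u, NoCut u T) :
    Disjoint T.rootBag T.forg := by
  induction T with
  | leaf => simp [rootBag]
  | introduce v T ih =>
    have hv : v ∉ T.forg := by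
      intro hv
      obtain ⟨i, hi⟩ := (hT.2.mem_iff v).1 (Finset.mem_union_right _ hv)
      exact (hc v).not_introduced hT.1 i hi
    simpa [rootBag, forg, hv] using ih hT.2 fun u => (hc u).introduce
  | forget v T ih =>
    have := ih hT.2 fun u => (hc u).forget
    rw [Finset.disjoint_left] at this ⊢
    intro u hu hu'
    simp only [rootBag, forg, Finset.mem_erase, Finset.mem_insert] at hu hu'
    exact this hu.2 (hu'.resolve_left hu.1)
  | join T₁ T₂ ih₁ ih₂ =>
    obtain ⟨h1, h2, h3⟩ := hT
    simp only [rootBag, forg, Finset.disjoint_union_right]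
    exact ⟨ih₁ h2 fun u => (hc u).left, h1 ▸ ih₂ h3 fun u => (hc u).right⟩

/-- The absence of cuts gives the separation. A vertex forgotten in a subtree does not occur outside
the subtree, so a bag that contains both ends of an edge at this vertex belongs to the subtree. In
particular, at its forget node, its neighbours are below this node, and the two sides of a join node
have no forgotten vertices in common. -/
theorem sep_of_noCut {T : NiceTree V} (hT : T.LocallyNice) (hc : ∀ u, NoCut u T)
    (he : ∀ u ∈ T.forg, ∀ w, G.Adj u w → ∃ i : T.Node, u ∈ bag i ∧ w ∈ bag i) : T.Sep G := by
  have hd := disjoint_of_noCut hT hc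
  have hroot : ∀ u ∈ T.forg, u ∉ bag (.root T) := fun u hu hu' =>
    Finset.disjoint_left.1 hd (mem_bag_root.1 hu') hu
  induction T with
  | leaf => trivial
  | introduce v T ih =>
    have hc' := fun u => (hc u).introduce
    have hd' := disjoint_of_noCut hT.2 hc'
    refine ⟨hT.1, ?_, ih hT.2 hc' ?_ hd' fun u hu hu' =>
      Finset.disjoint_left.1 hd' (mem_bag_root.1 hu') hu⟩
    · intro hv
      exact hroot v hv (mem_bag_root.2 (Finset.mem_insert_self _ _))
    · intro u hu w huw
      obtain ⟨i, hi, hi'⟩ := he u hu w huw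
      cases i with
      | root => exact absurd hi (hroot u hu)
      | introduce i => exact ⟨i, hi, hi'⟩
  | forget v T ih =>
    have hc' := fun u => (hc u).forget
    have hd' := disjoint_of_noCut hT.2 hc'
    have he' : ∀ u ∈ insert v T.forg, ∀ w, G.Adj u w → ∃ i : T.Node, u ∈ bag i ∧ w ∈ bag i := by
      intro u hu w huw
      obtain ⟨i, hi, hi'⟩ := he u hu w huw
      cases i with
      | root => exact absurd hi (hroot u hu)
      | forget i => exact ⟨i, hi, hi'⟩
    refine ⟨hT.1, fun u huv => ?_, ih hT.2 hc' (fun u hu => he' u (Finset.mem_insert_of_mem hu))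
      hd' fun u hu hu' => Finset.disjoint_left.1 hd' (mem_bag_root.1 hu') hu⟩
    obtain ⟨i, -, hi⟩ := he' v (Finset.mem_insert_self _ _) u huv
    exact (hT.2.mem_iff u).2 ⟨i, hi⟩
  | join T₁ T₂ ih₁ ih₂ =>
    have hc₁ := fun u => (hc u).left
    have hc₂ := fun u => (hc u).right
    have hd₁ := disjoint_of_noCut hT.2.1 hc₁
    have hd₂ := disjoint_of_noCut hT.2.2 hc₂
    have hboth : ∀ u (i : T₁.Node) (j : T₂.Node), u ∈ bag i → u ∈ bag j → u ∉ T₁.forg ∪ T₂.forg :=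
      fun u i j hi hj hu => hroot u hu (mem_bag_root.2 ((hc u).mem_of_both hi hj))
    refine ⟨hT.1, ?_, ih₁ hT.2.1 hc₁ ?_ hd₁ ?_, ih₂ hT.2.2 hc₂ ?_ hd₂ ?_⟩
    · rw [Finset.disjoint_left]
      intro u hu hu'
      obtain ⟨i, hi⟩ := (hT.2.1.mem_iff u).1 (Finset.mem_union_right _ hu)
      obtain ⟨j, hj⟩ := (hT.2.2.mem_iff u).1 (Finset.mem_union_right _ hu')
      exact hboth u i j hi hj (Finset.mem_union_left _ hu)
    · intro u hu w huw
      have hu' : u ∈ T₁.forg ∪ T₂.forg := Finset.mem_union_left _ hu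
      obtain ⟨i, hi, hi'⟩ := he u hu' w huw
      cases i with
      | root => exact absurd hi (hroot u hu')
      | left i => exact ⟨i, hi, hi'⟩
      | right i =>
        obtain ⟨j, hj⟩ := (hT.2.1.mem_iff u).1 (Finset.mem_union_right _ hu)
        exact absurd hu' (hboth u j i hj hi)
    · exact fun u hu hu' => Finset.disjoint_left.1 hd₁ (mem_bag_root.1 hu') hu
    · intro u hu w huw
      have hu' : u ∈ T₁.forg ∪ T₂.forg := Finset.mem_union_right _ hu
      obtain ⟨i, hi, hi'⟩ := he u hu' w huw
      cases i with
      | root => exact absurd hi (hroot u hu')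
      | right i => exact ⟨i, hi, hi'⟩
      | left i =>
        obtain ⟨j, hj⟩ := (hT.2.2.mem_iff u).1 (Finset.mem_union_right _ hu)
        exact absurd hu' (hboth u i j hi hj)
    · exact fun u hu hu' => Finset.disjoint_left.1 hd₂ (mem_bag_root.1 hu') hu

theorem IsNiceTreeDecomposition.sep {D : NiceTree V} (h : D.IsNiceTreeDecomposition G) :
    D.Sep G :=
  sep_of_noCut h.2 (fun u => noCut_of_connected (h.1.connected u))
    fun u _ w huw => h.1.edge_mem u w huw

theorem IsNiceTreeDecomposition.mem {D : NiceTree V} (h : D.IsNiceTreeDecomposition G) (v : V) :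
    v ∈ D.rootBag ∪ D.forg :=
  (h.2.mem_iff v).2 (h.1.vertex_mem v)

/-! ### Forget nodes and the length of the code -/

theorem mem_forg_of_mem_forgets {T : NiceTree V} {p : V × Finset V} (hp : p ∈ T.forgets) :
    p.1 ∈ T.forg := by
  induction T with
  | leaf => simp [forgets] at hp
  | introduce v T ih => exact ih hp
  | forget v T ih =>
    simp only [forgets, List.mem_append, List.mem_singleton] at hp
    rcases hp with hp | rfl
    · exact Finset.mem_insert_of_mem (ih hp)
    · exact Finset.mem_insert_self _ _
  | join T₁ T₂ ih₁ ih₂ =>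
    simp only [forgets, List.mem_append] at hp
    exact Finset.mem_union.2 (hp.imp ih₁ ih₂)

theorem exists_mem_forgets {T : NiceTree V} {v : V} (hv : v ∈ T.forg) :
    ∃ B, (v, B) ∈ T.forgets := by
  induction T with
  | leaf => simp [forg] at hv
  | introduce u T ih => exact ih hv
  | forget u T ih =>
    rcases Finset.mem_insert.1 hv with rfl | hv
    · exact ⟨T.rootBag, by simp [forgets]⟩
    · obtain ⟨B, hB⟩ := ih hv
      exact ⟨B, by simp [forgets, hB]⟩
  | join T₁ T₂ ih₁ ih₂ =>
    rcases Finset.mem_union.1 hv with hv | hv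
    · obtain ⟨B, hB⟩ := ih₁ hv
      exact ⟨B, by simp [forgets, hB]⟩
    · obtain ⟨B, hB⟩ := ih₂ hv
      exact ⟨B, by simp [forgets, hB]⟩

theorem Sep.mem_of_mem_forgets {T : NiceTree V} (h : T.Sep G) {p : V × Finset V}
    (hp : p ∈ T.forgets) : p.1 ∈ p.2 ∧ p.2 ⊆ T.rootBag ∪ T.forg := by
  induction T with
  | leaf => simp [forgets] at hp
  | introduce v T ih =>
    refine (ih h.2.2 hp).imp_right fun h' => h'.trans ?_
    exact Finset.union_subset_union_left (Finset.subset_insert _ _)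
  | forget v T ih =>
    have hsub : T.rootBag ∪ T.forg ⊆ (forget v T).rootBag ∪ (forget v T).forg := by
      intro u
      simp only [rootBag, forg, Finset.mem_union, Finset.mem_erase, Finset.mem_insert]
      tauto
    simp only [forgets, List.mem_append, List.mem_singleton] at hp
    rcases hp with hp | rfl
    · exact (ih h.2.2 hp).imp_right fun h' => h'.trans hsub
    · exact ⟨h.1, Finset.subset_union_left.trans hsub⟩
  | join T₁ T₂ ih₁ ih₂ =>
    obtain ⟨h1, h2, h3, h4⟩ := h
    simp only [forgets, List.mem_append] at hp
    rcases hp with hp | hp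
    · refine (ih₁ h3 hp).imp_right fun h' => h'.trans ?_
      exact Finset.union_subset_union_right Finset.subset_union_left
    · refine (ih₂ h4 hp).imp_right fun h' => h'.trans ?_
      rw [← h1]
      exact Finset.union_subset_union_right Finset.subset_union_right

theorem WidthLE.of_introduce {t : ℕ} {v : V} {T : NiceTree V} (h : (introduce v T).WidthLE t) :
    T.WidthLE t := fun i => h (.introduce i)

theorem WidthLE.of_forget {t : ℕ} {v : V} {T : NiceTree V} (h : (forget v T).WidthLE t) :
    T.WidthLE t := fun i => h (.forget i)

theorem WidthLE.of_left {t : ℕ} {T₁ T₂ : NiceTree V} (h : (join T₁ T₂).WidthLE t) :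
    T₁.WidthLE t := fun i => h (.left i)

theorem WidthLE.of_right {t : ℕ} {T₁ T₂ : NiceTree V} (h : (join T₁ T₂).WidthLE t) :
    T₂.WidthLE t := fun i => h (.right i)

theorem WidthLE.rootBag {t : ℕ} {T : NiceTree V} (h : T.WidthLE t) : T.rootBag.card ≤ t + 1 := by
  have := h (.root T)
  cases T <;> exact this

theorem WidthLE.forget {t : ℕ} {T : NiceTree V} (h : T.WidthLE t) (v : V) :
    (forget v T).WidthLE t := by
  intro i
  cases i with
  | root => exact (Finset.card_le_card (Finset.erase_subset _ _)).trans h.rootBag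
  | forget i => exact h i

/-- The tree with forget nodes for the vertices of the list `l` put on top of the root. -/
def forgetAll (T : NiceTree V) : List V → NiceTree V
  | [] => T
  | v :: l => (forget v T).forgetAll l

theorem forg_forgetAll (T : NiceTree V) (l : List V) :
    (T.forgetAll l).forg = T.forg ∪ l.toFinset := by
  induction l generalizing T with
  | nil => simp [forgetAll]
  | cons v l ih => simp [forgetAll, ih, forg]

/-- Forget nodes may be put on top of the root without losing separation when the tree contains all
vertices of the graph. -/
theorem Sep.forgetAll {T : NiceTree V} (h : T.Sep G) (hT : ∀ v, v ∈ T.rootBag ∪ T.forg)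
    {l : List V} (hl : l.Nodup) (hlT : ∀ v ∈ l, v ∈ T.rootBag) : (T.forgetAll l).Sep G := by
  induction l generalizing T with
  | nil => exact h
  | cons v l ih =>
    have hl' := List.nodup_cons.1 hl
    refine ih (T := .forget v T) ⟨hlT v (by simp), fun u _ => hT u, h⟩ ?_ hl'.2 ?_
    · intro u
      have := hT u
      simp only [rootBag, forg, Finset.mem_union, Finset.mem_erase, Finset.mem_insert] at this ⊢
      tauto
    · intro u hu
      refine Finset.mem_erase.2 ⟨?_, hlT u (by simp [hu])⟩
      rintro rfl
      exact hl'.1 hu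

theorem WidthLE.forgetAll {t : ℕ} {T : NiceTree V} (h : T.WidthLE t) (l : List V) :
    (T.forgetAll l).WidthLE t := by
  induction l generalizing T with
  | nil => exact h
  | cons v l ih => exact ih (h.forget v)

end

theorem code_forgetAll {n : ℕ} (T : NiceTree (Fin n)) (l : List (Fin n)) :
    (T.forgetAll l).code = T.code ++ l.map fun v : Fin n => (2, (v : ℕ)) := by
  induction l generalizing T with
  | nil => simp [forgetAll]
  | cons v l ih => simp [forgetAll, ih, code]

theorem finite_node_and_card {n : ℕ} (T : NiceTree (Fin n)) :
    Finite T.Node ∧ Nat.card T.Node = T.code.length := by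
  induction T with
  | leaf =>
    let e : (leaf : NiceTree (Fin n)).Node ≃ Unit :=
      { toFun := fun _ => ()
        invFun := fun _ => .root _
        left_inv := fun x => by cases x; rfl
        right_inv := fun _ => rfl }
    exact ⟨.of_equiv _ e.symm, by simp [Nat.card_congr e, code]⟩
  | introduce v T ih =>
    obtain ⟨_, ih⟩ := ih
    let e : (introduce v T).Node ≃ Option T.Node :=
      { toFun := fun x => match x with
          | .root _ => none
          | .introduce i => some i
        invFun := fun x => x.elim (.root _) .introduce
        left_inv := fun x => by cases x <;> rfl
        right_inv := fun x => by cases x <;> rfl }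
    exact ⟨.of_equiv _ e.symm, by simp [Nat.card_congr e, code, ih, Finite.card_option]⟩
  | forget v T ih =>
    obtain ⟨_, ih⟩ := ih
    let e : (forget v T).Node ≃ Option T.Node :=
      { toFun := fun x => match x with
          | .root _ => none
          | .forget i => some i
        invFun := fun x => x.elim (.root _) .forget
        left_inv := fun x => by cases x <;> rfl
        right_inv := fun x => by cases x <;> rfl }
    exact ⟨.of_equiv _ e.symm, by simp [Nat.card_congr e, code, ih, Finite.card_option]⟩
  | join T₁ T₂ ih₁ ih₂ =>
    obtain ⟨_, ih₁⟩ := ih₁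
    obtain ⟨_, ih₂⟩ := ih₂
    let e : (join T₁ T₂).Node ≃ Option (T₁.Node ⊕ T₂.Node) :=
      { toFun := fun x => match x with
          | .root _ => none
          | .left i => some (.inl i)
          | .right i => some (.inr i)
        invFun := fun x => x.elim (.root _) (Sum.elim .left .right)
        left_inv := fun x => by cases x <;> rfl
        right_inv := fun x => by rcases x with _ | _ | _ <;> rfl }
    exact ⟨.of_equiv _ e.symm,
      by simp [Nat.card_congr e, code, ih₁, ih₂, Finite.card_option, Nat.add_assoc]⟩

theorem code_length_pos {n : ℕ} (T : NiceTree (Fin n)) : 0 < T.code.length := by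
  cases T <;> simp [code]

/-- A graph with a tree decomposition of width `t` has at most `(t + 1) ^ 2` edges per node. -/
theorem edges_length_le {n t : ℕ} {G : SimpleGraph (Fin n)} {es : List (Fin n × Fin n)}
    {D : NiceTree (Fin n)} (hes : ListsEdges es G) (hD : D.IsNiceTreeDecomposition G)
    (ht : D.WidthLE t) : es.length ≤ D.code.length * (t + 1) ^ 2 := by
  classical
  obtain ⟨_, hcard⟩ := finite_node_and_card D
  have := Fintype.ofFinite D.Node
  have hn : es.Nodup := List.Nodup.of_map _ hes.1
  rw [← List.toFinset_card_of_nodup hn, ← hcard, Nat.card_eq_fintype_card]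
  calc es.toFinset.card
      ≤ (Finset.univ.biUnion fun i : D.Node => bag i ×ˢ bag i).card := by
        refine Finset.card_le_card fun e he => ?_
        have hadj : G.Adj e.1 e.2 :=
          (hes.2 _ _).2 (List.mem_map.2 ⟨e, List.mem_toFinset.1 he, rfl⟩)
        obtain ⟨i, hi, hi'⟩ := hD.1.edge_mem _ _ hadj
        exact Finset.mem_biUnion.2 ⟨i, Finset.mem_univ _, Finset.mem_product.2 ⟨hi, hi'⟩⟩
    _ ≤ ∑ i : D.Node, (bag i ×ˢ bag i).card := Finset.card_biUnion_le
    _ ≤ ∑ _i : D.Node, (t + 1) ^ 2 := by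
        refine Finset.sum_le_sum fun i _ => ?_
        rw [Finset.card_product, pow_two]
        exact Nat.mul_le_mul (ht i) (ht i)
    _ = Fintype.card D.Node * (t + 1) ^ 2 := by simp

end NiceTree

/-! ### Partial embeddings -/

section Profiles

variable {V W : Type} [DecidableEq V]

/-- `g` realizes the profile `f` in the colour class `c` of the colouring `χ` of the part of the
graph `G` below the root of `T`. The profile tells for each vertex of `H` whether it is not mapped
yet (`0`), mapped to a forgotten vertex (`1`), or mapped to the vertex with slot `i` of the bag of
the root (`i + 2`). Edges of `H` are only checked if one of their ends is mapped to a forgotten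
vertex. -/
structure Realizes (H : SimpleGraph W) (G : SimpleGraph V) (σ : V → ℕ) (T : NiceTree V)
    (χ : V → Fin 2) (c : ℕ) (f : W → ℕ) (g : W → V) : Prop where
  forg : ∀ w, f w = 1 → g w ∈ T.forg
  bag : ∀ w, 2 ≤ f w → g w ∈ T.rootBag ∧ f w = σ (g w) + 2
  color : ∀ w, f w ≠ 0 → (χ (g w) : ℕ) = c
  inj : ∀ w w', f w ≠ 0 → f w' ≠ 0 → g w = g w' → w = w'
  adj : ∀ w w', H.Adj w w' → f w = 1 → f w' ≠ 0 ∧ G.Adj (g w) (g w')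

/-- The profile `f` is realized by some partial embedding of `H`. -/
def Realizable (H : SimpleGraph W) (G : SimpleGraph V) (σ : V → ℕ) (T : NiceTree V)
    (χ : V → Fin 2) (c : ℕ) (f : W → ℕ) : Prop :=
  ∃ g, Realizes H G σ T χ c f g

variable {H : SimpleGraph W} {G : SimpleGraph V} {σ : V → ℕ} {T : NiceTree V} {χ χ' : V → Fin 2}
  {c : ℕ} {f : W → ℕ} {g : W → V}

theorem Realizes.mem (h : Realizes H G σ T χ c f g) {w : W} (hw : f w ≠ 0) :
    g w ∈ T.rootBag ∪ T.forg := by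
  rcases (by omega : f w = 1 ∨ 2 ≤ f w) with h1 | h2
  · exact Finset.mem_union_right _ (h.forg w h1)
  · exact Finset.mem_union_left _ (h.bag w h2).1

theorem Realizable.congr (h : Realizable H G σ T χ c f)
    (hχ : ∀ v ∈ T.rootBag ∪ T.forg, χ v = χ' v) :
    Realizable H G σ T χ' c f := by
  obtain ⟨g, hg⟩ := h
  exact ⟨g, hg.forg, hg.bag, fun w hw => by rw [← hχ _ (hg.mem hw)]; exact hg.color w hw,
    hg.inj, hg.adj⟩

theorem realizable_congr (hχ : ∀ v ∈ T.rootBag ∪ T.forg, χ v = χ' v) :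
    Realizable H G σ T χ c f ↔ Realizable H G σ T χ' c f :=
  ⟨fun h => h.congr hχ, fun h => h.congr fun v hv => (hχ v hv).symm⟩

theorem realizable_leaf [Nonempty V] : Realizable H G σ .leaf χ c f ↔ ∀ w, f w = 0 := by
  constructor
  · rintro ⟨g, hg⟩ w
    by_contra hw
    simpa [NiceTree.rootBag, NiceTree.forg] using hg.mem hw
  · intro h
    obtain ⟨v⟩ := ‹Nonempty V›
    exact ⟨fun _ => v, by simp [h], by simp [h], by simp [h], by simp [h], by simp [h]⟩

/-- When all vertices have been forgotten, the profile that is constantly `1` stands for the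
embeddings of `H` into a colour class. -/
theorem realizable_one (hT : ∀ v, v ∈ T.forg) : Realizable H G σ T χ c (fun _ => 1) ↔
    ∃ g : W → V, Function.Injective g ∧ (∀ w, (χ (g w) : ℕ) = c) ∧
      ∀ w w', H.Adj w w' → G.Adj (g w) (g w') := by
  constructor
  · rintro ⟨g, hg⟩
    exact ⟨g, fun w w' h => hg.inj w w' (by simp) (by simp) h, fun w => hg.color w (by simp),
      fun w w' h => (hg.adj w w' h rfl).2⟩
  · rintro ⟨g, h1, h2, h3⟩
    exact ⟨g, fun w _ => hT _, fun w hw => by omega, fun w _ => h2 w, fun w w' _ _ h => h1 h,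
      fun w w' h _ => ⟨by simp, h3 w w' h⟩⟩

/-- How the values of two profiles at the children of a join node combine. -/
def Comb (a₁ a₂ a : ℕ) : Prop :=
  (a ≠ 1 ∧ a₁ = a ∧ a₂ = a) ∨ (a = 1 ∧ ((a₁ = 1 ∧ a₂ = 0) ∨ (a₁ = 0 ∧ a₂ = 1)))

theorem Comb.le {a₁ a₂ a : ℕ} (h : Comb a₁ a₂ a) : a₁ ≤ a ∧ a₂ ≤ a := by
  unfold Comb at h
  omega

/-- A partial embedding below a join node consists of partial embeddings on the two sides with the
same restriction to the common bag. A vertex mapped to a forgotten vertex of one side is not mapped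
in the profile of the other side, and its neighbours in `H` are not mapped to forgotten vertices of
the other side, since `G` has no edges between the two sides. -/
theorem realizable_join {T₁ T₂ : NiceTree V} (hT : (NiceTree.join T₁ T₂).Sep G)
    (hσ : Set.InjOn σ T₁.rootBag) :
    Realizable H G σ (.join T₁ T₂) χ c f ↔
      ∃ f₁ f₂, Realizable H G σ T₁ χ c f₁ ∧ Realizable H G σ T₂ χ c f₂ ∧
      ∀ w, Comb (f₁ w) (f₂ w) (f w) := by
  obtain ⟨h1, h2, h3, h4⟩ := hT
  have hd1 := h3.disjoint
  have hd2 := h4.disjoint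
  rw [← h1] at hd2
  rw [Finset.disjoint_left] at h2 hd1 hd2
  have hna : ∀ u ∈ T₁.forg, ∀ u' ∈ T₂.forg, ¬ G.Adj u u' := by
    intro u hu u' hu' ha
    rcases Finset.mem_union.1 (h3.adj_mem hu ha) with h5 | h5
    · exact hd2 h5 hu'
    · exact h2 h5 hu'
  constructor
  · rintro ⟨g, hg⟩
    have hforg : ∀ w, f w = 1 → g w ∈ T₁.forg ∨ g w ∈ T₂.forg := fun w hw =>
      Finset.mem_union.1 (hg.forg w hw)
    refine ⟨fun w => if f w = 1 ∧ g w ∈ T₂.forg then 0 else f w,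
      fun w => if f w = 1 ∧ g w ∈ T₁.forg then 0 else f w,
      ⟨g, ?_, ?_, ?_, ?_, ?_⟩, ⟨g, ?_, ?_, ?_, ?_, ?_⟩, ?_⟩
    · intro w hw
      split_ifs at hw with h
      exact (hforg w hw).resolve_right fun h' => h ⟨hw, h'⟩
    · intro w hw
      split_ifs at hw ⊢ with h
      · omega
      · exact hg.bag w hw
    · intro w hw
      split_ifs at hw with h
      · exact absurd rfl hw
      · exact hg.color w hw
    · intro w w' hw hw'
      split_ifs at hw hw'
      · exact absurd rfl hw
      · exact absurd rfl hw
      · exact absurd rfl hw'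
      · exact hg.inj w w' hw hw'
    · intro w w' hww hw
      split_ifs at hw with h
      obtain ⟨h5, h6⟩ := hg.adj w w' hww hw
      refine ⟨?_, h6⟩
      split_ifs with h'
      · exact absurd h6 (hna _ ((hforg w hw).resolve_right fun h' => h ⟨hw, h'⟩) _ h'.2)
      · exact h5
    · intro w hw
      split_ifs at hw with h
      exact (hforg w hw).resolve_left fun h' => h ⟨hw, h'⟩
    · intro w hw
      split_ifs at hw ⊢ with h
      · omega
      · rw [← h1]
        exact hg.bag w hw
    · intro w hw
      split_ifs at hw with h
      · exact absurd rfl hw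
      · exact hg.color w hw
    · intro w w' hw hw'
      split_ifs at hw hw'
      · exact absurd rfl hw
      · exact absurd rfl hw
      · exact absurd rfl hw'
      · exact hg.inj w w' hw hw'
    · intro w w' hww hw
      split_ifs at hw with h
      obtain ⟨h5, h6⟩ := hg.adj w w' hww hw
      refine ⟨?_, h6⟩
      split_ifs with h'
      · exact absurd h6.symm (hna _ h'.2 _ ((hforg w hw).resolve_left fun h' => h ⟨hw, h'⟩))
      · exact h5
    · intro w
      by_cases hw : f w = 1
      · rcases hforg w hw with h5 | h5
        · have h6 : g w ∉ T₂.forg := h2 h5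
          exact .inr ⟨hw, .inl ⟨by simp [hw, h6], by simp [hw, h5]⟩⟩
        · have h6 : g w ∉ T₁.forg := fun h => h2 h h5
          exact .inr ⟨hw, .inr ⟨by simp [hw, h5], by simp [hw, h6]⟩⟩
      · exact .inl ⟨hw, by simp [hw], by simp [hw]⟩
  · rintro ⟨f₁, f₂, ⟨g₁, hg₁⟩, ⟨g₂, hg₂⟩, hf⟩
    -- follow the first embedding where it is defined, and the second one elsewhere
    let g : W → V := fun w => if f₁ w ≠ 0 then g₁ w else g₂ w
    have hgg₁ : ∀ w, f₁ w ≠ 0 → g w = g₁ w := fun w hw => if_pos hw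
    have hgg₂ : ∀ w, f₂ w ≠ 0 → g w = g₂ w := by
      intro w hw
      by_cases hw1 : f₁ w = 0
      · simp [g, hw1]
      · rw [hgg₁ w hw1]
        have h5 := hf w
        unfold Comb at h5
        obtain ⟨h6, h7⟩ := hg₁.bag w (by omega)
        obtain ⟨h8, h9⟩ := hg₂.bag w (by omega)
        rw [← h1] at h8
        exact hσ h6 h8 (by omega)
    have hcase : ∀ w, f w ≠ 0 → f₁ w ≠ 0 ∨ f₂ w ≠ 0 := by
      intro w hw
      have h5 := hf w
      unfold Comb at h5
      omega
    have hmix : ∀ w w', f₁ w ≠ 0 → f₂ w' ≠ 0 → g₁ w = g₂ w' → f₁ w' ≠ 0 ∨ f₂ w ≠ 0 := by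
      intro w w' hw hw' h
      by_contra hcon
      have h5 := hf w
      have h6 := hf w'
      unfold Comb at h5 h6
      have h7 := hg₁.forg w (by omega)
      have h8 := hg₂.forg w' (by omega)
      rw [← h] at h8
      exact h2 h7 h8
    refine ⟨g, ?_, ?_, ?_, ?_, ?_⟩
    · intro w hw
      have h5 := hf w
      unfold Comb at h5
      rcases (by omega : f₁ w = 1 ∨ f₂ w = 1) with h6 | h6
      · rw [hgg₁ w (by omega)]
        exact Finset.mem_union_left _ (hg₁.forg w h6)
      · rw [hgg₂ w (by omega)]
        exact Finset.mem_union_right _ (hg₂.forg w h6)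
    · intro w hw
      have h5 := hf w
      unfold Comb at h5
      rw [hgg₁ w (by omega)]
      have h6 := hg₁.bag w (by omega)
      exact ⟨h6.1, by omega⟩
    · intro w hw
      rcases hcase w hw with h5 | h5
      · rw [hgg₁ w h5]
        exact hg₁.color w h5
      · rw [hgg₂ w h5]
        exact hg₂.color w h5
    · intro w w' hw hw' h
      rcases hcase w hw with h5 | h5 <;> rcases hcase w' hw' with h6 | h6
      · rw [hgg₁ w h5, hgg₁ w' h6] at h
        exact hg₁.inj w w' h5 h6 h
      · rw [hgg₁ w h5, hgg₂ w' h6] at h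
        rcases hmix w w' h5 h6 h with h7 | h7
        · rw [← hgg₂ w' h6, hgg₁ w' h7] at h
          exact hg₁.inj w w' h5 h7 h
        · rw [← hgg₁ w h5, hgg₂ w h7] at h
          exact hg₂.inj w w' h7 h6 h
      · rw [hgg₂ w h5, hgg₁ w' h6] at h
        rcases hmix w' w h6 h5 h.symm with h7 | h7
        · rw [← hgg₂ w h5, hgg₁ w h7] at h
          exact hg₁.inj w w' h7 h6 h
        · rw [← hgg₁ w' h6, hgg₂ w' h7] at h
          exact hg₂.inj w w' h5 h7 h
      · rw [hgg₂ w h5, hgg₂ w' h6] at h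
        exact hg₂.inj w w' h5 h6 h
    · intro w w' hww hw
      have h5 := hf w
      have h5' := hf w'
      unfold Comb at h5 h5'
      rcases (by omega : f₁ w = 1 ∨ f₂ w = 1) with h6 | h6
      · obtain ⟨h7, h8⟩ := hg₁.adj w w' hww h6
        rw [hgg₁ w (by omega), hgg₁ w' h7]
        exact ⟨by omega, h8⟩
      · obtain ⟨h7, h8⟩ := hg₂.adj w w' hww h6
        rw [hgg₂ w (by omega), hgg₂ w' h7]
        exact ⟨by omega, h8⟩

/-- Profiles without forgotten vertices depend only on the colouring of the bag. -/
theorem Realizable.of_rootBag_eq {T₁ T₂ : NiceTree V} (h : T₁.rootBag = T₂.rootBag)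
    (hf : ∀ w, f w ≠ 1) (hr : Realizable H G σ T₁ χ c f) : Realizable H G σ T₂ χ c f := by
  obtain ⟨g, hg⟩ := hr
  exact ⟨g, fun w hw => absurd hw (hf w), h ▸ hg.bag, hg.color, hg.inj,
    fun w _ _ hw => absurd hw (hf w)⟩

variable [DecidableEq W]

/-- A partial embedding below an introduce node either does not use the new vertex `v`, or maps a
single vertex `i` to it. In the second case, `i` is not mapped yet in the profile at the child. -/
theorem realizable_introduce {v : V} (hT : (NiceTree.introduce v T).Sep G)
    (hσ : Set.InjOn σ (NiceTree.introduce v T).rootBag) :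
    Realizable H G σ (.introduce v T) χ c f ↔ Realizable H G σ T χ c f ∨
      ((χ v : ℕ) = c ∧ ∃ i, f i = σ v + 2 ∧ Realizable H G σ T χ c (Function.update f i 0)) := by
  obtain ⟨h1, h2, h3⟩ := hT
  have hvb : v ∈ (NiceTree.introduce v T).rootBag := Finset.mem_insert_self _ _
  constructor
  · rintro ⟨g, hg⟩
    by_cases hi : ∃ i, f i = σ v + 2
    · obtain ⟨i, hi⟩ := hi
      have hgi : g i = v := by
        obtain ⟨h4, h5⟩ := hg.bag i (by omega)
        exact hσ h4 hvb (by omega)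
      have hne : ∀ w, w ≠ i → f w ≠ 0 → g w ≠ v := fun w hw hw0 h =>
        hw (hg.inj w i hw0 (by omega) (h.trans hgi.symm))
      refine .inr ⟨by rw [← hgi]; exact hg.color i (by omega), i, hi, g, ?_, ?_, ?_, ?_, ?_⟩
      · intro w hw
        by_cases hwi : w = i
        · simp [hwi] at hw
        · exact hg.forg w (by simpa [hwi] using hw)
      · intro w hw
        by_cases hwi : w = i
        · simp [hwi] at hw
        · simp only [Function.update_of_ne hwi] at hw ⊢
          obtain ⟨h4, h5⟩ := hg.bag w hw
          exact ⟨(Finset.mem_insert.1 h4).resolve_left (hne w hwi (by omega)), h5⟩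
      · intro w hw
        by_cases hwi : w = i
        · simp [hwi] at hw
        · exact hg.color w (by simpa [hwi] using hw)
      · intro w w' hw hw'
        by_cases hwi : w = i
        · simp [hwi] at hw
        by_cases hwi' : w' = i
        · simp [hwi'] at hw'
        exact hg.inj w w' (by simpa [hwi] using hw) (by simpa [hwi'] using hw')
      · intro w w' hww hw
        by_cases hwi : w = i
        · simp [hwi] at hw
        have hw1 : f w = 1 := by simpa [hwi] using hw
        obtain ⟨h4, h5⟩ := hg.adj w w' hww hw1
        refine ⟨?_, h5⟩
        -- the new vertex has no forgotten neighbour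
        by_cases hwi' : w' = i
        · subst hwi'
          rw [hgi] at h5
          rcases Finset.mem_union.1 (h3.adj_mem (hg.forg w hw1) h5) with h6 | h6
          · exact absurd h6 h1
          · exact absurd h6 h2
        · simpa [hwi'] using h4
    · refine .inl ⟨g, hg.forg, fun w hw => ?_, hg.color, hg.inj, hg.adj⟩
      obtain ⟨h4, h5⟩ := hg.bag w hw
      refine ⟨(Finset.mem_insert.1 h4).resolve_left ?_, h5⟩
      rintro rfl
      exact hi ⟨w, h5⟩
  · rintro (⟨g, hg⟩ | ⟨hc, i, hi, g, hg⟩)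
    · exact ⟨g, hg.forg, fun w hw => (hg.bag w hw).imp_left (Finset.mem_insert_of_mem ·),
        hg.color, hg.inj, hg.adj⟩
    · have hne : ∀ w, w ≠ i → f w ≠ 0 → g w ≠ v := by
        intro w hwi hw h
        have h4 := hg.mem (w := w) (by simpa [hwi] using hw)
        rw [h] at h4
        rcases Finset.mem_union.1 h4 with h6 | h6
        · exact h1 h6
        · exact h2 h6
      refine ⟨Function.update g i v, ?_, ?_, ?_, ?_, ?_⟩
      · intro w hw
        by_cases hwi : w = i
        · subst hwi; omega
        · rw [Function.update_of_ne hwi]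
          exact hg.forg w (by simpa [hwi] using hw)
      · intro w hw
        by_cases hwi : w = i
        · subst hwi
          simpa [hi] using hvb
        · rw [Function.update_of_ne hwi]
          have := hg.bag w (by simpa [hwi] using hw)
          rw [Function.update_of_ne hwi] at this
          exact this.imp_left (Finset.mem_insert_of_mem ·)
      · intro w hw
        by_cases hwi : w = i
        · subst hwi
          simpa using hc
        · rw [Function.update_of_ne hwi]
          exact hg.color w (by simpa [hwi] using hw)
      · intro w w' hw hw' hgg
        by_cases hwi : w = i <;> by_cases hwi' : w' = i
        · rw [hwi, hwi']
        · subst hwi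
          rw [Function.update_self, Function.update_of_ne hwi'] at hgg
          exact absurd hgg.symm (hne w' hwi' hw')
        · subst hwi'
          rw [Function.update_self, Function.update_of_ne hwi] at hgg
          exact absurd hgg (hne w hwi hw)
        · rw [Function.update_of_ne hwi, Function.update_of_ne hwi'] at hgg
          exact hg.inj w w' (by simpa [hwi] using hw) (by simpa [hwi'] using hw') hgg
      · intro w w' hww hw
        have hwi : w ≠ i := by rintro rfl; omega
        obtain ⟨h4, h5⟩ := hg.adj w w' hww (by simpa [hwi] using hw)
        have hwi' : w' ≠ i := by rintro rfl; simp at h4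
        rw [Function.update_of_ne hwi, Function.update_of_ne hwi']
        exact ⟨by simpa [hwi'] using h4, h5⟩

/-- A partial embedding below a forget node either does not use the forgotten vertex `v`, or maps a
single vertex `i` to it. In the second case, the edges of `H` at `i` are checked here: their other
ends must be mapped already, and those mapped to the bag must be mapped to neighbours of `v`. -/
theorem realizable_forget {v : V} (hT : (NiceTree.forget v T).Sep G) (hσ : Set.InjOn σ T.rootBag) :
    Realizable H G σ (.forget v T) χ c f ↔ (∀ i, f i ≠ σ v + 2) ∧ (Realizable H G σ T χ c f ∨
      ∃ i, f i = 1 ∧ Realizable H G σ T χ c (Function.update f i (σ v + 2)) ∧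
        ∀ j, H.Adj i j → f j ≠ 0 ∧ ∀ u ∈ T.rootBag, f j = σ u + 2 → G.Adj v u) := by
  obtain ⟨h1, h2, h3⟩ := hT
  constructor
  · rintro ⟨g, hg⟩
    have hbag : ∀ w, 2 ≤ f w → g w ∈ T.rootBag ∧ g w ≠ v := fun w hw =>
      ⟨(Finset.mem_erase.1 (hg.bag w hw).1).2, (Finset.mem_erase.1 (hg.bag w hw).1).1⟩
    refine ⟨fun i hi => ?_, ?_⟩
    · have h4 := hbag i (by omega)
      have h5 := (hg.bag i (by omega)).2
      exact h4.2 (hσ h4.1 h1 (by omega))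
    by_cases hi : ∃ i, f i = 1 ∧ g i = v
    · obtain ⟨i, hi, hgi⟩ := hi
      refine .inr ⟨i, hi, ⟨g, ?_, ?_, ?_, ?_, ?_⟩, ?_⟩
      · intro w hw
        by_cases hwi : w = i
        · subst hwi; simp at hw
        have hw1 : f w = 1 := by simpa [hwi] using hw
        refine (Finset.mem_insert.1 (hg.forg w hw1)).resolve_left fun h => hwi ?_
        exact hg.inj w i (by omega) (by omega) (h.trans hgi.symm)
      · intro w hw
        by_cases hwi : w = i
        · subst hwi
          simp [hgi, h1]
        · rw [Function.update_of_ne hwi] at hw ⊢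
          exact ⟨(hbag w hw).1, (hg.bag w hw).2⟩
      · intro w hw
        refine hg.color w ?_
        by_cases hwi : w = i
        · subst hwi; omega
        · simpa [hwi] using hw
      · have h0 : ∀ w, Function.update f i (σ v + 2) w ≠ 0 → f w ≠ 0 := by
          intro w hw
          by_cases hwi : w = i
          · subst hwi; omega
          · simpa [hwi] using hw
        exact fun w w' hw hw' => hg.inj w w' (h0 w hw) (h0 w' hw')
      · intro w w' hww hw
        by_cases hwi : w = i
        · subst hwi; simp at hw
        obtain ⟨h4, h5⟩ := hg.adj w w' hww (by simpa [hwi] using hw)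
        refine ⟨?_, h5⟩
        by_cases hwi' : w' = i
        · subst hwi'; simp
        · simpa [hwi'] using h4
      · intro j hj
        obtain ⟨h4, h5⟩ := hg.adj i j hj hi
        refine ⟨h4, fun u hu huj => ?_⟩
        have h6 := hbag j (by omega)
        have h7 := (hg.bag j (by omega)).2
        rw [hgi, hσ h6.1 hu (by omega)] at h5
        exact h5
    · refine .inl ⟨g, fun w hw => ?_, fun w hw => ⟨(hbag w hw).1, (hg.bag w hw).2⟩, hg.color,
        hg.inj, hg.adj⟩
      exact (Finset.mem_insert.1 (hg.forg w hw)).resolve_left fun h => hi ⟨w, hw, h⟩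
  · rintro ⟨h0, ⟨g, hg⟩ | ⟨i, hi, ⟨g, hg⟩, hadj⟩⟩
    · refine ⟨g, fun w hw => Finset.mem_insert_of_mem (hg.forg w hw), fun w hw => ?_, hg.color,
        hg.inj, hg.adj⟩
      obtain ⟨h4, h5⟩ := hg.bag w hw
      refine ⟨Finset.mem_erase.2 ⟨?_, h4⟩, h5⟩
      rintro rfl
      exact h0 w h5
    · have hgi : g i = v := by
        obtain ⟨h4, h5⟩ := hg.bag i (by simp)
        rw [Function.update_self] at h5
        exact hσ h4 h1 (by omega)
      have hup : ∀ w, f w ≠ 0 → Function.update f i (σ v + 2) w ≠ 0 := by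
        intro w hw
        by_cases hwi : w = i
        · subst hwi; simp
        · simpa [hwi] using hw
      have hne : ∀ w, w ≠ i → f w ≠ 0 → g w ≠ v := fun w hw hw0 h =>
        hw (hg.inj w i (hup w hw0) (by simp) (h.trans hgi.symm))
      refine ⟨g, ?_, ?_, ?_, ?_, ?_⟩
      · intro w hw
        by_cases hwi : w = i
        · subst hwi
          exact Finset.mem_insert.2 (.inl hgi)
        · exact Finset.mem_insert_of_mem (hg.forg w (by simpa [hwi] using hw))
      · intro w hw
        have hwi : w ≠ i := by rintro rfl; omega
        have := hg.bag w (by simpa [hwi] using hw)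
        rw [Function.update_of_ne hwi] at this
        exact ⟨Finset.mem_erase.2 ⟨hne w hwi (by omega), this.1⟩, this.2⟩
      · exact fun w hw => hg.color w (hup w hw)
      · exact fun w w' hw hw' => hg.inj w w' (hup w hw) (hup w' hw')
      · intro w w' hww hw
        by_cases hwi : w = i
        · subst hwi
          obtain ⟨h4, h5⟩ := hadj w' hww
          refine ⟨h4, ?_⟩
          have hwi' : w' ≠ w := hww.ne'
          rcases (by omega : f w' = 1 ∨ 2 ≤ f w') with h6 | h6
          · exact (hg.adj w' w hww.symm (by simpa [hwi'] using h6)).2.symm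
          · have h7 := hg.bag w' (by simpa [hwi'] using h6)
            rw [Function.update_of_ne hwi'] at h7
            rw [hgi]
            exact h5 _ h7.1 h7.2
        · obtain ⟨h4, h5⟩ := hg.adj w w' hww (by simpa [hwi] using hw)
          refine ⟨?_, h5⟩
          by_cases hwi' : w' = i
          · subst hwi'; omega
          · simpa [hwi'] using h4

/-- The colour of a bag vertex can be read off a profile that maps a single vertex. -/
theorem realizable_single {v : V} (hv : v ∈ T.rootBag) (hσ : Set.InjOn σ T.rootBag) (w₀ : W) :
    Realizable H G σ T χ c (Function.update (fun _ => 0) w₀ (σ v + 2)) ↔ (χ v : ℕ) = c := by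
  constructor
  · rintro ⟨g, hg⟩
    obtain ⟨h1, h2⟩ := hg.bag w₀ (by simp)
    have h3 : g w₀ = v := hσ h1 hv (by simpa using h2.symm)
    rw [← h3]
    exact hg.color w₀ (by simp)
  · intro hc
    have h0 : ∀ w, Function.update (fun _ => 0) w₀ (σ v + 2) w ≠ 0 → w = w₀ := by
      intro w hw
      by_contra h
      simp [h] at hw
    have h1 : ∀ w, Function.update (fun _ => 0) w₀ (σ v + 2) w ≠ 1 := by
      intro w
      by_cases h : w = w₀
      · subst h; simp
      · simp [h]
    refine ⟨fun _ => v, fun w hw => absurd hw (h1 w), ?_, fun _ _ => hc, ?_,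
      fun w _ _ hw => absurd hw (h1 w)⟩
    · intro w hw
      rw [h0 w (by omega)]
      simpa using hv
    · intro w w' hw hw' _
      rw [h0 w hw, h0 w' hw']

end Profiles

theorem isContained_induce_iff {V W : Type} {H : SimpleGraph W} {G : SimpleGraph V} {A : Set V} :
    H.IsContained (G.induce A) ↔ ∃ g : W → V, Function.Injective g ∧ (∀ w, g w ∈ A) ∧
      ∀ w w', H.Adj w w' → G.Adj (g w) (g w') := by
  constructor
  · rintro ⟨⟨f, hf⟩⟩
    refine ⟨fun w => f w, fun w w' h => hf (Subtype.ext h), fun w => (f w).2, fun w w' h => ?_⟩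
    exact f.map_adj h
  · rintro ⟨g, h1, h2, h3⟩
    exact ⟨⟨⟨fun w => ⟨g w, h2 w⟩, fun {a b} h => h3 a b h⟩,
      fun w w' h => h1 (congrArg Subtype.val h)⟩⟩

/-- If `H` has at least two vertices, then the classes of the partition may be required to be
non-empty at no cost: a graph on at least two vertices without a copy of `H` can be split
arbitrarily. -/
theorem bws_iff {n r : ℕ} (hr : 2 ≤ r) (H : SimpleGraph (Fin r)) (G : SimpleGraph (Fin n)) :
    BWS H G ↔ 1 < n ∧ ∃ χ : Fin n → Fin 2, ∀ c < 2, ¬ ∃ g : Fin r → Fin n,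
      Function.Injective g ∧ (∀ w, (χ (g w) : ℕ) = c) ∧
        ∀ w w', H.Adj w w' → G.Adj (g w) (g w') := by
  classical
  simp only [BWS, isContained_induce_iff]
  constructor
  · rintro ⟨A, B, ⟨a, ha⟩, ⟨b, hb⟩, hAB, huniv, h1, h2⟩
    have hab : a ≠ b := fun h => Set.disjoint_left.1 hAB ha (h ▸ hb)
    refine ⟨?_, fun v => if v ∈ A then 0 else 1, ?_⟩
    · by_contra hn
      exact hab (Fin.ext (by omega))
    · rintro c hc ⟨g, hg1, hg2, hg3⟩
      rcases (by omega : c = 0 ∨ c = 1) with rfl | rfl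
      · refine h1 ⟨g, hg1, fun w => ?_, hg3⟩
        have := hg2 w
        by_contra h
        simp [h] at this
      · refine h2 ⟨g, hg1, fun w => ?_, hg3⟩
        have := hg2 w
        have h3 : g w ∈ A ∪ B := huniv ▸ Set.mem_univ _
        refine h3.resolve_left fun h => ?_
        simp [h] at this
  · rintro ⟨hn, χ, hχ⟩
    have h0 : ∀ c : Fin 2, ¬ ∃ g : Fin r → Fin n, Function.Injective g ∧
        (∀ w, g w ∈ {v | χ v = c}) ∧ ∀ w w', H.Adj w w' → G.Adj (g w) (g w') := by
      rintro c ⟨g, h1, h2, h3⟩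
      exact hχ c c.2 ⟨g, h1, fun w => by rw [show χ (g w) = c from h2 w], h3⟩
    have hsingle : ∀ v : Fin n, ¬ ∃ g : Fin r → Fin n, Function.Injective g ∧
        (∀ w, g w ∈ ({v} : Set (Fin n))) ∧ ∀ w w', H.Adj w w' → G.Adj (g w) (g w') := by
      rintro v ⟨g, h1, h2, -⟩
      have h3 : (⟨0, by omega⟩ : Fin r) = ⟨1, by omega⟩ :=
        h1 ((Set.mem_singleton_iff.1 (h2 _)).trans (Set.mem_singleton_iff.1 (h2 _)).symm)
      simp at h3
    by_cases hc : ∃ c : Fin 2, ∀ v, χ v = c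
    · -- all vertices have the same colour: move one vertex to the other class
      obtain ⟨c, hc⟩ := hc
      have hn0 : 0 < n := by omega
      refine ⟨{⟨0, hn0⟩}, {⟨0, hn0⟩}ᶜ, ⟨_, rfl⟩, ⟨⟨1, hn⟩, by simp⟩,
        disjoint_compl_right, Set.union_compl_self _, hsingle _, ?_⟩
      rintro ⟨g, h1, -, h3⟩
      exact h0 c ⟨g, h1, fun w => hc _, h3⟩
    · push Not at hc
      refine ⟨{v | χ v = 0}, {v | χ v = 1}, ?_, ?_, ?_, ?_, h0 0, h0 1⟩
      · obtain ⟨v, hv⟩ := hc 1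
        exact ⟨v, by simp; omega⟩
      · obtain ⟨v, hv⟩ := hc 0
        exact ⟨v, by simp; omega⟩
      · rw [Set.disjoint_left]
        intro v h1 h2
        simp only [Set.mem_ofPred_eq] at h1 h2
        omega
      · ext v
        simp only [Set.mem_union, Set.mem_ofPred_eq, Set.mem_univ, iff_true]
        omega

/-! ### Profiles and sets of profiles as numbers -/

section Encoding

/-- The binary digit of `q` at position `p` is `1`: the profile with number `p` belongs to the set
with number `q`. -/
def Bit (q p : ℕ) : Prop := q / 2 ^ p % 2 ≠ 0

/-- A digit in base `b`. -/
def digit (b p i : ℕ) : ℕ := p / b ^ i % b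

theorem digit_lt {b : ℕ} (hb : 0 < b) (p i : ℕ) : digit b p i < b := Nat.mod_lt _ hb

theorem exists_digits {b r : ℕ} {f : ℕ → ℕ} (hf : ∀ i < r, f i < b) :
    ∃ p < b ^ r, ∀ i < r, digit b p i = f i := by
  let e := finFunctionFinEquiv (m := b) (n := r) fun i => ⟨f i, hf i i.2⟩
  refine ⟨e, e.2, fun i hi => ?_⟩
  have := congrFun (finFunctionFinEquiv.symm_apply_apply (fun i : Fin r =>
    (⟨f i, hf i i.2⟩ : Fin b))) ⟨i, hi⟩
  exact congrArg Fin.val this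

theorem exists_bits (Q : ℕ) (S : ℕ → Prop) : ∃ q < 2 ^ Q, ∀ p < Q, (Bit q p ↔ S p) := by
  classical
  obtain ⟨q, hq, h⟩ := exists_digits (b := 2) (r := Q) (f := fun p => if S p then 1 else 0)
    fun i _ => by split_ifs <;> simp
  refine ⟨q, hq, fun p hp => ?_⟩
  have := h p hp
  simp only [digit] at this
  rw [Bit, this]
  by_cases h : S p <;> simp [h]

/-- Every pair of a colour and a profile has a number. -/
theorem exists_profile {r k c : ℕ} (hc : c < 2) {f : Fin r → ℕ} (hf : ∀ i, f i < k + 2) :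
    ∃ p < 2 * (k + 2) ^ r, p / (k + 2) ^ r = c ∧ (fun i : Fin r => digit (k + 2) p i) = f := by
  obtain ⟨p, hp, h⟩ := exists_digits (b := k + 2) (r := r + 1)
    (f := fun i => if h : i < r then f ⟨i, h⟩ else c) (fun i hi => by
      by_cases h : i < r
      · simpa [h] using hf ⟨i, h⟩
      · simp only [h, dite_false]
        omega)
  have hpos : 0 < (k + 2) ^ r := by positivity
  have hpr : p / (k + 2) ^ r = c := by
    have := h r (by omega)
    simp only [digit, lt_irrefl, dite_false] at this
    rwa [Nat.mod_eq_of_lt] at this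
    rw [Nat.div_lt_iff_lt_mul hpos]
    rwa [pow_succ, Nat.mul_comm] at hp
  refine ⟨p, ?_, hpr, ?_⟩
  · rw [← Nat.div_lt_iff_lt_mul hpos, hpr]
    exact hc
  · funext i
    simpa using h i (by omega)

variable {n r : ℕ} {H : SimpleGraph (Fin r)} {G : SimpleGraph (Fin n)} {σ : Fin n → ℕ} {k : ℕ}
  {T : NiceTree (Fin n)} {χ χ' : Fin n → Fin 2} {q : ℕ}

/-- The number `q` encodes the set of the profiles that are realized for the colouring `χ`. -/
def Encodes (H : SimpleGraph (Fin r)) (G : SimpleGraph (Fin n)) (σ : Fin n → ℕ) (k : ℕ)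
    (T : NiceTree (Fin n)) (χ : Fin n → Fin 2) (q : ℕ) : Prop :=
  ∀ p < 2 * (k + 2) ^ r, (Bit q p ↔
    Realizable H G σ T χ (p / (k + 2) ^ r) fun i => digit (k + 2) p i)

/-- The table `F` marks the numbers of the sets of profiles that arise from some colouring. -/
def IsTable (H : SimpleGraph (Fin r)) (G : SimpleGraph (Fin n)) (σ : Fin n → ℕ) (k : ℕ)
    (T : NiceTree (Fin n)) (F : ℕ → ℕ) : Prop :=
  ∀ q < 2 ^ (2 * (k + 2) ^ r), (F q ≠ 0 ↔ ∃ χ, Encodes H G σ k T χ q)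

theorem exists_encodes (H : SimpleGraph (Fin r)) (G : SimpleGraph (Fin n)) (σ : Fin n → ℕ) (k : ℕ)
    (T : NiceTree (Fin n)) (χ : Fin n → Fin 2) :
    ∃ q < 2 ^ (2 * (k + 2) ^ r), Encodes H G σ k T χ q :=
  exists_bits _ _

/-- Membership of a profile, given as a function, in terms of its number. The machine searches for
this number by a bounded quantifier instead of computing it. -/
theorem Encodes.exists_bit (hq : Encodes H G σ k T χ q) {c : ℕ} (hc : c < 2) {f : Fin r → ℕ}
    (hf : ∀ i, f i < k + 2) : Realizable H G σ T χ c f ↔ ∃ p < 2 * (k + 2) ^ r, Bit q p ∧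
      p / (k + 2) ^ r = c ∧ ∀ i : Fin r, digit (k + 2) p i = f i := by
  constructor
  · intro h
    obtain ⟨p, hp, rfl, rfl⟩ := exists_profile hc hf
    exact ⟨p, hp, (hq p hp).2 h, rfl, fun _ => rfl⟩
  · rintro ⟨p, hp, hb, rfl, hf⟩
    rw [← funext hf]
    exact (hq p hp).1 hb

theorem colour_lt {p : ℕ} (hp : p < 2 * (k + 2) ^ r) : p / (k + 2) ^ r < 2 := by
  rwa [Nat.div_lt_iff_lt_mul (by positivity)]

theorem update_digit_lt {p a : ℕ} (ha : a < k + 2) (i j : Fin r) :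
    Function.update (fun i : Fin r => digit (k + 2) p i) i a j < k + 2 := by
  by_cases h : j = i
  · subst h
    simpa using ha
  · simpa [h] using digit_lt (by omega) p j

theorem encodes_leaf_iff [Nonempty (Fin n)] : (∃ χ, Encodes H G σ k .leaf χ q) ↔
    ∀ p < 2 * (k + 2) ^ r, (Bit q p ↔ ∀ i : Fin r, digit (k + 2) p i = 0) := by
  simp only [Encodes, realizable_leaf, exists_const]

/-- The table of an introduce node: choose a set at the child and the colour `c` of the new vertex.
-/
theorem encodes_introduce_iff {v : Fin n} {F : ℕ → ℕ} (hT : (NiceTree.introduce v T).Sep G)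
    (hσ : Set.InjOn σ (NiceTree.introduce v T).rootBag) (hF : IsTable H G σ k T F) :
    (∃ χ, Encodes H G σ k (.introduce v T) χ q) ↔
      ∃ q' < 2 ^ (2 * (k + 2) ^ r), F q' ≠ 0 ∧ ∃ c < 2, ∀ p < 2 * (k + 2) ^ r, (Bit q p ↔
        Bit q' p ∨ (p / (k + 2) ^ r = c ∧ ∃ i : Fin r, digit (k + 2) p i = σ v + 2 ∧
          ∃ p' < 2 * (k + 2) ^ r, Bit q' p' ∧ p' / (k + 2) ^ r = p / (k + 2) ^ r ∧
            ∀ j : Fin r, digit (k + 2) p' j =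
              Function.update (fun i : Fin r => digit (k + 2) p i) i 0 j)) := by
  have hv : v ∉ T.rootBag ∪ T.forg := by
    rw [Finset.mem_union]
    exact fun h => h.elim hT.1 hT.2.1
  -- what the transition says if `q'` encodes the profiles of the child
  have key : ∀ (χ : Fin n → Fin 2) (q' : ℕ), Encodes H G σ k T χ q' →
      ∀ p < 2 * (k + 2) ^ r, (Realizable H G σ (.introduce v T) χ (p / (k + 2) ^ r)
        (fun i => digit (k + 2) p i) ↔
        Bit q' p ∨ (p / (k + 2) ^ r = χ v ∧ ∃ i : Fin r, digit (k + 2) p i = σ v + 2 ∧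
          ∃ p' < 2 * (k + 2) ^ r, Bit q' p' ∧ p' / (k + 2) ^ r = p / (k + 2) ^ r ∧
            ∀ j : Fin r, digit (k + 2) p' j =
              Function.update (fun i : Fin r => digit (k + 2) p i) i 0 j)) := by
    intro χ q' hq' p hp
    rw [realizable_introduce hT hσ, hq' p hp, eq_comm (a := p / _)]
    simp only [hq'.exists_bit (colour_lt hp) (update_digit_lt (show 0 < k + 2 by omega) _)]
  constructor
  · rintro ⟨χ, hχ⟩
    obtain ⟨q', hq', he⟩ := exists_encodes H G σ k T χ
    exact ⟨q', hq', (hF q' hq').2 ⟨χ, he⟩, χ v, (χ v).2,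
      fun p hp => (hχ p hp).trans (key χ q' he p hp)⟩
  · rintro ⟨q', hq', hFq, c, hc, h⟩
    obtain ⟨χ, he⟩ := (hF q' hq').1 hFq
    -- the colour of the new vertex can be chosen freely
    refine ⟨Function.update χ v ⟨c, hc⟩, fun p hp => (h p hp).trans ?_⟩
    have he' : Encodes H G σ k T (Function.update χ v ⟨c, hc⟩) q' := by
      intro p hp
      rw [he p hp]
      refine realizable_congr fun u hu => ?_
      rw [Function.update_of_ne]
      rintro rfl
      exact hv hu
    rw [key _ q' he' p hp]
    simp

/-- The table of a forget node: choose a set at the child. The predicate `A` is the adjacency test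
for the vertices in the bag, expressed by digits. -/
theorem encodes_forget_iff {v : Fin n} {F : ℕ → ℕ} {A : ℕ → Prop}
    (hT : (NiceTree.forget v T).Sep G) (hσ : Set.InjOn σ T.rootBag) (hv : σ v < k)
    (hA : ∀ d, A d ↔ ∀ u ∈ T.rootBag, d = σ u + 2 → G.Adj v u) (hF : IsTable H G σ k T F) :
    (∃ χ, Encodes H G σ k (.forget v T) χ q) ↔
      ∃ q' < 2 ^ (2 * (k + 2) ^ r), F q' ≠ 0 ∧ ∀ p < 2 * (k + 2) ^ r, (Bit q p ↔
        (∀ i : Fin r, digit (k + 2) p i ≠ σ v + 2) ∧ (Bit q' p ∨ ∃ i : Fin r,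
          digit (k + 2) p i = 1 ∧ (∃ p' < 2 * (k + 2) ^ r, Bit q' p' ∧
            p' / (k + 2) ^ r = p / (k + 2) ^ r ∧ ∀ j : Fin r, digit (k + 2) p' j =
              Function.update (fun i : Fin r => digit (k + 2) p i) i (σ v + 2) j) ∧
          ∀ j : Fin r, H.Adj i j → digit (k + 2) p j ≠ 0 ∧ A (digit (k + 2) p j))) := by
  have key : ∀ (χ : Fin n → Fin 2) (q' : ℕ), Encodes H G σ k T χ q' →
      ∀ p < 2 * (k + 2) ^ r, (Realizable H G σ (.forget v T) χ (p / (k + 2) ^ r)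
        (fun i => digit (k + 2) p i) ↔
        (∀ i : Fin r, digit (k + 2) p i ≠ σ v + 2) ∧ (Bit q' p ∨ ∃ i : Fin r,
          digit (k + 2) p i = 1 ∧ (∃ p' < 2 * (k + 2) ^ r, Bit q' p' ∧
            p' / (k + 2) ^ r = p / (k + 2) ^ r ∧ ∀ j : Fin r, digit (k + 2) p' j =
              Function.update (fun i : Fin r => digit (k + 2) p i) i (σ v + 2) j) ∧
          ∀ j : Fin r, H.Adj i j → digit (k + 2) p j ≠ 0 ∧ A (digit (k + 2) p j))) := by
    intro χ q' hq' p hp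
    rw [realizable_forget hT hσ, hq' p hp]
    simp only [hq'.exists_bit (colour_lt hp) (update_digit_lt (show σ v + 2 < k + 2 by omega) _),
      hA]
  constructor
  · rintro ⟨χ, hχ⟩
    obtain ⟨q', hq', he⟩ := exists_encodes H G σ k T χ
    exact ⟨q', hq', (hF q' hq').2 ⟨χ, he⟩, fun p hp => (hχ p hp).trans (key χ q' he p hp)⟩
  · rintro ⟨q', hq', hFq, h⟩
    obtain ⟨χ, he⟩ := (hF q' hq').1 hFq
    exact ⟨χ, fun p hp => (h p hp).trans (key χ q' he p hp).symm⟩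

/-- The table of a join node: choose sets at both children that agree on the profiles without
forgotten vertices, so that the two colourings can be glued. -/
theorem encodes_join_iff {T₁ T₂ : NiceTree (Fin n)} {F₁ F₂ : ℕ → ℕ} (hr : 0 < r)
    (hT : (NiceTree.join T₁ T₂).Sep G) (hσ : Set.InjOn σ T₁.rootBag)
    (hk : ∀ v ∈ T₁.rootBag, σ v < k) (hF₁ : IsTable H G σ k T₁ F₁)
    (hF₂ : IsTable H G σ k T₂ F₂) :
    (∃ χ, Encodes H G σ k (.join T₁ T₂) χ q) ↔
      ∃ q₁ < 2 ^ (2 * (k + 2) ^ r), F₁ q₁ ≠ 0 ∧ ∃ q₂ < 2 ^ (2 * (k + 2) ^ r), F₂ q₂ ≠ 0 ∧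
        (∀ p < 2 * (k + 2) ^ r, (∀ i : Fin r, digit (k + 2) p i ≠ 1) → (Bit q₁ p ↔ Bit q₂ p)) ∧
        ∀ p < 2 * (k + 2) ^ r, (Bit q p ↔
          ∃ p₁ < 2 * (k + 2) ^ r, Bit q₁ p₁ ∧ p₁ / (k + 2) ^ r = p / (k + 2) ^ r ∧
          ∃ p₂ < 2 * (k + 2) ^ r, Bit q₂ p₂ ∧ p₂ / (k + 2) ^ r = p / (k + 2) ^ r ∧
          ∀ i : Fin r, Comb (digit (k + 2) p₁ i) (digit (k + 2) p₂ i) (digit (k + 2) p i)) := by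
  have hbag : T₁.rootBag = T₂.rootBag := hT.1
  have key : ∀ (χ : Fin n → Fin 2) (q₁ q₂ : ℕ), Encodes H G σ k T₁ χ q₁ →
      Encodes H G σ k T₂ χ q₂ → ∀ p < 2 * (k + 2) ^ r,
        (Realizable H G σ (.join T₁ T₂) χ (p / (k + 2) ^ r) (fun i => digit (k + 2) p i) ↔
          ∃ p₁ < 2 * (k + 2) ^ r, Bit q₁ p₁ ∧ p₁ / (k + 2) ^ r = p / (k + 2) ^ r ∧
          ∃ p₂ < 2 * (k + 2) ^ r, Bit q₂ p₂ ∧ p₂ / (k + 2) ^ r = p / (k + 2) ^ r ∧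
          ∀ i : Fin r, Comb (digit (k + 2) p₁ i) (digit (k + 2) p₂ i) (digit (k + 2) p i)) := by
    intro χ q₁ q₂ h₁ h₂ p hp
    rw [realizable_join hT hσ]
    constructor
    · rintro ⟨f₁, f₂, hf₁, hf₂, hf⟩
      have hlt := fun i : Fin r => digit_lt (show 0 < k + 2 by omega) p i
      obtain ⟨p₁, hp₁, hb₁, hc₁, hd₁⟩ := (h₁.exists_bit (colour_lt hp)
        fun i => ((hf i).le.1.trans_lt (hlt i))).1 hf₁
      obtain ⟨p₂, hp₂, hb₂, hc₂, hd₂⟩ := (h₂.exists_bit (colour_lt hp)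
        fun i => ((hf i).le.2.trans_lt (hlt i))).1 hf₂
      refine ⟨p₁, hp₁, hb₁, hc₁, p₂, hp₂, hb₂, hc₂, fun i => ?_⟩
      rw [hd₁, hd₂]
      exact hf i
    · rintro ⟨p₁, hp₁, hb₁, hc₁, p₂, hp₂, hb₂, hc₂, hd⟩
      exact ⟨_, _, hc₁ ▸ (h₁ p₁ hp₁).1 hb₁, hc₂ ▸ (h₂ p₂ hp₂).1 hb₂, hd⟩
  constructor
  · rintro ⟨χ, hχ⟩
    obtain ⟨q₁, hq₁, he₁⟩ := exists_encodes H G σ k T₁ χ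
    obtain ⟨q₂, hq₂, he₂⟩ := exists_encodes H G σ k T₂ χ
    refine ⟨q₁, hq₁, (hF₁ q₁ hq₁).2 ⟨χ, he₁⟩, q₂, hq₂, (hF₂ q₂ hq₂).2 ⟨χ, he₂⟩,
      fun p hp hne => ?_, fun p hp => (hχ p hp).trans (key χ q₁ q₂ he₁ he₂ p hp)⟩
    rw [he₁ p hp, he₂ p hp]
    exact ⟨fun h => Realizable.of_rootBag_eq hbag hne h,
      fun h => Realizable.of_rootBag_eq hbag.symm hne h⟩
  · rintro ⟨q₁, hq₁, hFq₁, q₂, hq₂, hFq₂, hagree, h⟩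
    obtain ⟨χ₁, he₁⟩ := (hF₁ q₁ hq₁).1 hFq₁
    obtain ⟨χ₂, he₂⟩ := (hF₂ q₂ hq₂).1 hFq₂
    -- the two colourings agree on the common bag, because profiles of single vertices do
    have hχ : ∀ v ∈ T₁.rootBag, χ₁ v = χ₂ v := by
      intro v hv
      have hkv := hk v hv
      have hlt : ∀ i : Fin r,
          Function.update (fun _ => 0) (⟨0, hr⟩ : Fin r) (σ v + 2) i < k + 2 := by
        intro i
        by_cases hi : i = ⟨0, hr⟩
        · subst hi
          simpa using hkv
        · simp [hi]
      obtain ⟨p, hp, hb, hc, hd⟩ := (he₁.exists_bit (χ₁ v).2 hlt).1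
        ((realizable_single (c := (χ₁ v : ℕ)) hv hσ (⟨0, hr⟩ : Fin r)).2 rfl)
      have hb₂ := (hagree p hp fun i => by
        rw [hd]
        by_cases hi : i = ⟨0, hr⟩
        · subst hi
          simp
        · simp [hi]).1 hb
      have := (he₂.exists_bit (χ₁ v).2 hlt).2 ⟨p, hp, hb₂, hc, hd⟩
      rw [realizable_single (hbag ▸ hv) (hbag ▸ hσ)] at this
      exact Fin.ext this.symm
    obtain ⟨-, h2, h3, h4⟩ := hT
    have hd2 := h4.disjoint
    rw [Finset.disjoint_left] at h2 hd2
    let χ : Fin n → Fin 2 := fun v => if v ∈ T₁.rootBag ∪ T₁.forg then χ₁ v else χ₂ v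
    have hχ₁ : Encodes H G σ k T₁ χ q₁ := by
      intro p hp
      rw [he₁ p hp]
      exact realizable_congr fun u hu => (if_pos hu).symm
    have hχ₂ : Encodes H G σ k T₂ χ q₂ := by
      intro p hp
      rw [he₂ p hp]
      refine realizable_congr fun u hu => ?_
      by_cases hu' : u ∈ T₁.rootBag
      · simp only [χ, Finset.mem_union, hu', true_or, if_true]
        exact (hχ u hu').symm
      · have hu'' : u ∉ T₁.forg := by
          rcases Finset.mem_union.1 hu with h5 | h5
          · exact absurd (hbag ▸ h5) hu'
          · exact fun h6 => h2 h6 h5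
        simp [χ, hu', hu'']
    exact ⟨χ, fun p hp => (h p hp).trans (key χ q₁ q₂ hχ₁ hχ₂ p hp).symm⟩

/-- Reading off the answer from the table of a tree in which all vertices have been forgotten. -/
theorem IsTable.bws_iff {F : ℕ → ℕ} (hr : 2 ≤ r) (hT : ∀ v, v ∈ T.forg)
    (hF : IsTable H G σ k T F) : BWS H G ↔ 1 < n ∧ ∃ q < 2 ^ (2 * (k + 2) ^ r), F q ≠ 0 ∧
      ∀ p < 2 * (k + 2) ^ r, (∀ i : Fin r, digit (k + 2) p i = 1) → ¬ Bit q p := by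
  rw [_root_.bws_iff hr]
  refine and_congr_right fun _ => ?_
  simp only [← realizable_one hT (σ := σ)]
  constructor
  · rintro ⟨χ, hχ⟩
    obtain ⟨q, hq, he⟩ := exists_encodes H G σ k T χ
    refine ⟨q, hq, (hF q hq).2 ⟨χ, he⟩, fun p hp h1 hb => hχ _ (colour_lt hp) ?_⟩
    rw [← funext h1]
    exact (he p hp).1 hb
  · rintro ⟨q, hq, hFq, h⟩
    obtain ⟨χ, he⟩ := (hF q hq).1 hFq
    refine ⟨χ, fun c hc hR => ?_⟩
    obtain ⟨p, hp, hb, -, hd⟩ := (he.exists_bit hc fun _ => by omega).1 hR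
    exact h p hp hd hb

end Encoding

/-! ### Registers and arrays

Registers below `12` hold numbers that may be large, see `RAM.SmallRegs`; the registers `0`, `1`,
`2` and the arrays `0` to `3` hold the input. The arrays `arrBase`, `arrSize` and `arrStack` form
the stack of bags; `arrStart`, `arrLen`, `arrNb` and `arrOwner` hold the records, that is, the lists
of the bags below the forget nodes, and `arrMark` holds the marks of their entries; `arrSlot` holds
the slots of the vertices, `arrPow` powers of two, and `arrTab` and `arrTmp` the tables. -/

notation "regN" => (0 : ℕ)
notation "regE" => (1 : ℕ)
notation "regL" => (2 : ℕ)
notation "regPos" => (3 : ℕ)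
notation "regDepth" => (4 : ℕ)
notation "regPtr" => (5 : ℕ)
notation "regV" => (6 : ℕ)
notation "regB" => (7 : ℕ)
notation "regTop" => (8 : ℕ)
notation "regPrev" => (9 : ℕ)
notation "regU" => (10 : ℕ)
notation "regA" => (11 : ℕ)
notation "regK" => (12 : ℕ)
notation "regZ" => (13 : ℕ)
notation "regX" => (14 : ℕ)
notation "regRadix" => (15 : ℕ)
notation "regQ" => (16 : ℕ)
notation "regM" => (17 : ℕ)
notation "regS" => (18 : ℕ)
notation "regC" => (19 : ℕ)
notation "regY" => (20 : ℕ)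
notation "arrEnd" => (0 : ℕ)
notation "arrEnd'" => (1 : ℕ)
notation "arrType" => (2 : ℕ)
notation "arrVert" => (3 : ℕ)
notation "arrBase" => (4 : ℕ)
notation "arrSize" => (5 : ℕ)
notation "arrStack" => (6 : ℕ)
notation "arrStart" => (7 : ℕ)
notation "arrLen" => (8 : ℕ)
notation "arrNb" => (9 : ℕ)
notation "arrOwner" => (10 : ℕ)
notation "arrMark" => (11 : ℕ)
notation "arrSlot" => (12 : ℕ)
notation "arrPow" => (13 : ℕ)
notation "arrTab" => (14 : ℕ)
notation "arrTmp" => (15 : ℕ)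

/-! ### The pass over the bags -/

namespace RAM

namespace Cmd

/-- `Steps c j τ s s'`: running `c` from `s` for `j` times leads to `s'`, with cost at most `τ` per
run. -/
def Steps (c : Cmd) (j τ : ℕ) (s s' : State) : Prop :=
  c.run^[j] s = s' ∧ ∑ i ∈ Finset.range j, c.cost (c.run^[i] s) ≤ j * τ

theorem Steps.one {c : Cmd} {τ : ℕ} {s s' : State} (h : c.cost s ≤ τ) (hs : c.run s = s') :
    Steps c 1 τ s s' := by
  simpa [Steps, hs] using h

theorem Steps.add {c : Cmd} {i j τ : ℕ} {s s' s'' : State} (h : Steps c i τ s s')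
    (h' : Steps c j τ s' s'') : Steps c (i + j) τ s s'' := by
  obtain ⟨h1, h2⟩ := h
  obtain ⟨h3, h4⟩ := h'
  refine ⟨by rw [Nat.add_comm, Function.iterate_add_apply, h1, h3], ?_⟩
  rw [Finset.sum_range_add, Nat.add_mul]
  refine Nat.add_le_add h2 (le_trans (le_of_eq ?_) h4)
  refine Finset.sum_congr rfl fun x _ => ?_
  rw [Nat.add_comm, Function.iterate_add_apply, h1]

theorem Steps.rep_run {c : Cmd} {j τ : ℕ} {s s' : State} (h : Steps c j τ s s') {e : Expr}
    (he : e.eval s = j) : (rep e c).run s = s' := by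
  rw [run, he, h.1]

theorem Steps.rep_cost {c : Cmd} {j τ : ℕ} {s s' : State} (h : Steps c j τ s s') {e : Expr}
    (he : e.eval s = j) : (rep e c).cost s ≤ e.cost s + j * (τ + 2) + 2 := by
  have := h.2
  simp only [cost, he, Finset.sum_add_distrib, Finset.sum_const, Finset.card_range, smul_eq_mul]
  rw [Nat.mul_add]
  omega

/-- Commands that keep the small registers small, at polynomial cost. -/
structure Tame (c : Cmd) : Prop where
  wf : c.WF 32
  cost : PolyOn SmallRegs c.cost
  small : ∀ N s, SmallRegs N s → SmallRegs N (c.run s)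

theorem Tame.seq {c c' : Cmd} (h : c.Tame) (h' : c'.Tame) : (Cmd.seq c c').Tame :=
  ⟨⟨h.wf, h'.wf⟩, polyOn_seq h.cost h'.cost h.small,
    fun N s hs => h'.small N _ (h.small N s hs)⟩

theorem Tame.ite {e : Expr} {c c' : Cmd} (he : e.Ok) (h : c.Tame) (h' : c'.Tame) :
    (Cmd.ite e c c').Tame := by
  refine ⟨⟨he.wf, h.wf, h'.wf⟩, polyOn_ite he.polyOn (h.cost.weaken fun _ _ hs => hs.1)
    (h'.cost.weaken fun _ _ hs => hs.1), fun N s hs => ?_⟩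
  rw [run]
  split_ifs
  · exact h.small N s hs
  · exact h'.small N s hs

theorem Tame.assign {x : ℕ} {e : Expr} (hx : x < 12) (he : e.Ok) : (Cmd.assign x e).Tame :=
  ⟨⟨by omega, he.wf⟩, polyOn_assign he, fun _ _ hs => hs.setReg (.inl hx)⟩

theorem Tame.assign_small {x : ℕ} {e : Expr} (hx : x < 32) (he : e.Ok)
    (h : ∀ N s, SmallRegs N s → e.eval s ≤ N) : (Cmd.assign x e).Tame :=
  ⟨⟨hx, he.wf⟩, polyOn_assign he, fun N s hs => hs.setReg (.inr (h N s hs))⟩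

theorem Tame.store {k : ℕ} {a e : Expr} (ha : a.Ok) (he : e.Ok) : (Cmd.store k a e).Tame :=
  ⟨⟨ha.wf, he.wf⟩, polyOn_store ha he, fun _ _ hs => hs.of_reg rfl⟩

theorem fill_iterate_reg {k y x : ℕ} {e : Expr} (s : State) (j : ℕ) :
    ((run (.seq (.store k (.op .add (.var y) (.var x)) e)
      (.assign x (.op .add (.var x) (.const 1)))))^[j] (s.setReg x 0)).reg =
      Function.update s.reg x j := by
  induction j with
  | zero => rfl
  | succ j ih =>
    rw [Function.iterate_succ_apply']
    generalize (run (.seq (.store k (.op .add (.var y) (.var x)) e)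
      (.assign x (.op .add (.var x) (.const 1)))))^[j] (s.setReg x 0) = s' at ih ⊢
    simp [run, State.setReg, State.setMem, ih, Expr.eval, Op.fn]

theorem Tame.fill {k y x z : ℕ} {e : Expr} (hx : 12 ≤ x ∧ x < 32) (hz : 12 ≤ z ∧ z < 32)
    (hy : y < 32) (hxz : z ≠ x) (he : e.Ok) : (Cmd.fill k y x z e).Tame := by
  refine ⟨wf_fill hx.2 hz.2 hy he, polyOn_fill hx.1 hx.2 hz.1 hz.2 hy he, fun N s hs => ?_⟩
  refine SmallRegs.of_reg (s := s.setReg x (s.reg z)) (hs.setReg (.inr (hs z hz.1 hz.2))) ?_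
  have : (Expr.var z).eval (s.setReg x 0) = s.reg z := by simp [Expr.eval, hxz]
  rw [Cmd.fill, run, run, run, Expr.eval, this]
  exact fill_iterate_reg s _

end Cmd

end RAM

open RAM

/-- The segment of the array `f` from address `a` on lists the elements of `B`. -/
def Frame {n : ℕ} (f : ℕ → ℕ) (a : ℕ) (B : Finset (Fin n)) : Prop :=
  ∃ e : ℕ → Fin n, (Finset.range B.card).image e = B ∧ ∀ i < B.card, f (a + i) = e i

theorem Frame.congr {n : ℕ} {f f' : ℕ → ℕ} {a a' : ℕ} {B : Finset (Fin n)} (h : Frame f a B)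
    (hf : ∀ i < B.card, f' (a' + i) = f (a + i)) : Frame f' a' B := by
  obtain ⟨e, he, hfe⟩ := h
  exact ⟨e, he, fun i hi => (hf i hi).trans (hfe i hi)⟩

theorem Frame.insert {n : ℕ} {f : ℕ → ℕ} {a : ℕ} {B : Finset (Fin n)} (h : Frame f a B)
    {v : Fin n} (hv : v ∉ B) (hf : f (a + B.card) = v) : Frame f a (insert v B) := by
  obtain ⟨e, he, hfe⟩ := h
  have hne : ∀ i ∈ Finset.range B.card, Function.update e B.card v i = e i := fun i hi =>
    Function.update_of_ne (Finset.mem_range.1 hi).ne _ _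
  refine ⟨Function.update e B.card v, ?_, ?_⟩
  · rw [Finset.card_insert_of_notMem hv, Finset.range_add_one, Finset.image_insert,
      Function.update_self, Finset.image_congr (g := e) (fun i hi => hne i hi), he]
  · intro i hi
    rw [Finset.card_insert_of_notMem hv] at hi
    rcases Nat.lt_succ_iff_lt_or_eq.1 hi with hi | rfl
    · rw [hne i (Finset.mem_range.2 hi)]
      exact hfe i hi
    · simpa using hf

/-- An element is deleted from a list by putting the last element in its place. -/
theorem Frame.erase {n : ℕ} {f f' : ℕ → ℕ} {a a' : ℕ} {B : Finset (Fin n)} (h : Frame f a B)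
    {v : Fin n} (hv : v ∈ B) (hf : ∀ i < B.card - 1,
      f' (a' + i) = if f (a + i) = v then f (a + (B.card - 1)) else f (a + i)) :
    Frame f' a' (B.erase v) := by
  obtain ⟨e, he, hfe⟩ := h
  have hpos : 0 < B.card := Finset.card_pos.2 ⟨v, hv⟩
  have hinj : Set.InjOn e (Finset.range B.card) := by
    rw [← Finset.card_image_iff, he, Finset.card_range]
  have hinj' : ∀ i < B.card, ∀ j < B.card, e i = e j → i = j := fun i hi j hj h =>
    hinj (by simpa using hi) (by simpa using hj) h
  refine ⟨fun i => if e i = v then e (B.card - 1) else e i, ?_, ?_⟩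
  · rw [Finset.card_erase_of_mem hv]
    ext u
    simp only [Finset.mem_image, Finset.mem_range, Finset.mem_erase]
    constructor
    · rintro ⟨i, hi, rfl⟩
      have hm : ∀ j < B.card, e j ∈ B := fun j hj => by
        have := Finset.mem_image_of_mem e (Finset.mem_range.2 hj)
        rwa [he] at this
      split_ifs with h
      · refine ⟨fun h' => ?_, hm _ (by omega)⟩
        have := hinj' i (by omega) _ (by omega) (h.trans h'.symm)
        omega
      · exact ⟨h, hm i (by omega)⟩
    · rintro ⟨huv, hu⟩
      rw [← he] at hu hv
      obtain ⟨i, hi, rfl⟩ := Finset.mem_image.1 hu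
      obtain ⟨j, hj, hjv⟩ := Finset.mem_image.1 hv
      rw [Finset.mem_range] at hi hj
      by_cases hl : i = B.card - 1
      · refine ⟨j, ?_, by rw [if_pos hjv, hl]⟩
        have : j ≠ i := by
          rintro rfl
          exact huv hjv
        omega
      · exact ⟨i, by omega, if_neg huv⟩
  · intro i hi
    rw [Finset.card_erase_of_mem hv] at hi
    rw [hf i hi, hfe i (by omega), hfe _ (by omega)]
    by_cases h : e i = v
    · simp [h]
    · simp [h, Fin.val_inj]

/-- The code `l` stands in the arrays from position `p` on. -/
def CodeAt (m : ℕ → ℕ → ℕ) (p : ℕ) (l : List (ℕ × ℕ)) : Prop :=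
  ∀ i (h : i < l.length), m arrType (p + i) = l[i].1 ∧ m arrVert (p + i) = l[i].2

theorem CodeAt.left {m : ℕ → ℕ → ℕ} {p : ℕ} {l l' : List (ℕ × ℕ)} (h : CodeAt m p (l ++ l')) :
    CodeAt m p l := by
  intro i hi
  have := h i (by simp; omega)
  rwa [List.getElem_append_left hi] at this

theorem CodeAt.right {m : ℕ → ℕ → ℕ} {p : ℕ} {l l' : List (ℕ × ℕ)} (h : CodeAt m p (l ++ l')) :
    CodeAt m (p + l.length) l' := by
  intro i hi
  have := h (l.length + i) (by simp; omega)
  rw [List.getElem_append_right (by omega)] at this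
  simpa [Nat.add_assoc] using this

theorem CodeAt.head {m : ℕ → ℕ → ℕ} {p : ℕ} {a : ℕ × ℕ} (h : CodeAt m p [a]) :
    m arrType p = a.1 ∧ m arrVert p = a.2 := by
  simpa using h 0 (by simp)

theorem CodeAt.congr {m m' : ℕ → ℕ → ℕ} {p : ℕ} {l : List (ℕ × ℕ)} (h : CodeAt m p l)
    (h2 : m' arrType = m arrType) (h3 : m' arrVert = m arrVert) : CodeAt m' p l := by
  intro i hi
  rw [h2, h3]
  exact h i hi

/-- Recording the bag of the child at a forget node, and removing the forgotten vertex from the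
topmost list of the stack. -/
def forgetCmd : Cmd :=
  .seq (.store arrStart (.var regV) (.var regPtr))
  (.seq (.store arrLen (.var regV) (.var regZ))
  (.seq (.fill arrNb regPtr regX regZ (.load arrStack (.op .add (.var regB) (.var regX))))
  (.seq (.fill arrOwner regPtr regX regZ (.var regV))
  (.seq (.assign regK (.cond (.op .lt (.var regK) (.var regZ)) (.var regZ) (.var regK)))
  (.seq (.assign regY (.op .sub (.var regZ) (.const 1)))
  (.seq (.assign regU (.load arrStack (.op .add (.var regB) (.var regY))))
  (.seq (.fill arrStack regB regX regY
    (.cond (.op .eq (.load arrNb (.op .add (.var regPtr) (.var regX))) (.var regV)) (.var regU)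
      (.load arrNb (.op .add (.var regPtr) (.var regX)))))
  (.seq (.store arrSize (.var regDepth) (.var regY))
    (.assign regPtr (.op .add (.var regPtr) (.var regZ)))))))))))

/-- One node in the pass over the bags. A stack holds the bags of the roots of the subtrees that
have been read completely, as lists of vertices; list number `d` starts at `arrBase[d]` and has
length `arrSize[d]`. -/
def bagBody : Cmd :=
  .seq (.assign regZ (.load arrSize (.var regDepth)))
  (.seq (.assign regB (.load arrBase (.var regDepth)))
  (.seq (.assign regV (.load arrVert (.var regPos)))
  (.seq (.ite (.op .eq (.load arrType (.var regPos)) (.const 0))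
    (.seq (.assign regDepth (.op .add (.var regDepth) (.const 1)))
      (.seq (.store arrBase (.var regDepth) (.op .add (.var regB) (.var regZ)))
        (.store arrSize (.var regDepth) (.const 0))))
    (.ite (.op .eq (.load arrType (.var regPos)) (.const 1))
      (.seq (.store arrStack (.op .add (.var regB) (.var regZ)) (.var regV))
        (.store arrSize (.var regDepth) (.op .add (.var regZ) (.const 1))))
      (.ite (.op .eq (.load arrType (.var regPos)) (.const 2)) forgetCmd
        (.assign regDepth (.op .sub (.var regDepth) (.const 1))))))
    (.assign regPos (.op .add (.var regPos) (.const 1))))))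

theorem tame_forgetCmd : forgetCmd.Tame := by
  refine .seq (.store ?_ ?_) (.seq (.store ?_ ?_) (.seq (.fill ?_ ?_ ?_ ?_ ?_)
    (.seq (.fill ?_ ?_ ?_ ?_ ?_) (.seq (.assign_small ?_ ?_ ?_) (.seq (.assign_small ?_ ?_ ?_)
    (.seq (.assign ?_ ?_) (.seq (.fill ?_ ?_ ?_ ?_ ?_) (.seq (.store ?_ ?_)
      (.assign ?_ ?_)))))))))
  case refine_17 =>
    intro N s hs
    have h1 := hs regZ (by norm_num) (by norm_num)
    have h2 := hs regK (by norm_num) (by norm_num)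
    by_cases h : s.reg regK < s.reg regZ <;> simp [Expr.eval, Op.fn, h, h1, h2]
  case refine_20 =>
    intro N s hs
    exact (Nat.sub_le _ _).trans (hs regZ (by norm_num) (by norm_num))
  all_goals simp [Expr.Ok, Expr.Sm]

/-- The part of `bagBody` after the first assignment. -/
theorem bagBody_polyOn : bagBody.WF 32 ∧
    PolyOn (fun N s => SmallRegs N s ∧ s.mem arrSize (s.reg regDepth) ≤ N) bagBody.cost ∧
    ∀ N s, SmallRegs N s → s.mem arrSize (s.reg regDepth) ≤ N → SmallRegs N (bagBody.run s) := by
  have h1 : ∀ N s, SmallRegs N s ∧ s.mem arrSize (s.reg regDepth) ≤ N →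
      SmallRegs N ((Cmd.assign regZ (.load arrSize (.var regDepth))).run s) := fun N s hs =>
    hs.1.setReg (.inr hs.2)
  have h2 : Expr.Ok (.load arrSize (.var regDepth)) := by simp [Expr.Ok]
  have h3 : ∀ c c', bagBody = .seq c c' → c'.Tame := by
    rintro c c' h
    cases h
    refine .seq (.assign ?_ ?_) (.seq (.assign ?_ ?_) (.seq (.ite ?_ (.seq (.assign ?_ ?_)
      (.seq (.store ?_ ?_) (.store ?_ ?_))) (.ite ?_ (.seq (.store ?_ ?_) (.store ?_ ?_))
      (.ite ?_ tame_forgetCmd (.assign ?_ ?_)))) (.assign ?_ ?_)))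
    all_goals simp [Expr.Ok, Expr.Sm]
  have h4 := h3 _ _ rfl
  exact ⟨⟨⟨by norm_num, h2.wf⟩, h4.wf⟩,
    Cmd.polyOn_seq ((Cmd.polyOn_assign h2).weaken fun _ _ hs => hs.1) h4.cost h1,
    fun N s hs hs' => h4.small N _ (h1 N s ⟨hs, hs'⟩)⟩

/-- The effect of `forgetCmd` on the registers and arrays that matter. -/
theorem forgetCmd_run (s : State) :
    ((forgetCmd.run s).reg regPtr = s.reg regPtr + s.reg regZ ∧
      (forgetCmd.run s).reg regK = max (s.reg regK) (s.reg regZ) ∧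
      ∀ x < 5, (forgetCmd.run s).reg x = s.reg x) ∧
    (forgetCmd.run s).mem arrStart = Function.update (s.mem arrStart) (s.reg regV) (s.reg regPtr) ∧
    (forgetCmd.run s).mem arrLen = Function.update (s.mem arrLen) (s.reg regV) (s.reg regZ) ∧
    (forgetCmd.run s).mem arrNb = Cmd.segment (s.mem arrNb) (s.reg regPtr) (s.reg regZ)
      (fun i => s.mem arrStack (s.reg regB + i)) ∧
    (forgetCmd.run s).mem arrOwner = Cmd.segment (s.mem arrOwner) (s.reg regPtr) (s.reg regZ)
      (fun _ => s.reg regV) ∧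
    (forgetCmd.run s).mem arrStack = Cmd.segment (s.mem arrStack) (s.reg regB) (s.reg regZ - 1)
      (fun i => if s.mem arrStack (s.reg regB + i) = s.reg regV then
        s.mem arrStack (s.reg regB + (s.reg regZ - 1)) else s.mem arrStack (s.reg regB + i)) ∧
    (forgetCmd.run s).mem arrSize =
      Function.update (s.mem arrSize) (s.reg regDepth) (s.reg regZ - 1) ∧
    ∀ k, k < 5 ∨ 10 < k → (forgetCmd.run s).mem k = s.mem k := by
  rw [forgetCmd, Cmd.run, Cmd.run, Cmd.run, Cmd.run, Cmd.run]
  rw [Cmd.fill_run (g := fun i => s.mem arrStack (s.reg regB + i)) (by norm_num) (by norm_num)]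
  rw [Cmd.run, Cmd.fill_run (g := fun _ => s.reg regV) (by norm_num) (by norm_num)]
  simp only [Cmd.run]
  rw [Cmd.fill_run (g := fun i => if s.mem arrStack (s.reg regB + i) = s.reg regV then
    s.mem arrStack (s.reg regB + (s.reg regZ - 1)) else s.mem arrStack (s.reg regB + i))
    (by norm_num) (by norm_num)]
  · refine ⟨⟨?_, ?_, ?_⟩, ?_, ?_, ?_, ?_, ?_, ?_, ?_⟩
    case refine_2 =>
      by_cases h : s.reg regK < s.reg regZ
      · simp [State.setReg, State.setMem, Expr.eval, Op.fn, h, h.le]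
      · simp [State.setReg, State.setMem, Expr.eval, Op.fn, h, not_lt.1 h]
    case refine_3 =>
      intro x hx
      have h1 : x ≠ 5 := by omega
      have h2 : x ≠ 10 := by omega
      have h3 : x ≠ 12 := by omega
      have h4 : x ≠ 14 := by omega
      have h5 : x ≠ 20 := by omega
      simp [State.setReg, State.setMem, h1, h2, h3, h4, h5]
    case refine_10 =>
      intro k hk
      have h1 : k ≠ 5 := by omega
      have h2 : k ≠ 6 := by omega
      have h3 : k ≠ 7 := by omega
      have h4 : k ≠ 8 := by omega
      have h5 : k ≠ 9 := by omega
      have h6 : k ≠ 10 := by omega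
      simp [State.setReg, State.setMem, h1, h2, h3, h4, h5, h6]
    all_goals simp [State.setReg, State.setMem, Expr.eval, Op.fn]
  · intro j hj
    simp only [State.setReg, Expr.eval, Op.fn] at hj
    simp [State.setReg, State.setMem, Expr.eval, Op.fn] at hj ⊢
    rw [Cmd.segment_of_lt (by omega)]
  all_goals
    intro j hj
    simp [State.setMem, Expr.eval, Op.fn]

/-- The record about the vertex `v` that is made at its forget node: the child has the bag `B`. -/
structure Recorded {n : ℕ} (s : State) (v : Fin n) (B : Finset (Fin n)) : Prop where
  len : s.mem arrLen v = B.card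
  card_le : B.card ≤ s.reg regK
  le_ptr : s.mem arrStart v + B.card ≤ s.reg regPtr
  frame : Frame (s.mem arrNb) (s.mem arrStart v) B
  owner : ∀ i < B.card, s.mem arrOwner (s.mem arrStart v + i) = v

theorem Recorded.mono {n : ℕ} {s s' : State} {v : Fin n} {B : Finset (Fin n)}
    (h : Recorded s v B) (h1 : s'.mem arrStart v = s.mem arrStart v)
    (h2 : s'.mem arrLen v = s.mem arrLen v) (h3 : s.reg regK ≤ s'.reg regK)
    (h4 : s.reg regPtr ≤ s'.reg regPtr) (h5 : ∀ a < s.reg regPtr,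
      s'.mem arrNb a = s.mem arrNb a ∧ s'.mem arrOwner a = s.mem arrOwner a) :
    Recorded s' v B := by
  have hle := h.le_ptr
  refine ⟨by rw [h2, h.len], h.card_le.trans h3, by rw [h1]; omega, ?_, ?_⟩
  · refine h.frame.congr fun i hi => ?_
    rw [h1]
    exact (h5 _ (by omega)).1
  · intro i hi
    rw [h1, (h5 _ (by omega)).2]
    exact h.owner i hi

/-- The state `s'` after the pass over the code of the subtree `T`, started in the state `s`: the
bag of the root of `T` has been put on the stack, and there are records for the forget nodes. -/
structure BagPost {n : ℕ} (t : ℕ) (T : NiceTree (Fin n)) (s s' : State) : Prop where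
  pos : s'.reg regPos = s.reg regPos + T.code.length
  depth : s'.reg regDepth = s.reg regDepth + 1
  ptr : s.reg regPtr ≤ s'.reg regPtr
  le_k : s.reg regK ≤ s'.reg regK
  k_le : s.reg regK ≤ t + 1 → s'.reg regK ≤ t + 1
  len_le : (∀ a, s.mem arrLen a ≤ t + 1) → ∀ a, s'.mem arrLen a ≤ t + 1
  reg : ∀ x < 3, s'.reg x = s.reg x
  mem : ∀ k, k < 4 ∨ 10 < k → s'.mem k = s.mem k
  below : ∀ d ≤ s.reg regDepth, s'.mem arrBase d = s.mem arrBase d ∧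
    s'.mem arrSize d = s.mem arrSize d
  base : s'.mem arrBase (s.reg regDepth + 1) =
    s.mem arrBase (s.reg regDepth) + s.mem arrSize (s.reg regDepth)
  size : s'.mem arrSize (s.reg regDepth + 1) = T.rootBag.card
  stack : ∀ a < s.mem arrBase (s.reg regDepth) + s.mem arrSize (s.reg regDepth),
    s'.mem arrStack a = s.mem arrStack a
  frame : Frame (s'.mem arrStack)
    (s.mem arrBase (s.reg regDepth) + s.mem arrSize (s.reg regDepth)) T.rootBag
  start : ∀ v ∉ T.forg, s'.mem arrStart (v : Fin n) = s.mem arrStart v ∧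
    s'.mem arrLen v = s.mem arrLen v
  nb : ∀ a < s.reg regPtr, s'.mem arrNb a = s.mem arrNb a ∧ s'.mem arrOwner a = s.mem arrOwner a
  recorded : ∀ p ∈ T.forgets, Recorded s' p.1 p.2

open NiceTree in
/-- The effect of the pass over the bags on the code of a subtree, by induction on the tree. -/
theorem bagBody_steps {n t N τ : ℕ} [Nonempty (Fin n)]
    {G : SimpleGraph (Fin n)} {T : NiceTree (Fin n)}
    (hT : T.Sep G) (ht : T.WidthLE t) (hN : t + 1 ≤ N)
    (hτ : ∀ s, SmallRegs N s → s.mem arrSize (s.reg regDepth) ≤ N → bagBody.cost s ≤ τ)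
    {s : State} (hs : SmallRegs N s) (hsz : s.mem arrSize (s.reg regDepth) ≤ N)
    (hcode : CodeAt s.mem (s.reg regPos) T.code) :
    ∃ s', Cmd.Steps bagBody T.code.length τ s s' ∧ SmallRegs N s' ∧ BagPost t T s s' := by
  have hsmall := bagBody_polyOn.2.2
  induction T generalizing s with
  | leaf =>
    obtain ⟨h2, h3⟩ := CodeAt.head hcode
    simp only at h2
    refine ⟨_, .one (hτ s hs hsz) rfl, hsmall N s hs hsz, ?_⟩
    have hrun : bagBody.run s = ((((((s.setReg regZ (s.mem arrSize (s.reg regDepth))).setReg regB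
        (s.mem arrBase (s.reg regDepth))).setReg regV (s.mem arrVert (s.reg regPos))).setReg
        regDepth (s.reg regDepth + 1)).setMem arrBase (s.reg regDepth + 1)
        (s.mem arrBase (s.reg regDepth) + s.mem arrSize (s.reg regDepth))).setMem arrSize
        (s.reg regDepth + 1) 0).setReg regPos (s.reg regPos + 1) := by
      simp [bagBody, Cmd.run, Expr.eval, Op.fn, h2]
    rw [hrun]
    refine ⟨by simp [code], by simp, by simp, by simp, by simp, by simp, ?_, ?_, ?_, by simp,
      by simp [rootBag], by simp, ?_, by simp, by simp, by simp [forgets]⟩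
    · intro x hx
      have h4 : x ≠ 3 := by omega
      have h5 : x ≠ 4 := by omega
      have h6 : x ≠ 6 := by omega
      have h7 : x ≠ 7 := by omega
      have h8 : x ≠ 13 := by omega
      simp [h4, h5, h6, h7, h8]
    · intro k hk
      have h4 : k ≠ 4 := by omega
      have h5 : k ≠ 5 := by omega
      funext a
      simp [h4, h5]
    · intro d hd
      have h4 : d ≠ s.reg regDepth + 1 := by omega
      simp [h4]
    · obtain ⟨v⟩ := ‹Nonempty (Fin n)›
      exact ⟨fun _ => v, by simp [rootBag], by simp [rootBag]⟩
  | introduce v T ih =>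
    obtain ⟨s₁, hsteps, hs₁, h₁⟩ := ih hT.2.2 ht.of_introduce hs hsz hcode.left
    have hsz₁ : s₁.mem arrSize (s₁.reg regDepth) ≤ N := by
      rw [h₁.depth, h₁.size]
      exact ht.of_introduce.rootBag.trans hN
    obtain ⟨h2, h3⟩ := (hcode.right.congr (h₁.mem arrType (by norm_num))
      (h₁.mem arrVert (by norm_num))).head
    rw [← h₁.pos] at h2 h3
    simp only at h2 h3
    refine ⟨_, by simpa [code] using hsteps.add (.one (hτ s₁ hs₁ hsz₁) rfl),
      hsmall N s₁ hs₁ hsz₁, ?_⟩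
    have hrun : bagBody.run s₁ = (((((s₁.setReg regZ T.rootBag.card).setReg regB
        (s.mem arrBase (s.reg regDepth) + s.mem arrSize (s.reg regDepth))).setReg regV v).setMem
        arrStack (s.mem arrBase (s.reg regDepth) + s.mem arrSize (s.reg regDepth) +
          T.rootBag.card) v).setMem arrSize
        (s.reg regDepth + 1) (T.rootBag.card + 1)).setReg regPos (s₁.reg regPos + 1) := by
      simp [bagBody, Cmd.run, Expr.eval, Op.fn, h2, h3, h₁.depth, h₁.base, h₁.size]
    rw [hrun]
    refine ⟨by simp [code, h₁.pos, Nat.add_assoc], by simp [h₁.depth], by simp [h₁.ptr],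
      by simp [h₁.le_k], by simpa using h₁.k_le, by simpa using h₁.len_le, ?_, ?_, ?_,
      by simp [h₁.base],
      by simp [rootBag, hT.1], ?_, ?_, by simpa [forg] using h₁.start, by simpa using h₁.nb, ?_⟩
    · intro x hx
      have h4 : x ≠ 3 := by omega
      have h6 : x ≠ 6 := by omega
      have h7 : x ≠ 7 := by omega
      have h8 : x ≠ 13 := by omega
      simp [h4, h6, h7, h8, h₁.reg x hx]
    · intro k hk
      have h4 : k ≠ 6 := by omega
      have h5 : k ≠ 5 := by omega
      funext a
      simp [h4, h5, h₁.mem k hk]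
    · intro d hd
      have h4 : d ≠ s.reg regDepth + 1 := by omega
      simpa [h4] using h₁.below d hd
    · intro a ha
      have h4 : a ≠ s.mem arrBase (s.reg regDepth) + s.mem arrSize (s.reg regDepth) +
          T.rootBag.card := by omega
      simpa [h4] using h₁.stack a ha
    · refine Frame.insert (h₁.frame.congr fun i hi => ?_) hT.1 (by simp)
      have h4 : i ≠ T.rootBag.card := hi.ne
      simp [h4]
    · exact fun p hp => (h₁.recorded p hp).mono (by simp) (by simp) (by simp) (by simp) (by simp)
  | forget v T ih =>
    obtain ⟨s₁, hsteps, hs₁, h₁⟩ := ih hT.2.2 ht.of_forget hs hsz hcode.left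
    have hsz₁ : s₁.mem arrSize (s₁.reg regDepth) ≤ N := by
      rw [h₁.depth, h₁.size]
      exact ht.of_forget.rootBag.trans hN
    obtain ⟨h2, h3⟩ := (hcode.right.congr (h₁.mem arrType (by norm_num))
      (h₁.mem arrVert (by norm_num))).head
    rw [← h₁.pos] at h2 h3
    simp only at h2 h3
    refine ⟨_, by simpa [code] using hsteps.add (.one (hτ s₁ hs₁ hsz₁) rfl),
      hsmall N s₁ hs₁ hsz₁, ?_⟩
    set β := s.mem arrBase (s.reg regDepth) + s.mem arrSize (s.reg regDepth) with hβ
    set s₂ := ((s₁.setReg regZ T.rootBag.card).setReg regB β).setReg regV v with hs₂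
    have hrun : bagBody.run s₁ = (forgetCmd.run s₂).setReg regPos (s₁.reg regPos + 1) := by
      have := (forgetCmd_run s₂).1.2.2 regPos (by norm_num)
      rw [show s₂.reg regPos = s₁.reg regPos by simp [s₂]] at this
      have h4 : s₂.mem arrType (s₂.reg regPos) = 2 := by simp [s₂, h2]
      simp [bagBody, Cmd.run, Expr.eval, Op.fn, h3, h₁.depth, h₁.base, h₁.size, ← hβ, ← hs₂,
        this, h4]
    obtain ⟨⟨e1, e2, e3⟩, e4, e5, e6, e7, e8, e9, e10⟩ := forgetCmd_run s₂
    have hr : ∀ x, x ≠ 6 → x ≠ 7 → x ≠ 13 → s₂.reg x = s₁.reg x := fun x h6 h7 h13 => by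
      simp [s₂, h6, h7, h13]
    have hm : s₂.mem = s₁.mem := rfl
    have hz : s₂.reg regZ = T.rootBag.card := by simp [s₂]
    have hv : s₂.reg regV = v := by simp [s₂]
    have hb : s₂.reg regB = β := by simp [s₂]
    rw [hr _ (by norm_num) (by norm_num) (by norm_num), hz] at e1 e2
    rw [hm, hv, hr regPtr (by norm_num) (by norm_num) (by norm_num)] at e4
    rw [hm, hv, hz] at e5
    rw [hm, hb, hz, hr regPtr (by norm_num) (by norm_num) (by norm_num)] at e6
    rw [hm, hv, hz, hr regPtr (by norm_num) (by norm_num) (by norm_num)] at e7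
    rw [hm, hb, hz, hv] at e8
    rw [hm, hz, hr regDepth (by norm_num) (by norm_num) (by norm_num)] at e9
    rw [hm] at e10
    have e11 : (forgetCmd.run s₂).mem arrBase = s₁.mem arrBase := e10 4 (by norm_num)
    have hcard := ht.of_forget.rootBag
    have hrec : Recorded ((forgetCmd.run s₂).setReg regPos (s₁.reg regPos + 1)) v T.rootBag := by
      refine ⟨by simp [e5], by simp [e2], by simp [e4, e1], ?_, ?_⟩
      · refine h₁.frame.congr fun i hi => ?_
        simp only [State.setReg_mem, e4, e6, Function.update_self]
        exact Cmd.segment_of_lt hi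
      · intro i hi
        simp only [State.setReg_mem, e4, e7, Function.update_self]
        exact Cmd.segment_of_lt hi
    rw [hrun]
    refine ⟨by simp [code, h₁.pos, Nat.add_assoc], ?_, ?_, ?_, ?_, ?_, ?_, ?_, ?_, ?_, ?_, ?_,
      ?_, ?_, ?_, ?_⟩
    · have := e3 regDepth (by norm_num)
      simp [this, s₂, h₁.depth]
    · have := h₁.ptr
      simp only [State.setReg_reg, e1]
      norm_num
      omega
    · have := h₁.le_k
      simp only [State.setReg_reg, e2]
      norm_num
      omega
    · intro hk
      have := h₁.k_le hk
      simp only [State.setReg_reg, e2]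
      norm_num
      omega
    · intro hlen a
      rw [State.setReg_mem, e5, Function.update_apply]
      split_ifs
      · exact hcard
      · exact h₁.len_le hlen a
    · intro x hx
      have h4 : x ≠ 3 := by omega
      simp only [State.setReg_reg, h4, if_false]
      rw [e3 x (by omega), hr x (by omega) (by omega) (by omega), h₁.reg x hx]
    · intro k hk
      rw [State.setReg_mem, e10 k (by omega), h₁.mem k hk]
    · intro d hd
      have h4 : d ≠ s.reg regDepth + 1 := by omega
      rw [State.setReg_mem, e11, e9, h₁.depth, Function.update_of_ne h4]
      exact h₁.below d hd
    · rw [State.setReg_mem, e11, h₁.base]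
    · rw [State.setReg_mem, e9, h₁.depth, Function.update_self, rootBag,
        Finset.card_erase_of_mem hT.1]
    · intro a ha
      rw [State.setReg_mem, e8, Cmd.segment_of_not (.inl ha)]
      exact h₁.stack a ha
    · refine h₁.frame.erase hT.1 fun i hi => ?_
      rw [State.setReg_mem, e8]
      exact Cmd.segment_of_lt hi
    · intro u hu
      have hu' : (u : ℕ) ≠ v := fun h => hu (Fin.ext h ▸ Finset.mem_insert_self _ _)
      rw [State.setReg_mem, e4, e5, Function.update_of_ne hu', Function.update_of_ne hu']
      exact h₁.start u fun h => hu (Finset.mem_insert_of_mem h)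
    · intro a ha
      have := h₁.ptr
      rw [State.setReg_mem, e6, e7, Cmd.segment_of_not (.inl (by omega)),
        Cmd.segment_of_not (.inl (by omega))]
      exact h₁.nb a ha
    · intro p hp
      simp only [forgets, List.mem_append, List.mem_singleton] at hp
      rcases hp with hp | rfl
      · have hpv : (p.1 : ℕ) ≠ v := fun h => by
          have h4 := mem_forg_of_mem_forgets hp
          rw [Fin.ext h] at h4
          exact Finset.disjoint_left.1 hT.2.2.disjoint hT.1 h4
        refine (h₁.recorded p hp).mono ?_ ?_ ?_ ?_ ?_
        · rw [State.setReg_mem, e4, Function.update_of_ne hpv]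
        · rw [State.setReg_mem, e5, Function.update_of_ne hpv]
        · simp [e2]
        · simp [e1]
        · intro a ha
          rw [State.setReg_mem, e6, e7, Cmd.segment_of_not (.inl (by omega)),
            Cmd.segment_of_not (.inl (by omega))]
          exact ⟨rfl, rfl⟩
      · exact hrec
  | join T₁ T₂ ih₁ ih₂ =>
    obtain ⟨hbag, hdisj, hT₁, hT₂⟩ := hT
    rw [code] at hcode
    obtain ⟨s₁, hsteps, hs₁, h₁⟩ := ih₁ hT₁ ht.of_left hs hsz hcode.left.left
    have hsz₁ : s₁.mem arrSize (s₁.reg regDepth) ≤ N := by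
      rw [h₁.depth, h₁.size]
      exact ht.of_left.rootBag.trans hN
    obtain ⟨s₂, hsteps', hs₂, h₂⟩ := ih₂ hT₂ ht.of_right hs₁ hsz₁ (by
      rw [h₁.pos]
      exact hcode.left.right.congr (h₁.mem arrType (by norm_num)) (h₁.mem arrVert (by norm_num)))
    have hsz₂ : s₂.mem arrSize (s₂.reg regDepth) ≤ N := by
      rw [h₂.depth, h₂.size]
      exact ht.of_right.rootBag.trans hN
    have hmem : ∀ k, k < 4 ∨ 10 < k → s₂.mem k = s.mem k := fun k hk =>
      (h₂.mem k hk).trans (h₁.mem k hk)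
    have hpos : s₂.reg regPos = s.reg regPos + (T₁.code ++ T₂.code).length := by
      rw [h₂.pos, h₁.pos, List.length_append, Nat.add_assoc]
    obtain ⟨h2, -⟩ := (hcode.right.congr (hmem arrType (by norm_num))
      (hmem arrVert (by norm_num))).head
    rw [← hpos] at h2
    simp only at h2
    refine ⟨_, by simpa [code, Nat.add_assoc] using
      (hsteps.add hsteps').add (.one (hτ s₂ hs₂ hsz₂) rfl), hsmall N s₂ hs₂ hsz₂, ?_⟩
    have hrun : bagBody.run s₂ = ((((s₂.setReg regZ (s₂.mem arrSize (s₂.reg regDepth))).setReg regB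
        (s₂.mem arrBase (s₂.reg regDepth))).setReg regV (s₂.mem arrVert (s₂.reg regPos))).setReg
        regDepth (s.reg regDepth + 1)).setReg regPos (s₂.reg regPos + 1) := by
      simp [bagBody, Cmd.run, Expr.eval, Op.fn, h2, h₂.depth, h₁.depth]
    rw [hrun]
    have hbel := h₂.below (s.reg regDepth + 1) (by rw [h₁.depth])
    have hst := h₂.stack
    rw [h₁.depth, h₁.base, h₁.size] at hst
    have hp := h₁.ptr
    refine ⟨by simp [code, hpos, Nat.add_assoc], by simp, by simpa using hp.trans h₂.ptr,
      by simpa using h₁.le_k.trans h₂.le_k, by simpa using fun h => h₂.k_le (h₁.k_le h),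
      by simpa using fun h => h₂.len_le (h₁.len_le h), ?_, by simpa using hmem, ?_,
      by simp [hbel.1, h₁.base], by simp [hbel.2, h₁.size, rootBag],
      ?_, ?_, ?_, ?_, ?_⟩
    · intro x hx
      have h4 : x ≠ 3 := by omega
      have h5 : x ≠ 4 := by omega
      have h6 : x ≠ 6 := by omega
      have h7 : x ≠ 7 := by omega
      have h8 : x ≠ 13 := by omega
      simp [h4, h5, h6, h7, h8, h₂.reg x hx, h₁.reg x hx]
    · intro d hd
      have h4 := h₁.below d hd
      have h5 := h₂.below d (by rw [h₁.depth]; omega)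
      simp [h5, h4]
    · intro a ha
      simp only [State.setReg_mem]
      rw [hst a (by omega), h₁.stack a ha]
    · refine h₁.frame.congr fun i hi => ?_
      simp only [State.setReg_mem]
      exact hst _ (by omega)
    · intro u hu
      simp only [forg, Finset.mem_union, not_or] at hu
      have h4 := h₁.start u hu.1
      have h5 := h₂.start u hu.2
      simp [h5, h4]
    · intro a ha
      have h4 := h₁.nb a ha
      have h5 := h₂.nb a (by omega)
      simp [h5, h4]
    · intro p hp
      simp only [forgets, List.mem_append] at hp
      rcases hp with hp | hp
      · have h4 := h₂.start p.1 fun h =>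
          Finset.disjoint_left.1 hdisj (mem_forg_of_mem_forgets hp) h
        exact (h₁.recorded p hp).mono (by simp [h4]) (by simp [h4]) (by simpa using h₂.le_k)
          (by simpa using h₂.ptr) (by simpa using h₂.nb)
      · exact (h₂.recorded p hp).mono (by simp) (by simp) (by simp) (by simp) (by simp)

/-! ### Marking the edges inside the recorded bags -/

theorem Cmd.run_seq (c c' : Cmd) (s : State) : (Cmd.seq c c').run s = c'.run (c.run s) := by
  rw [Cmd.run]

theorem Cmd.run_assign (x : ℕ) (e : Expr) (s : State) :
    (Cmd.assign x e).run s = s.setReg x (e.eval s) := by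
  rw [Cmd.run]

/-- The small registers, the recorded lengths and the slots are at most `N`. -/
structure SmallData (N : ℕ) (s : State) : Prop where
  regs : SmallRegs N s
  len : ∀ a, s.mem arrLen a ≤ N
  slot : ∀ a, s.mem arrSlot a ≤ N

/-- Commands that keep the data small, at polynomial cost. -/
structure TameData (c : Cmd) : Prop where
  wf : c.WF 32
  cost : PolyOn SmallData c.cost
  small : ∀ N s, SmallData N s → SmallData N (c.run s)

namespace TameData

theorem seq {c c' : Cmd} (h : TameData c) (h' : TameData c') : TameData (.seq c c') :=
  ⟨⟨h.wf, h'.wf⟩, Cmd.polyOn_seq h.cost h'.cost h.small,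
    fun N s hs => h'.small N _ (h.small N s hs)⟩

theorem ite {e : Expr} {c c' : Cmd} (he : e.Ok) (h : TameData c) (h' : TameData c') :
    TameData (.ite e c c') := by
  refine ⟨⟨he.wf, h.wf, h'.wf⟩, Cmd.polyOn_ite (he.polyOn.weaken fun _ _ hs => hs.regs)
    (h.cost.weaken fun _ _ hs => hs.1) (h'.cost.weaken fun _ _ hs => hs.1), fun N s hs => ?_⟩
  rw [Cmd.run]
  split_ifs
  · exact h.small N s hs
  · exact h'.small N s hs

theorem assign {x : ℕ} {e : Expr} (hx : x < 12) (he : e.Ok) : TameData (.assign x e) :=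
  ⟨⟨by omega, he.wf⟩, (Cmd.polyOn_assign he).weaken fun _ _ hs => hs.regs,
    fun _ _ hs => ⟨hs.regs.setReg (.inl hx), hs.len, hs.slot⟩⟩

theorem assign_small {x : ℕ} {e : Expr} (hx : x < 32) (he : e.Ok)
    (h : ∀ N s, SmallData N s → e.eval s ≤ N) : TameData (.assign x e) :=
  ⟨⟨hx, he.wf⟩, (Cmd.polyOn_assign he).weaken fun _ _ hs => hs.regs,
    fun N s hs => ⟨hs.regs.setReg (.inr (h N s hs)), hs.len, hs.slot⟩⟩

theorem store_slot {a e : Expr} (ha : a.Ok) (he : e.Ok)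
    (h : ∀ N s, SmallData N s → e.eval s ≤ N) : TameData (.store arrSlot a e) := by
  refine ⟨⟨ha.wf, he.wf⟩, (Cmd.polyOn_store ha he).weaken fun _ _ hs => hs.regs,
    fun N s hs => ⟨hs.regs.of_reg rfl, fun b => ?_, fun b => ?_⟩⟩
  · simpa [Cmd.run] using hs.len b
  · simp only [Cmd.run, State.setMem_mem]
    split_ifs
    · exact h N s hs
    · exact hs.slot b

theorem fill {k y x z : ℕ} {e : Expr} (hk : k ≠ arrLen ∧ k ≠ arrSlot) (hx : 12 ≤ x ∧ x < 32)
    (hz : 12 ≤ z ∧ z < 32) (hy : y < 32) (hxz : z ≠ x) (he : e.Ok) :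
    TameData (.fill k y x z e) := by
  have h := Cmd.Tame.fill (k := k) hx hz hy hxz he
  refine ⟨h.wf, h.cost.weaken fun _ _ hs => hs.regs, fun N s hs => ?_⟩
  have key : ∀ k', k' ≠ k → ((Cmd.fill k y x z e).run s).mem k' = s.mem k' := by
    intro k' hk'
    have : ∀ j (s₀ : State), ((Cmd.run (.seq (.store k (.op .add (.var y) (.var x)) e)
        (.assign x (.op .add (.var x) (.const 1)))))^[j] s₀).mem k' = s₀.mem k' := by
      intro j s₀
      induction j with
      | zero => rfl
      | succ j ih =>
        rw [Function.iterate_succ_apply', ← ih]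
        simp [Cmd.run, State.setMem, hk']
    exact this _ _
  exact ⟨h.small N s hs.regs, fun a => by rw [key _ hk.1.symm]; exact hs.len a,
    fun a => by rw [key _ hk.2.symm]; exact hs.slot a⟩

end TameData

/-- Mark the entry `u` in the list of the vertex `v`, for `v` in register `regV` and `u` in register
`regU`. -/
def markHalf : Cmd :=
  .seq (.assign regZ (.load arrLen (.var regV)))
  (.seq (.assign regA (.load arrStart (.var regV)))
    (.fill arrMark regA regX regZ
      (.cond (.op .eq (.load arrNb (.op .add (.var regA) (.var regX))) (.var regU)) (.const 1)
        (.load arrMark (.op .add (.var regA) (.var regX))))))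

/-- Mark an edge in the lists of both ends. -/
def markBody : Cmd :=
  .seq (.assign regV (.load arrEnd (.var regPos)))
  (.seq (.assign regU (.load arrEnd' (.var regPos)))
  (.seq markHalf
  (.seq (.assign regV (.load arrEnd' (.var regPos)))
  (.seq (.assign regU (.load arrEnd (.var regPos)))
  (.seq markHalf
    (.assign regPos (.op .add (.var regPos) (.const 1))))))))

theorem tameData_markHalf : TameData markHalf := by
  refine .seq (.assign_small ?_ ?_ fun N s hs => hs.len _) (.seq (.assign ?_ ?_)
    (.fill ?_ ?_ ?_ ?_ ?_ ?_))
  all_goals simp [Expr.Ok, Expr.Sm]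

theorem tameData_markBody : TameData markBody := by
  refine .seq (.assign ?_ ?_) (.seq (.assign ?_ ?_) (.seq tameData_markHalf
    (.seq (.assign ?_ ?_) (.seq (.assign ?_ ?_) (.seq tameData_markHalf (.assign ?_ ?_))))))
  all_goals simp [Expr.Ok, Expr.Sm]

theorem markHalf_run (s : State) :
    (∀ x < 11, (markHalf.run s).reg x = s.reg x) ∧
    (markHalf.run s).reg regK = s.reg regK ∧
    (∀ k, k ≠ arrMark → (markHalf.run s).mem k = s.mem k) ∧
    (markHalf.run s).mem arrMark =
      Cmd.segment (s.mem arrMark) (s.mem arrStart (s.reg regV)) (s.mem arrLen (s.reg regV))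
        (fun i => if s.mem arrNb (s.mem arrStart (s.reg regV) + i) = s.reg regU then 1
          else s.mem arrMark (s.mem arrStart (s.reg regV) + i)) := by
  rw [markHalf, Cmd.run_seq, Cmd.run_seq]
  rw [Cmd.fill_run (g := fun i => if s.mem arrNb (s.mem arrStart (s.reg regV) + i) = s.reg regU
    then 1 else s.mem arrMark (s.mem arrStart (s.reg regV) + i)) (by norm_num) (by norm_num)]
  · refine ⟨fun x hx => ?_, ?_, fun k hk => ?_, ?_⟩
    · have h1 : x ≠ 11 := by omega
      have h2 : x ≠ 13 := by omega
      have h3 : x ≠ 14 := by omega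
      simp [Cmd.run, h1, h2, h3]
    · simp [Cmd.run]
    · simp [Cmd.run, hk]
    · simp [Cmd.run, Expr.eval]
  · intro j _
    have := Cmd.segment_of_not (f := s.mem arrMark) (a := s.mem arrStart (s.reg regV)) (len := j)
      (g := fun i => if s.mem arrNb (s.mem arrStart (s.reg regV) + i) = s.reg regU then 1
        else s.mem arrMark (s.mem arrStart (s.reg regV) + i))
      (i := s.mem arrStart (s.reg regV) + j) (.inr le_rfl)
    simp [Cmd.run, Expr.eval, Op.fn, this]

/-- The state before the edges are marked: all vertices have records. -/
def AllRecorded {n : ℕ} (s : State) (B : Fin n → Finset (Fin n)) : Prop :=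
  ∀ v, Recorded s v (B v)

theorem Recorded.congr {n : ℕ} {s s' : State} {v : Fin n} {B : Finset (Fin n)}
    (h : Recorded s v B) (hk : s'.reg regK = s.reg regK) (hp : s'.reg regPtr = s.reg regPtr)
    (hm : ∀ k, 7 ≤ k → k ≤ 10 → s'.mem k = s.mem k) : Recorded s' v B :=
  h.mono (by rw [hm _ (by norm_num) (by norm_num)]) (by rw [hm _ (by norm_num) (by norm_num)])
    hk.ge hp.ge fun a _ => by
      rw [hm arrNb (by norm_num) (by norm_num), hm arrOwner (by norm_num) (by norm_num)]
      exact ⟨rfl, rfl⟩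

/-- The owner of an entry determines in whose list the entry is. -/
theorem markHalf_mark {n : ℕ} {s : State} {B : Fin n → Finset (Fin n)} (hB : AllRecorded s B)
    {u w v : Fin n} (hu : s.reg regV = u) (hw : s.reg regU = w) {i : ℕ} (hi : i < (B v).card) :
    (markHalf.run s).mem arrMark (s.mem arrStart v + i) ≠ 0 ↔
      (v = u ∧ s.mem arrNb (s.mem arrStart v + i) = w) ∨
        s.mem arrMark (s.mem arrStart v + i) ≠ 0 := by
  rw [(markHalf_run s).2.2.2, hu, hw, (hB u).len]
  by_cases hvu : v = u
  · subst hvu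
    rw [Cmd.segment_of_lt hi]
    split_ifs with h <;> simp [h]
  · rw [Cmd.segment_of_not]
    · simp [hvu]
    · -- an entry in the list of `u` is owned by `u`
      by_contra hcon
      have h1 := (hB u).owner (s.mem arrStart v + i - s.mem arrStart u) (by omega)
      rw [show s.mem arrStart u + (s.mem arrStart v + i - s.mem arrStart u) =
        s.mem arrStart v + i by omega, (hB v).owner i hi] at h1
      exact hvu (Fin.ext h1)

theorem markBody_run {s : State} {a b : ℕ} (ha : s.mem arrEnd (s.reg regPos) = a)
    (hb : s.mem arrEnd' (s.reg regPos) = b) : markBody.run s =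
      (markHalf.run (((markHalf.run ((s.setReg regV a).setReg regU b)).setReg regV b).setReg
        regU a)).setReg regPos (s.reg regPos + 1) := by
  obtain ⟨s₁, hs₁⟩ : ∃ s₁, s₁ = (s.setReg regV a).setReg regU b := ⟨_, rfl⟩
  have h1 : (Cmd.assign regU (.load arrEnd' (.var regPos))).run
      ((Cmd.assign regV (.load arrEnd (.var regPos))).run s) = s₁ := by
    rw [Cmd.run_assign, Cmd.run_assign, hs₁]
    simp [Expr.eval, ha, hb]
  obtain ⟨h2, -, h3, -⟩ := markHalf_run s₁
  obtain ⟨s₂, hs₂⟩ : ∃ s₂, s₂ = markHalf.run s₁ := ⟨_, rfl⟩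
  rw [← hs₂] at h2 h3
  have h4 : s₂.reg regPos = s.reg regPos := by
    rw [h2 _ (by norm_num), hs₁]
    simp
  have h5 : ∀ k, k ≠ arrMark → s₂.mem k = s.mem k := fun k hk => by
    rw [h3 k hk, hs₁]
    rfl
  have h6 : (Cmd.assign regU (.load arrEnd (.var regPos))).run
      ((Cmd.assign regV (.load arrEnd' (.var regPos))).run s₂) =
      (s₂.setReg regV b).setReg regU a := by
    rw [Cmd.run_assign, Cmd.run_assign]
    simp [Expr.eval, ha, hb, h4, h5]
  rw [← hs₁, ← hs₂, markBody, Cmd.run_seq, Cmd.run_seq, Cmd.run_seq, Cmd.run_seq, Cmd.run_seq,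
    Cmd.run_seq, h1, ← hs₂, h6, Cmd.run_assign]
  have h7 := (markHalf_run ((s₂.setReg regV b).setReg regU a)).1 regPos (by norm_num)
  simp only [Expr.eval, Op.fn, h7]
  simp [h4]

/-- The effect of the pass over the edges: the marks of the lists of all vertices tell which entries
are neighbours of the owner of the list. -/
theorem markBody_steps {n N τ : ℕ} {es : List (Fin n × Fin n)} {B : Fin n → Finset (Fin n)}
    (hτ : ∀ s, SmallData N s → markBody.cost s ≤ τ) {s : State} (hs : SmallData N s)
    (hB : AllRecorded s B) (hes : ∀ i (h : i < es.length),
      s.mem arrEnd (s.reg regPos + i) = es[i].1 ∧ s.mem arrEnd' (s.reg regPos + i) = es[i].2) :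
    ∃ s', Cmd.Steps markBody es.length τ s s' ∧ SmallData N s' ∧
      (∀ x < 3, s'.reg x = s.reg x) ∧ s'.reg regPtr = s.reg regPtr ∧ s'.reg regK = s.reg regK ∧
      (∀ k, k ≠ arrMark → s'.mem k = s.mem k) ∧
      ∀ v, ∀ i < (B v).card, (s'.mem arrMark (s.mem arrStart v + i) ≠ 0 ↔
        (∃ e ∈ es, (v = e.1 ∧ s.mem arrNb (s.mem arrStart v + i) = e.2) ∨
          (v = e.2 ∧ s.mem arrNb (s.mem arrStart v + i) = e.1)) ∨
        s.mem arrMark (s.mem arrStart v + i) ≠ 0) := by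
  induction es generalizing s with
  | nil => exact ⟨s, ⟨rfl, by simp⟩, hs, by simp⟩
  | cons e es ih =>
    obtain ⟨he1, he2⟩ := hes 0 (by simp)
    simp only [Nat.add_zero, List.getElem_cons_zero] at he1 he2
    -- the states between the two halves
    obtain ⟨s₁, hs₁⟩ : ∃ s₁, s₁ = (s.setReg regV e.1).setReg regU e.2 := ⟨_, rfl⟩
    obtain ⟨s₂, hs₂⟩ : ∃ s₂, s₂ = ((markHalf.run s₁).setReg regV e.2).setReg regU e.1 := ⟨_, rfl⟩
    obtain ⟨a1, a2, a3, -⟩ := markHalf_run s₁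
    obtain ⟨b1, b2, b3, -⟩ := markHalf_run s₂
    have hr₁ : ∀ x, x ≠ 6 → x ≠ 10 → s₁.reg x = s.reg x := fun x h h' => by simp [hs₁, h, h']
    have hr₂ : ∀ x, x ≠ 6 → x ≠ 10 → (x < 11 ∨ x = 12) → s₂.reg x = s.reg x := by
      intro x h h' h''
      rw [← hr₁ x h h']
      rcases h'' with h'' | rfl
      · simp [hs₂, h, h', a1 x h'']
      · simp [hs₂, a2]
    have hm₁ : s₁.mem = s.mem := by rw [hs₁]; rfl
    have hm₂ : ∀ k, k ≠ arrMark → s₂.mem k = s.mem k := fun k hk => by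
      rw [← hm₁, ← a3 k hk, hs₂]; rfl
    have hm₃ : ∀ k, k ≠ arrMark → (markHalf.run s₂).mem k = s.mem k := fun k hk =>
      (b3 k hk).trans (hm₂ k hk)
    have hrun : markBody.run s = (markHalf.run s₂).setReg regPos (s.reg regPos + 1) := by
      rw [hs₂, hs₁]
      exact markBody_run he1 he2
    have hB₁ : AllRecorded s₁ B := fun v => (hB v).congr (hr₁ _ (by norm_num) (by norm_num))
      (hr₁ _ (by norm_num) (by norm_num)) fun k _ _ => by rw [hm₁]
    have hB₂ : AllRecorded s₂ B := fun v => (hB v).congr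
      (hr₂ _ (by norm_num) (by norm_num) (by norm_num))
      (hr₂ _ (by norm_num) (by norm_num) (by norm_num)) fun k h h' => hm₂ k (by omega)
    have hmark : ∀ v, ∀ i < (B v).card,
        ((markHalf.run s₂).mem arrMark (s.mem arrStart v + i) ≠ 0 ↔
          ((v = e.1 ∧ s.mem arrNb (s.mem arrStart v + i) = e.2) ∨
          (v = e.2 ∧ s.mem arrNb (s.mem arrStart v + i) = e.1)) ∨
          s.mem arrMark (s.mem arrStart v + i) ≠ 0) := by
      intro v i hi
      have h1 := markHalf_mark hB₁ (u := e.1) (w := e.2) (by simp [hs₁]) (by simp [hs₁]) hi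
      have h2 := markHalf_mark hB₂ (u := e.2) (w := e.1) (by simp [hs₂]) (by simp [hs₂]) hi
      rw [hm₁] at h1
      rw [hm₂ arrStart (by norm_num), hm₂ arrNb (by norm_num)] at h2
      have h3 : s₂.mem = (markHalf.run s₁).mem := by rw [hs₂]; rfl
      rw [h3, h1] at h2
      rw [h2]
      exact or_left_comm.trans or_assoc.symm
    have hs' : SmallData N (markBody.run s) := tameData_markBody.small N s hs
    rw [hrun] at hs'
    have hB' : AllRecorded ((markHalf.run s₂).setReg regPos (s.reg regPos + 1)) B := by
      refine fun v => (hB v).congr (by simp [b2, hr₂]) ?_ ?_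
      · rw [State.setReg_reg, if_neg (by norm_num), b1 _ (by norm_num),
          hr₂ _ (by norm_num) (by norm_num) (.inl (by norm_num))]
      · intro k h h'
        rw [State.setReg_mem, hm₃ k (by omega)]
    obtain ⟨s', h1, h2, h3, h4, h5, h6, h7⟩ := ih hs' hB' (by
      intro i hi
      have := hes (i + 1) (by simpa using hi)
      rw [State.setReg_mem, hm₃ arrEnd (by norm_num), hm₃ arrEnd' (by norm_num)]
      simpa [Nat.add_assoc, Nat.add_comm 1 i] using this)
    · refine ⟨s', ?_, h2, ?_, ?_, ?_, ?_, ?_⟩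
      · rw [List.length_cons, Nat.add_comm]
        exact (Cmd.Steps.one (hτ s hs) hrun).add h1
      · intro x hx
        have hx3 : x ≠ 3 := by omega
        rw [h3 x hx]
        simp only [State.setReg_reg, hx3, if_false]
        rw [b1 x (by omega), hr₂ x (by omega) (by omega) (.inl (by omega))]
      · rw [h4]
        simp only [State.setReg_reg]
        rw [if_neg (by norm_num), b1 _ (by norm_num),
          hr₂ _ (by norm_num) (by norm_num) (.inl (by norm_num))]
      · rw [h5]
        simp only [State.setReg_reg]
        rw [if_neg (by norm_num), b2, hr₂ _ (by norm_num) (by norm_num) (.inr rfl)]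
      · intro k hk
        rw [h6 k hk, State.setReg_mem, hm₃ k hk]
      · intro v i hi
        have h8 := h7 v i hi
        rw [State.setReg_mem, hm₃ arrStart (by norm_num), hm₃ arrNb (by norm_num),
          hmark v i hi] at h8
        rw [h8]
        simp only [List.mem_cons, exists_eq_or_imp]
        exact or_left_comm.trans or_assoc.symm

/-! ### Slots -/

/-- The slot in register `regC` is used by a vertex other than `v` in the list of `v`, the vertex in
register `regV`. -/
def usedExpr : Expr :=
  .ex regY (.var regZ) (.and (.not (.op .eq (.load arrNb (.op .add (.var regA) (.var regY)))
    (.var regV))) (.op .eq (.load arrSlot (.load arrNb (.op .add (.var regA) (.var regY))))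
    (.var regC)))

/-- Search for the smallest slot that is not used. -/
def slotSearch : Cmd :=
  .seq (.assign regC (.const 0)) (.rep (.var regK)
    (.ite usedExpr (.assign regC (.op .add (.var regC) (.const 1))) (.assign regC (.var regC))))

/-- One node in the pass that assigns slots; the nodes are visited in the reverse order. -/
def slotBody : Cmd :=
  .seq (.assign regPos (.op .sub (.var regPos) (.const 1)))
  (.ite (.op .eq (.load arrType (.var regPos)) (.const 2))
    (.seq (.assign regV (.load arrVert (.var regPos)))
    (.seq (.assign regA (.load arrStart (.var regV)))
    (.seq (.assign regZ (.load arrLen (.var regV)))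
    (.seq slotSearch
      (.store arrSlot (.var regV) (.var regC))))))
    (.assign regA (.const 0)))

/-- The slot `c` is used by a vertex other than `v` among the first `z` vertices of the list that
starts at `a`. -/
def Used (m : ℕ → ℕ → ℕ) (a z v c : ℕ) : Prop :=
  ∃ y < z, m arrNb (a + y) ≠ v ∧ m arrSlot (m arrNb (a + y)) = c

theorem tr_usedExpr (s : State) : usedExpr.Tr s ↔
    Used s.mem (s.reg regA) (s.reg regZ) (s.reg regV) (s.reg regC) := by
  simp [usedExpr, Used, Expr.eval, Op.fn]

/-- After `j` rounds of the search, either all slots below `j` are used and the candidate is `j`, or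
the candidate is an unused slot and will not change any more. -/
theorem slotSearch_iterate (s : State) (j : ℕ) : ∃ c,
    (Cmd.run (.ite usedExpr (.assign regC (.op .add (.var regC) (.const 1)))
      (.assign regC (.var regC))))^[j] (s.setReg regC 0) = s.setReg regC c ∧
    ((c = j ∧ ∀ i < j, Used s.mem (s.reg regA) (s.reg regZ) (s.reg regV) i) ∨
      (c < j ∧ ¬ Used s.mem (s.reg regA) (s.reg regZ) (s.reg regV) c)) := by
  induction j with
  | zero => exact ⟨0, rfl, .inl ⟨rfl, by simp⟩⟩
  | succ j ih =>
    obtain ⟨c, h1, h2⟩ := ih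
    rw [Function.iterate_succ_apply', h1]
    have h3 := tr_usedExpr (s.setReg regC c)
    simp only [State.setReg_mem, State.setReg_reg] at h3
    norm_num at h3
    by_cases hu : Used s.mem (s.reg regA) (s.reg regZ) (s.reg regV) c
    · have h4 : usedExpr.eval (s.setReg regC c) ≠ 0 := h3.2 hu
      refine ⟨c + 1, ?_, ?_⟩
      · rw [Cmd.run, if_pos h4]
        simp [Cmd.run, Expr.eval, Op.fn, State.setReg]
      · rcases h2 with ⟨rfl, h5⟩ | ⟨-, h5⟩
        · refine .inl ⟨rfl, fun i hi => ?_⟩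
          rcases Nat.lt_succ_iff_lt_or_eq.1 hi with hi | rfl
          · exact h5 i hi
          · exact hu
        · exact absurd hu h5
    · have h4 : ¬ usedExpr.eval (s.setReg regC c) ≠ 0 := fun h => hu (h3.1 h)
      refine ⟨c, ?_, .inr ⟨?_, hu⟩⟩
      · rw [Cmd.run, if_neg h4]
        simp [Cmd.run, Expr.eval, State.setReg]
      · omega

theorem tameData_slotSearch : TameData slotSearch := by
  have hok : usedExpr.Ok := by simp [usedExpr, Expr.Ok, Expr.Sm]
  have hsm : ∀ N s, SmallRegs N s → ∀ i ≤ s.reg regK, SmallRegs N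
      ((Cmd.run (.ite usedExpr (.assign regC (.op .add (.var regC) (.const 1)))
      (.assign regC (.var regC))))^[i] (s.setReg regC 0)) := by
    intro N s hs i hi
    obtain ⟨c, h1, h2⟩ := slotSearch_iterate s i
    rw [h1]
    have := hs regK (by norm_num) (by norm_num)
    exact hs.setReg (.inr (by omega))
  have h0 : ∀ s : State, (Cmd.assign regC (.const 0)).run s = s.setReg regC 0 := fun s => rfl
  refine ⟨⟨⟨by norm_num, trivial⟩, by simp [Expr.WF], hok.wf, by simp [Cmd.WF, Expr.WF],
    by simp [Cmd.WF, Expr.WF]⟩, ?_, fun N s hs => ?_⟩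
  · refine Cmd.polyOn_seq (J := fun N s => SmallRegs N s ∧ s.reg regC = 0)
      ((Cmd.polyOn_assign (by simp [Expr.Ok])).weaken fun _ _ hs => hs.regs)
      (Cmd.polyOn_rep (J := SmallRegs) (.const 1)
        (.of_le fun N s hs => hs.1 regK (by norm_num) (by norm_num)) ?_ ?_) ?_
    · refine Cmd.polyOn_ite hok.polyOn ((Cmd.polyOn_assign ?_).weaken fun _ _ hs => hs.1)
        ((Cmd.polyOn_assign ?_).weaken fun _ _ hs => hs.1) <;> simp [Expr.Ok, Expr.Sm]
    · rintro N s ⟨hs, hc⟩ i hi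
      have h1 := hsm N s hs i (by simpa [Expr.eval] using le_of_lt hi)
      rwa [← hc, State.setReg_self] at h1
    · exact fun N s hs => ⟨hs.regs.setReg (.inr (Nat.zero_le _)), by simp [Cmd.run, Expr.eval]⟩
  · have h1 : (Expr.var regK).eval (s.setReg regC 0) = s.reg regK := by simp [Expr.eval]
    have h2 := hsm N s hs.regs _ le_rfl
    obtain ⟨c, h3, -⟩ := slotSearch_iterate s (s.reg regK)
    have h4 : slotSearch.run s = s.setReg regC c := by
      rw [slotSearch, Cmd.run, h0, Cmd.run, h1, h3]
    rw [h3] at h2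
    rw [h4]
    exact ⟨h2, hs.len, hs.slot⟩

theorem tameData_slotBody : TameData slotBody := by
  refine .seq (.assign ?_ ?_) (.ite ?_ (.seq (.assign ?_ ?_) (.seq (.assign ?_ ?_)
    (.seq (.assign_small ?_ ?_ fun N s hs => hs.len _) (.seq tameData_slotSearch
      (.store_slot ?_ ?_ fun N s hs => hs.regs regC (by norm_num) (by norm_num))))))
      (.assign ?_ ?_))
  all_goals simp [Expr.Ok, Expr.Sm]

/-- At a forget node of the vertex `v`, a slot below `regK` is found that no other vertex of the
bag has: there are fewer other vertices than slots. -/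
theorem slotSearch_run {n : ℕ} {s : State} {v : Fin n} {B : Finset (Fin n)}
    (hB : Recorded s v B) (hvB : v ∈ B) (hv : s.reg regV = v)
    (ha : s.reg regA = s.mem arrStart v) (hz : s.reg regZ = s.mem arrLen v) :
    ∃ c < s.reg regK, slotSearch.run s = s.setReg regC c ∧
      ∀ u ∈ B, u ≠ v → s.mem arrSlot u ≠ c := by
  have h1 : (Expr.var regK).eval (s.setReg regC 0) = s.reg regK := by simp [Expr.eval]
  obtain ⟨c, h2, h3⟩ := slotSearch_iterate s (s.reg regK)
  have h4 : slotSearch.run s = s.setReg regC c := by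
    rw [← h2, slotSearch, Cmd.run_seq, Cmd.run_assign, Cmd.run, Expr.eval, h1]
  obtain ⟨e, he, hf⟩ := hB.frame
  have hused : ∀ i, Used s.mem (s.reg regA) (s.reg regZ) (s.reg regV) i ↔
      ∃ u ∈ B, u ≠ v ∧ s.mem arrSlot u = i := by
    intro i
    rw [Used, ha, hz, hv, hB.len]
    constructor
    · rintro ⟨y, hy, h5, h6⟩
      rw [hf y hy] at h5 h6
      refine ⟨e y, ?_, fun h => h5 (by rw [h]), h6⟩
      have := Finset.mem_image_of_mem e (Finset.mem_range.2 hy)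
      rwa [he] at this
    · rintro ⟨u, hu, huv, h5⟩
      rw [← he] at hu
      obtain ⟨y, hy, rfl⟩ := Finset.mem_image.1 hu
      rw [Finset.mem_range] at hy
      refine ⟨y, hy, ?_, ?_⟩
      · rw [hf y hy]
        exact fun h => huv (Fin.ext h)
      · rw [hf y hy]
        exact h5
  rcases h3 with ⟨-, h3⟩ | ⟨h3, h5⟩
  · exfalso
    have h6 : Finset.range (s.reg regK) ⊆ (B.erase v).image fun u : Fin n => s.mem arrSlot u := by
      intro i hi
      obtain ⟨u, hu, huv, h7⟩ := (hused i).1 (h3 i (Finset.mem_range.1 hi))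
      exact Finset.mem_image.2 ⟨u, Finset.mem_erase.2 ⟨huv, hu⟩, h7⟩
    have h7 := (Finset.card_le_card h6).trans Finset.card_image_le
    rw [Finset.card_range, Finset.card_erase_of_mem hvB] at h7
    have h8 := Finset.card_pos.2 ⟨v, hvB⟩
    have h9 := hB.card_le
    omega
  · refine ⟨c, h3, h4, fun u hu huv h => h5 ((hused c).2 ⟨u, hu, huv, h⟩)⟩

/-- The state `s'` after the nodes of the subtree `T` have been visited in reverse order, started in
the state `s`. -/
structure SlotPost {n : ℕ} (T : NiceTree (Fin n)) (s s' : State) : Prop where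
  pos : s'.reg regPos + T.code.length = s.reg regPos
  reg : ∀ x, x < 3 ∨ x = regPtr ∨ x = regK → s'.reg x = s.reg x
  mem : ∀ k, k ≠ arrSlot → s'.mem k = s.mem k
  same : ∀ v : Fin n, v ∉ T.forg → s'.mem arrSlot v = s.mem arrSlot v
  slots : ∀ p ∈ T.forgets, s'.mem arrSlot (p.1 : Fin n) < s.reg regK ∧
    ∀ u ∈ p.2, u ≠ p.1 → s'.mem arrSlot (u : Fin n) ≠ s'.mem arrSlot p.1

open NiceTree in
/-- The effect of the reverse pass on the code of a subtree. The other vertices in a recorded bag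
are forgotten above the node, so they have received their slots before and keep them. -/
theorem slotBody_steps {n N τ : ℕ} {G : SimpleGraph (Fin n)} {T : NiceTree (Fin n)}
    (hT : T.Sep G) (hτ : ∀ s, SmallData N s → slotBody.cost s ≤ τ) {s : State}
    (hs : SmallData N s) {p : ℕ} (hp : s.reg regPos = p + T.code.length)
    (hcode : CodeAt s.mem p T.code) (hrec : ∀ q ∈ T.forgets, Recorded s q.1 q.2) :
    ∃ s', Cmd.Steps slotBody T.code.length τ s s' ∧ SmallData N s' ∧ SlotPost T s s' := by
  have hsmall := tameData_slotBody.small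
  have hskip : ∀ s : State, s.mem arrType (s.reg regPos - 1) ≠ 2 → slotBody.run s =
      (s.setReg regPos (s.reg regPos - 1)).setReg regA 0 := by
    intro s h
    simp [slotBody, Cmd.run, Expr.eval, Op.fn, h]
  have hskip_reg : ∀ s : State, ∀ x, x ≠ 3 → x ≠ 11 →
      ((s.setReg regPos (s.reg regPos - 1)).setReg regA 0).reg x = s.reg x := by
    intro s x h h'
    simp [h, h']
  induction T generalizing s p with
  | leaf =>
    have h2 := (CodeAt.head hcode).1
    simp only [code, List.length_singleton] at hp h2
    have h3 : s.reg regPos - 1 = p := by omega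
    have h4 := hskip s (by rw [h3, h2]; norm_num)
    refine ⟨_, .one (hτ s hs) rfl, hsmall N s hs, ?_⟩
    rw [h4]
    refine ⟨by simp [code, hp], fun x hx => hskip_reg s x (by omega) (by omega), by simp,
      by simp, by simp [forgets]⟩
  | introduce v T ih =>
    have h2 := hcode.right.head.1
    simp only [code, List.length_append, List.length_singleton] at hp h2
    have h3 : s.reg regPos - 1 = p + T.code.length := by omega
    have h4 := hskip s (by rw [h3, h2]; norm_num)
    have hs₁ := hsmall N s hs
    rw [h4] at hs₁
    obtain ⟨s', h5, h6, h7⟩ := ih hT.2.2 hs₁ (p := p) (by simp [h3])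
      (hcode.left.congr rfl rfl) fun q hq => (hrec q hq).congr
        (hskip_reg s _ (by norm_num) (by norm_num)) (hskip_reg s _ (by norm_num) (by norm_num))
        fun _ _ _ => rfl
    refine ⟨s', ?_, h6, ?_, ?_, h7.mem, h7.same, ?_⟩
    · simpa [code, Nat.add_comm] using (Cmd.Steps.one (hτ s hs) h4).add h5
    · have := h7.pos
      simp [h3] at this
      simp [code, hp]
      omega
    · exact fun x hx => (h7.reg x hx).trans (hskip_reg s x (by omega) (by omega))
    · have := h7.slots
      rwa [hskip_reg s _ (by norm_num) (by norm_num)] at this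
  | forget v T ih =>
    have h2 := hcode.right.head
    simp only [code, List.length_append, List.length_singleton] at hp h2
    have h3 : s.reg regPos - 1 = p + T.code.length := by omega
    have hv : Recorded s v T.rootBag := hrec (v, T.rootBag) (by simp [forgets])
    obtain ⟨s₁, hs₁⟩ : ∃ s₁, s₁ = (((s.setReg regPos (p + T.code.length)).setReg regV v).setReg
      regA (s.mem arrStart v)).setReg regZ (s.mem arrLen v) := ⟨_, rfl⟩
    have hr₁ : ∀ x, x ≠ 3 → x ≠ 6 → x ≠ 11 → x ≠ 13 → s₁.reg x = s.reg x := fun x a b c d => by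
      simp [hs₁, a, b, c, d]
    have hm₁ : s₁.mem = s.mem := by rw [hs₁]; rfl
    obtain ⟨c, hc, hrun, hcu⟩ := slotSearch_run (s := s₁) (hv.congr
      (hr₁ _ (by norm_num) (by norm_num) (by norm_num) (by norm_num))
      (hr₁ _ (by norm_num) (by norm_num) (by norm_num) (by norm_num)) fun k _ _ => by rw [hm₁])
      hT.1 (by simp [hs₁]) (by simp [hs₁]) (by simp [hs₁])
    rw [hr₁ _ (by norm_num) (by norm_num) (by norm_num) (by norm_num)] at hc
    rw [hm₁] at hcu
    have h4 : slotBody.run s = (s₁.setReg regC c).setMem arrSlot v c := by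
      have h5 : slotBody.run s = (Cmd.store arrSlot (.var regV) (.var regC)).run
          (slotSearch.run s₁) := by
        simp [slotBody, Cmd.run, Expr.eval, Op.fn, h3, h2, hs₁]
      rw [h5, hrun]
      simp [Cmd.run, Expr.eval, hs₁]
    have hs₂ := hsmall N s hs
    rw [h4] at hs₂
    have hr₂ : ∀ x, x < 3 ∨ x = regPtr ∨ x = regK →
        ((s₁.setReg regC c).setMem arrSlot v c).reg x = s.reg x := by
      intro x hx
      have : x ≠ 19 := by omega
      simp only [State.setMem_reg, State.setReg_reg, this, if_false]
      exact hr₁ x (by omega) (by omega) (by omega) (by omega)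
    have hm₂ : ∀ k, k ≠ arrSlot → ((s₁.setReg regC c).setMem arrSlot v c).mem k = s.mem k := by
      intro k hk
      funext a
      simp [hk, hm₁]
    obtain ⟨s', h5, h6, h7⟩ := ih hT.2.2 hs₂ (p := p) (by simp [hs₁])
      (hcode.left.congr (hm₂ _ (by norm_num)) (hm₂ _ (by norm_num))) fun q hq =>
        (hrec q (by simp [forgets, hq])).congr (hr₂ _ (by norm_num)) (hr₂ _ (by norm_num))
        fun k _ _ => hm₂ k (by omega)
    have hdisj := hT.2.2.disjoint
    rw [Finset.disjoint_left] at hdisj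
    have hsv : s'.mem arrSlot v = c := by
      rw [h7.same v (hdisj hT.1)]
      simp
    refine ⟨s', ?_, h6, ?_, ?_, ?_, ?_, ?_⟩
    · simpa [code, Nat.add_comm] using (Cmd.Steps.one (hτ s hs) h4).add h5
    · have := h7.pos
      simp [hs₁] at this
      simp [code, hp]
      omega
    · exact fun x hx => (h7.reg x hx).trans (hr₂ x hx)
    · exact fun k hk => (h7.mem k hk).trans (hm₂ k hk)
    · intro u hu
      simp only [forg, Finset.mem_insert, not_or] at hu
      rw [h7.same u hu.2]
      have : (u : ℕ) ≠ v := fun h => hu.1 (Fin.ext h)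
      simp [this, hm₁]
    · intro q hq
      simp only [forgets, List.mem_append, List.mem_singleton] at hq
      rcases hq with hq | rfl
      · have := h7.slots q hq
        rwa [hr₂ _ (by norm_num)] at this
      · refine ⟨by rw [hsv]; exact hc, fun u hu huv => ?_⟩
        have huv' : (u : ℕ) ≠ v := fun h => huv (Fin.ext h)
        simp only at hu ⊢
        rw [hsv, h7.same u (hdisj hu)]
        simpa [huv', hm₁] using hcu u hu huv
  | join T₁ T₂ ih₁ ih₂ =>
    obtain ⟨hbag, hforg, hT₁, hT₂⟩ := hT
    have h2 := hcode.right.head.1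
    simp only [code, List.length_append, List.length_singleton] at hp h2 hcode
    have h3 : s.reg regPos - 1 = p + (T₁.code.length + T₂.code.length) := by omega
    have h4 := hskip s (by rw [h3, h2]; norm_num)
    have hs₁ := hsmall N s hs
    rw [h4] at hs₁
    obtain ⟨s₁, h5, h6, h7⟩ := ih₂ hT₂ hs₁ (p := p + T₁.code.length) (by simp [h3]; omega)
      (hcode.left.right.congr rfl rfl) fun q hq => (hrec q (by simp [forgets, hq])).congr
        (hskip_reg s _ (by norm_num) (by norm_num)) (hskip_reg s _ (by norm_num) (by norm_num))
        fun _ _ _ => rfl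
    have hreg : ∀ x, x < 3 ∨ x = regPtr ∨ x = regK → s₁.reg x = s.reg x := fun x hx =>
      (h7.reg x hx).trans (hskip_reg s x (by omega) (by omega))
    have hpos₁ : s₁.reg regPos = p + T₁.code.length := by
      have := h7.pos
      simp [h3] at this
      omega
    obtain ⟨s', h8, h9, h10⟩ := ih₁ hT₁ h6 (p := p) hpos₁
      (hcode.left.left.congr (h7.mem _ (by norm_num)) (h7.mem _ (by norm_num))) fun q hq =>
        (hrec q (by simp [forgets, hq])).congr (hreg _ (by norm_num)) (hreg _ (by norm_num))
        fun k _ _ => h7.mem k (by omega)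
    refine ⟨s', ?_, h9, ?_, fun x hx => (h10.reg x hx).trans (hreg x hx),
      fun k hk => (h10.mem k hk).trans (h7.mem k hk), ?_, ?_⟩
    · have := ((Cmd.Steps.one (hτ s hs) h4).add h5).add h8
      simp only [code, List.length_append, List.length_singleton]
      rwa [show 1 + T₂.code.length + T₁.code.length = T₁.code.length + T₂.code.length + 1 by
        omega] at this
    · have := h10.pos
      simp [code, hp]
      omega
    · intro u hu
      simp only [forg, Finset.mem_union, not_or] at hu
      rw [h10.same u hu.1, h7.same u hu.2]
      simp
    · intro q hq
      simp only [forgets, List.mem_append] at hq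
      rw [Finset.disjoint_left] at hforg
      rcases hq with hq | hq
      · have := h10.slots q hq
        rwa [hreg _ (by norm_num)] at this
      · -- the slots of the bags in the right subtree do not change any more
        have hsame : ∀ u ∈ T₂.rootBag ∪ T₂.forg, s'.mem arrSlot u = s₁.mem arrSlot u := by
          intro u hu
          refine h10.same u fun hu' => ?_
          rcases Finset.mem_union.1 hu with h | h
          · rw [← hbag] at h
            exact Finset.disjoint_left.1 hT₁.disjoint h hu'
          · exact hforg hu' h
        have h11 := h7.slots q hq
        have h12 := hT₂.mem_of_mem_forgets hq
        rw [hskip_reg s _ (by norm_num) (by norm_num)] at h11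
        rw [hsame _ (h12.2 h12.1)]
        refine ⟨h11.1, fun u hu huv => ?_⟩
        rw [hsame _ (h12.2 hu)]
        exact h11.2 u hu huv

/-! ### Transitions of the dynamic program as expressions -/

notation "regQ1" => (21 : ℕ)
notation "regQ2" => (22 : ℕ)
notation "regC0" => (23 : ℕ)
notation "regP" => (24 : ℕ)
notation "regP1" => (25 : ℕ)
notation "regP2" => (26 : ℕ)

/-- The power `radix ^ i`. -/
def powE : ℕ → Expr
  | 0 => .const 1
  | i + 1 => .op .mul (powE i) (.var regRadix)

/-- The binary digit of the number in register `a` at the position in register `p`. -/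
def bitE (a p : ℕ) : Expr := .op .mod (.op .div (.var a) (.load arrPow (.var p))) (.const 2)

/-- The digit of the profile in register `p` at position `i`. -/
def digE (p i : ℕ) : Expr := .op .mod (.op .div (.var p) (powE i)) (.var regRadix)

/-- The colour in the profile in register `p`. -/
def colE (r p : ℕ) : Expr := .op .div (.var p) (powE r)

/-- The profile in `regP1` arises from the one in `regP` by changing the digit `i` to `a`. -/
def changeE {r : ℕ} (i : Fin r) (a : Expr) : Expr :=
  .and (.op .eq (colE r regP1) (colE r regP)) (.allList (List.finRange r) fun j =>
    .op .eq (digE regP1 j) (if j = i then a else digE regP j))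

/-- The digits `a₁` and `a₂` may be combined to `a`, see `Comb`. -/
def combE (a₁ a₂ a : Expr) : Expr :=
  .or (.and (.not (.op .eq a (.const 1))) (.and (.op .eq a₁ a) (.op .eq a₂ a)))
    (.and (.op .eq a (.const 1)) (.or (.and (.op .eq a₁ (.const 1)) (.op .eq a₂ (.const 0)))
      (.and (.op .eq a₁ (.const 0)) (.op .eq a₂ (.const 1)))))

/-- The entry with number `regX` in the table of a leaf. -/
def leafE (r : ℕ) : Expr :=
  .all regP (.var regQ) (.iff (bitE regX regP)
    (.allList (List.finRange r) fun i => .op .eq (digE regP i) (.const 0)))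

/-- The entry with number `regX` in the table of an introduce node; the table of the child starts
at `regB`. -/
def introE (r : ℕ) : Expr :=
  .ex regQ1 (.var regM) (.and (.load arrTab (.op .add (.var regB) (.var regQ1)))
    (.ex regC0 (.const 2) (.all regP (.var regQ) (.iff (bitE regX regP) (.or (bitE regQ1 regP)
      (.and (.op .eq (colE r regP) (.var regC0)) (.exList (List.finRange r) fun i =>
        .and (.op .eq (digE regP i) (.op .add (.var regS) (.const 2)))
          (.ex regP1 (.var regQ) (.and (bitE regQ1 regP1) (changeE i (.const 0)))))))))))

/-- Every vertex in the list of the forgotten vertex that has the digit of the profile in `regP` at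
position `j` is a neighbour of the forgotten vertex. -/
def adjE (j : ℕ) : Expr :=
  .all regY (.var regZ) (.or (.not (.op .eq (digE regP j) (.op .add
    (.load arrSlot (.load arrNb (.op .add (.var regA) (.var regY)))) (.const 2))))
      (.load arrMark (.op .add (.var regA) (.var regY))))

open Classical in
/-- The entry with number `regX` in the table of a forget node; the table of the child starts at
`regB`. -/
noncomputable def forgetE {r : ℕ} (H : SimpleGraph (Fin r)) : Expr :=
  .ex regQ1 (.var regM) (.and (.load arrTab (.op .add (.var regB) (.var regQ1)))
    (.all regP (.var regQ) (.iff (bitE regX regP) (.and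
      (.allList (List.finRange r) fun i =>
        .not (.op .eq (digE regP i) (.op .add (.var regS) (.const 2))))
      (.or (bitE regQ1 regP) (.exList (List.finRange r) fun i =>
        .and (.op .eq (digE regP i) (.const 1)) (.and
          (.ex regP1 (.var regQ) (.and (bitE regQ1 regP1)
            (changeE i (.op .add (.var regS) (.const 2)))))
          (.allList ((List.finRange r).filter fun j => H.Adj i j) fun j =>
            .and (.not (.op .eq (digE regP j) (.const 0))) (adjE j)))))))))

/-- The entry with number `regX` in the table of a join node; the tables of the children start at
`regB` and `regPrev`. -/
def joinE (r : ℕ) : Expr :=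
  .ex regQ1 (.var regM) (.and (.load arrTab (.op .add (.var regB) (.var regQ1)))
    (.ex regQ2 (.var regM) (.and (.load arrTab (.op .add (.var regPrev) (.var regQ2)))
      (.and
        (.all regP (.var regQ) (.or
          (.exList (List.finRange r) fun i => .op .eq (digE regP i) (.const 1))
          (.iff (bitE regQ1 regP) (bitE regQ2 regP))))
        (.all regP (.var regQ) (.iff (bitE regX regP)
          (.ex regP1 (.var regQ) (.and (bitE regQ1 regP1)
            (.and (.op .eq (colE r regP1) (colE r regP))
            (.ex regP2 (.var regQ) (.and (bitE regQ2 regP2)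
              (.and (.op .eq (colE r regP2) (colE r regP))
                (.allList (List.finRange r) fun i =>
                  combE (digE regP1 i) (digE regP2 i) (digE regP i))))))))))))))

/-- The answer is yes, read off from the table of the root, which starts at `0`. -/
def answerE (r : ℕ) : Expr :=
  .and (.op .lt (.const 1) (.var regN)) (.ex regQ1 (.var regM) (.and
    (.load arrTab (.var regQ1)) (.all regP (.var regQ) (.or
      (.not (.allList (List.finRange r) fun i => .op .eq (digE regP i) (.const 1)))
      (.not (bitE regQ1 regP))))))

@[simp] theorem ok_powE (i : ℕ) : (powE i).Ok ∧ (powE i).Sm := by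
  induction i with
  | zero => exact ⟨trivial, trivial⟩
  | succ i ih => simp [powE, Expr.Ok, Expr.Sm, ih]

theorem eval_powE (i : ℕ) (s : State) : (powE i).eval s = s.reg regRadix ^ i := by
  induction i with
  | zero => rfl
  | succ i ih => simp [powE, Expr.eval, Op.fn, ih, pow_succ]

theorem ok_bitE {a p : ℕ} (ha : 12 ≤ a ∧ a < 32) (hp : p < 32) : (bitE a p).Ok := by
  simp [bitE, Expr.Ok, Expr.Sm, ha, hp]

theorem ok_digE {p : ℕ} (hp : 12 ≤ p ∧ p < 32) (i : ℕ) : (digE p i).Ok ∧ (digE p i).Sm := by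
  simp [digE, Expr.Ok, Expr.Sm, hp]

theorem ok_colE {p : ℕ} (hp : 12 ≤ p ∧ p < 32) (r : ℕ) : (colE r p).Ok := by
  simp [colE, Expr.Ok, Expr.Sm, hp]

theorem ok_changeE {r : ℕ} {i : Fin r} {a : Expr} (ha : a.Ok) : (changeE i a).Ok := by
  simp only [changeE, Expr.ok_and, Expr.ok_allList, Expr.Ok]
  refine ⟨⟨ok_colE (by norm_num) _, ok_colE (by norm_num) _⟩, fun j _ =>
    ⟨(ok_digE (by norm_num) _).1, ?_⟩⟩
  split_ifs
  · exact ha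
  · exact (ok_digE (by norm_num) _).1

theorem ok_leafE (r : ℕ) : (leafE r).Ok := by
  simp [leafE, Expr.Ok, Expr.Sm, ok_bitE, ok_digE]

theorem ok_introE (r : ℕ) : (introE r).Ok := by
  simp [introE, Expr.Ok, Expr.Sm, ok_bitE, ok_digE, ok_colE]
  exact fun i => ok_changeE trivial

theorem ok_forgetE {r : ℕ} (H : SimpleGraph (Fin r)) : (forgetE H).Ok := by
  simp [forgetE, adjE, Expr.Ok, Expr.Sm, ok_bitE, ok_digE]
  exact fun i => ok_changeE (by simp [Expr.Ok, Expr.Sm])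

theorem ok_joinE (r : ℕ) : (joinE r).Ok := by
  simp [joinE, combE, Expr.Ok, Expr.Sm, ok_bitE, ok_digE, ok_colE]

theorem ok_answerE (r : ℕ) : (answerE r).Ok := by
  simp [answerE, Expr.Ok, Expr.Sm, ok_bitE, ok_digE]

/-- The registers and the table of powers that the expressions refer to are set for slots below
`k`. -/
structure Numbers (r k : ℕ) (s : State) : Prop where
  radix : s.reg regRadix = k + 2
  profiles : s.reg regQ = 2 * (k + 2) ^ r
  sets : s.reg regM = 2 ^ (2 * (k + 2) ^ r)
  pow : ∀ p < 2 * (k + 2) ^ r, s.mem arrPow p = 2 ^ p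

section Tr

variable {r k : ℕ} {s : State}

/-- `Bit` with the powers of `2` taken from the table. -/
def TabBit (f : ℕ → ℕ) (q p : ℕ) : Prop := q / f p % 2 ≠ 0

theorem Numbers.tabBit (h : Numbers r k s) {q p : ℕ} (hp : p < 2 * (k + 2) ^ r) :
    TabBit (s.mem arrPow) q p ↔ Bit q p := by
  rw [TabBit, Bit, h.pow p hp]

theorem tr_bitE {a p : ℕ} : (bitE a p).Tr s ↔ TabBit (s.mem arrPow) (s.reg a) (s.reg p) := by
  simp [Expr.Tr, bitE, Expr.eval, Op.fn, TabBit]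

theorem eval_digE {p i : ℕ} : (digE p i).eval s = digit (s.reg regRadix) (s.reg p) i := by
  simp [digE, Expr.eval, Op.fn, eval_powE, digit]

theorem eval_colE {p : ℕ} : (colE r p).eval s = s.reg p / s.reg regRadix ^ r := by
  simp [colE, Expr.eval, Op.fn, eval_powE]

theorem tr_changeE {i : Fin r} {a : Expr} : (changeE i a).Tr s ↔
    s.reg regP1 / s.reg regRadix ^ r = s.reg regP / s.reg regRadix ^ r ∧
    ∀ j : Fin r, digit (s.reg regRadix) (s.reg regP1) j =
      Function.update (fun j : Fin r => digit (s.reg regRadix) (s.reg regP) j) i (a.eval s) j := by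
  simp only [changeE, Expr.tr_and, Expr.tr_eq, eval_colE, Expr.tr_allList, List.mem_finRange,
    forall_const, eval_digE]
  refine and_congr_right fun _ => forall_congr' fun j => ?_
  by_cases h : j = i
  · subst h
    simp
  · simp [h, eval_digE]

theorem tr_combE {a₁ a₂ a : Expr} :
    (combE a₁ a₂ a).Tr s ↔ Comb (a₁.eval s) (a₂.eval s) (a.eval s) := by
  simp [combE, Comb, Expr.eval]

theorem tr_leafE (h : Numbers r k s) : (leafE r).Tr s ↔ ∀ p < 2 * (k + 2) ^ r,
    (Bit (s.reg regX) p ↔ ∀ i : Fin r, digit (k + 2) p i = 0) := by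
  obtain ⟨h1, h2, -, -⟩ := id h
  simp [leafE, tr_bitE, eval_digE, Expr.eval, h1, h2]
  exact forall₂_congr fun p hp => iff_congr (h.tabBit hp) .rfl

/-- The adjacency condition that `adjE` tests. -/
def AdjAt (s : State) (d : ℕ) : Prop :=
  ∀ y < s.reg regZ, d = s.mem arrSlot (s.mem arrNb (s.reg regA + y)) + 2 →
    s.mem arrMark (s.reg regA + y) ≠ 0

theorem tr_adjE {j : ℕ} :
    (adjE j).Tr s ↔ AdjAt s (digit (s.reg regRadix) (s.reg regP) j) := by
  simp [adjE, AdjAt, eval_digE, Expr.eval, Op.fn, imp_iff_not_or]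

theorem tr_introE (h : Numbers r k s) : (introE r).Tr s ↔
    ∃ q' < 2 ^ (2 * (k + 2) ^ r), s.mem arrTab (s.reg regB + q') ≠ 0 ∧ ∃ c < 2,
      ∀ p < 2 * (k + 2) ^ r, (Bit (s.reg regX) p ↔
        Bit q' p ∨ (p / (k + 2) ^ r = c ∧ ∃ i : Fin r, digit (k + 2) p i = s.reg regS + 2 ∧
          ∃ p' < 2 * (k + 2) ^ r, Bit q' p' ∧ p' / (k + 2) ^ r = p / (k + 2) ^ r ∧
            ∀ j : Fin r, digit (k + 2) p' j =
              Function.update (fun i : Fin r => digit (k + 2) p i) i 0 j)) := by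
  obtain ⟨h1, h2, h3, -⟩ := id h
  simp only [introE, Expr.tr_all, Expr.tr_ex, Expr.tr_and, Expr.tr_or, Expr.tr_iff, Expr.tr_eq,
    Expr.tr_load, Expr.tr_exList, tr_bitE, eval_digE, eval_colE, tr_changeE, Expr.eval, Op.fn,
    List.mem_finRange, State.setReg_reg, State.setReg_mem, true_and]
  norm_num only [h1, h2, h3, if_true, if_false]
  refine exists_congr fun q' => and_congr_right fun _ => and_congr_right fun _ =>
    exists_congr fun c => and_congr_right fun _ => forall₂_congr fun p hp =>
    iff_congr (h.tabBit hp) (or_congr (h.tabBit hp) (and_congr_right fun _ =>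
    exists_congr fun i => and_congr_right fun _ => exists_congr fun p' =>
    and_congr_right fun hp' => and_congr_left' (h.tabBit hp')))

theorem tr_forgetE {H : SimpleGraph (Fin r)} (h : Numbers r k s) : (forgetE H).Tr s ↔
    ∃ q' < 2 ^ (2 * (k + 2) ^ r), s.mem arrTab (s.reg regB + q') ≠ 0 ∧
      ∀ p < 2 * (k + 2) ^ r, (Bit (s.reg regX) p ↔
        (∀ i : Fin r, digit (k + 2) p i ≠ s.reg regS + 2) ∧ (Bit q' p ∨ ∃ i : Fin r,
          digit (k + 2) p i = 1 ∧ (∃ p' < 2 * (k + 2) ^ r, Bit q' p' ∧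
            p' / (k + 2) ^ r = p / (k + 2) ^ r ∧ ∀ j : Fin r, digit (k + 2) p' j =
              Function.update (fun i : Fin r => digit (k + 2) p i) i (s.reg regS + 2) j) ∧
          ∀ j : Fin r, H.Adj i j → digit (k + 2) p j ≠ 0 ∧ AdjAt s (digit (k + 2) p j))) := by
  obtain ⟨h1, h2, h3, -⟩ := id h
  simp only [forgetE, Expr.tr_all, Expr.tr_ex, Expr.tr_and, Expr.tr_or, Expr.tr_not, Expr.tr_iff,
    Expr.tr_eq, Expr.tr_load, Expr.tr_allList, Expr.tr_exList, tr_bitE, eval_digE, tr_changeE,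
    tr_adjE, Expr.eval, Op.fn, List.mem_finRange, State.setReg_reg, State.setReg_mem, true_and,
    List.mem_filter, decide_eq_true_eq, AdjAt, forall_const]
  norm_num only [h1, h2, h3, if_true, if_false]
  refine exists_congr fun q' => and_congr_right fun _ => and_congr_right fun _ =>
    forall₂_congr fun p hp => iff_congr (h.tabBit hp) (and_congr_right fun _ =>
    or_congr (h.tabBit hp) (exists_congr fun i => and_congr_right fun _ => and_congr_left' <|
    exists_congr fun p' => and_congr_right fun hp' => and_congr_left' (h.tabBit hp')))

theorem tr_joinE (h : Numbers r k s) : (joinE r).Tr s ↔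
    ∃ q₁ < 2 ^ (2 * (k + 2) ^ r), s.mem arrTab (s.reg regB + q₁) ≠ 0 ∧
      ∃ q₂ < 2 ^ (2 * (k + 2) ^ r), s.mem arrTab (s.reg regPrev + q₂) ≠ 0 ∧
        (∀ p < 2 * (k + 2) ^ r, (∀ i : Fin r, digit (k + 2) p i ≠ 1) → (Bit q₁ p ↔ Bit q₂ p)) ∧
        ∀ p < 2 * (k + 2) ^ r, (Bit (s.reg regX) p ↔
          ∃ p₁ < 2 * (k + 2) ^ r, Bit q₁ p₁ ∧ p₁ / (k + 2) ^ r = p / (k + 2) ^ r ∧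
          ∃ p₂ < 2 * (k + 2) ^ r, Bit q₂ p₂ ∧ p₂ / (k + 2) ^ r = p / (k + 2) ^ r ∧
          ∀ i : Fin r, Comb (digit (k + 2) p₁ i) (digit (k + 2) p₂ i) (digit (k + 2) p i)) := by
  obtain ⟨h1, h2, h3, -⟩ := id h
  simp only [joinE, Expr.tr_all, Expr.tr_ex, Expr.tr_and, Expr.tr_or, Expr.tr_iff, Expr.tr_eq,
    Expr.tr_load, Expr.tr_allList, Expr.tr_exList, tr_bitE, eval_digE, eval_colE, tr_combE,
    Expr.eval, Op.fn, List.mem_finRange, State.setReg_reg, State.setReg_mem, true_and,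
    forall_const]
  norm_num only [h1, h2, h3, if_true, if_false]
  refine exists_congr fun q₁ => and_congr_right fun _ => and_congr_right fun _ =>
    exists_congr fun q₂ => and_congr_right fun _ => and_congr_right fun _ => and_congr
    (forall₂_congr fun p hp => ?_) (forall₂_congr fun p hp => iff_congr (h.tabBit hp)
    (exists_congr fun p₁ => and_congr_right fun hp₁ => and_congr (h.tabBit hp₁)
    (and_congr_right fun _ => exists_congr fun p₂ => and_congr_right fun hp₂ =>
    and_congr_left' (h.tabBit hp₂))))
  rw [h.tabBit hp, h.tabBit hp, or_iff_not_imp_left, not_exists]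

theorem tr_answerE (h : Numbers r k s) : (answerE r).Tr s ↔ 1 < s.reg regN ∧
    ∃ q < 2 ^ (2 * (k + 2) ^ r), s.mem arrTab q ≠ 0 ∧
      ∀ p < 2 * (k + 2) ^ r, (∀ i : Fin r, digit (k + 2) p i = 1) → ¬ Bit q p := by
  obtain ⟨h1, h2, h3, -⟩ := id h
  simp only [answerE, Expr.tr_all, Expr.tr_ex, Expr.tr_and, Expr.tr_or, Expr.tr_not, Expr.tr_eq,
    Expr.tr_lt, Expr.tr_load, Expr.tr_allList, tr_bitE, eval_digE, Expr.eval, List.mem_finRange,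
    State.setReg_reg, State.setReg_mem, forall_const]
  norm_num only [h1, h2, h3, if_true, if_false]
  refine and_congr_right fun _ => exists_congr fun q => and_congr_right fun _ =>
    and_congr_right fun _ => forall₂_congr fun p hp => ?_
  rw [h.tabBit hp, imp_iff_not_or]

end Tr

/-! ### The pass of the dynamic program -/

/-- Compute the table whose entries are the truth values of `e` for the values of `regX` below
`regM`, and store it from address `regB` on. The table is prepared in another array, since `e` may
refer to the old contents of the cells. -/
def dpFill (e : Expr) : Cmd :=
  .seq (.assign regU (.const 0))
  (.seq (.fill arrTmp regU regX regM (.cond e (.const 1) (.const 0)))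
    (.fill arrTab regB regX regM (.load arrTmp (.var regX))))

/-- One node of the dynamic program. The tables of the completed subtrees form a stack with top
`regTop`. -/
noncomputable def dpBody {r : ℕ} (H : SimpleGraph (Fin r)) : Cmd :=
  .seq (.assign regV (.load arrVert (.var regPos)))
  (.seq (.assign regS (.load arrSlot (.var regV)))
  (.seq (.assign regA (.load arrStart (.var regV)))
  (.seq (.assign regZ (.load arrLen (.var regV)))
  (.seq (.assign regPrev (.op .sub (.var regTop) (.var regM)))
  (.seq (.ite (.op .eq (.load arrType (.var regPos)) (.const 0))
      (.seq (.assign regB (.var regTop)) (dpFill (leafE r)))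
    (.ite (.op .eq (.load arrType (.var regPos)) (.const 1))
      (.seq (.assign regB (.var regPrev)) (dpFill (introE r)))
    (.ite (.op .eq (.load arrType (.var regPos)) (.const 2))
      (.seq (.assign regB (.var regPrev)) (dpFill (forgetE H)))
      (.seq (.assign regB (.op .sub (.var regPrev) (.var regM))) (dpFill (joinE r))))))
  (.seq (.assign regTop (.op .add (.var regB) (.var regM)))
    (.assign regPos (.op .add (.var regPos) (.const 1)))))))))

theorem tameData_dpFill {e : Expr} (he : e.Ok) : TameData (dpFill e) := by
  refine .seq (.assign ?_ ?_) (.seq (.fill ?_ ?_ ?_ ?_ ?_ ?_) (.fill ?_ ?_ ?_ ?_ ?_ ?_))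
  all_goals simp [Expr.Ok, he]

theorem tameData_dpBody {r : ℕ} (H : SimpleGraph (Fin r)) : TameData (dpBody H) := by
  refine .seq (.assign ?_ ?_) (.seq (.assign_small ?_ ?_ fun N s hs => hs.slot _)
    (.seq (.assign ?_ ?_) (.seq (.assign_small ?_ ?_ fun N s hs => hs.len _)
    (.seq (.assign ?_ ?_) (.seq
      (.ite ?_ (.seq (.assign ?_ ?_) (tameData_dpFill (ok_leafE r)))
      (.ite ?_ (.seq (.assign ?_ ?_) (tameData_dpFill (ok_introE r)))
      (.ite ?_ (.seq (.assign ?_ ?_) (tameData_dpFill (ok_forgetE H)))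
        (.seq (.assign ?_ ?_) (tameData_dpFill (ok_joinE r))))))
      (.seq (.assign ?_ ?_) (.assign ?_ ?_)))))))
  all_goals simp [Expr.Ok, Expr.Sm]

/-- The effect of `dpFill`: the table represents `P` as soon as `e` does, in every state that
differs from the given one only in the auxiliary registers and the auxiliary array. -/
theorem dpFill_run {e : Expr} {s : State} {P : ℕ → Prop}
    (he : ∀ s' : State, (∀ x, x ≠ regU → x ≠ regX → s'.reg x = s.reg x) →
      (∀ k, k ≠ arrTmp → s'.mem k = s.mem k) → s'.reg regX < s.reg regM →
      (e.Tr s' ↔ P (s'.reg regX))) :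
    (∀ x, x ≠ regU → x ≠ regX → ((dpFill e).run s).reg x = s.reg x) ∧
    (∀ k, k ≠ arrTab → k ≠ arrTmp → ((dpFill e).run s).mem k = s.mem k) ∧
    (∀ a < s.reg regB, ((dpFill e).run s).mem arrTab a = s.mem arrTab a) ∧
    ∀ q < s.reg regM, (((dpFill e).run s).mem arrTab (s.reg regB + q) ≠ 0 ↔ P q) := by
  classical
  obtain ⟨g, hg⟩ : ∃ g : ℕ → ℕ, g = fun q => if P q then 1 else 0 := ⟨_, rfl⟩
  have htmp : (Cmd.fill arrTmp regU regX regM (.cond e (.const 1) (.const 0))).run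
      (s.setReg regU 0) = ⟨Function.update (s.setReg regU 0).reg regX (s.reg regM),
        Function.update s.mem arrTmp (Cmd.segment (s.mem arrTmp) 0 (s.reg regM) g)⟩ := by
    rw [Cmd.fill_run (g := g) (by norm_num) (by norm_num)]
    · simp
    · intro j hj
      rw [Expr.eval, hg]
      refine if_congr ?_ rfl rfl
      refine (he _ (fun x h1 h2 => ?_) (fun k h1 => ?_) ?_).trans ?_
      · simp [h1, h2]
      · simp [h1]
      · simpa using hj
      · simp
  rw [dpFill, Cmd.run_seq, Cmd.run_seq, Cmd.run_assign, Expr.eval, htmp]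
  rw [Cmd.fill_run (g := g) (by norm_num) (by norm_num)]
  · refine ⟨fun x h1 h2 => ?_, fun k h1 h2 => ?_, fun a ha => ?_, fun q hq => ?_⟩
    · simp [h1, h2]
    · simp [h1, h2]
    · simp only [Function.update_self]
      rw [Cmd.segment_of_not (.inl (by simpa using ha))]
      simp
    · have h1 := Cmd.segment_of_lt (f := s.mem arrTab) (a := s.reg regB) (g := g) hq
      have h2 : g q ≠ 0 ↔ P q := by simp [hg]
      rw [← h2, ← h1]
      simp
  · intro j hj
    have hj' : j < s.reg regM := by simpa using hj
    have := Cmd.segment_of_lt (f := s.mem arrTmp) (a := 0) (g := g) hj'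
    simpa [Expr.eval] using this

theorem IsTable.congr {n r : ℕ} {H : SimpleGraph (Fin r)} {G : SimpleGraph (Fin n)} {σ : Fin n → ℕ}
    {k : ℕ} {T : NiceTree (Fin n)} {F F' : ℕ → ℕ} (h : IsTable H G σ k T F)
    (hF : ∀ q < 2 ^ (2 * (k + 2) ^ r), F' q = F q) : IsTable H G σ k T F' :=
  fun q hq => by rw [hF q hq]; exact h q hq

/-- The data that the dynamic program uses at the nodes of `T`: the numbers, the slots `σ`, and the
marked lists of the bags. -/
structure DpData {n : ℕ} (r k : ℕ) (G : SimpleGraph (Fin n)) (σ : Fin n → ℕ)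
    (T : NiceTree (Fin n)) (s : State) : Prop where
  numbers : Numbers r k s
  slot : ∀ v : Fin n, s.mem arrSlot v = σ v
  recorded : ∀ p ∈ T.forgets, Recorded s p.1 p.2
  marked : ∀ p ∈ T.forgets, ∀ i < p.2.card, ∀ u : Fin n,
    s.mem arrNb (s.mem arrStart (p.1 : Fin n) + i) = u →
      (s.mem arrMark (s.mem arrStart (p.1 : Fin n) + i) ≠ 0 ↔ G.Adj p.1 u)

/-- The registers and arrays that do not change in the dynamic program. -/
def Unchanged (s s' : State) : Prop :=
  (∀ x, x < 3 ∨ x = regPtr ∨ x = regK ∨ (regRadix ≤ x ∧ x ≤ regM) → s'.reg x = s.reg x) ∧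
    ∀ k, k ≠ arrTab → k ≠ arrTmp → s'.mem k = s.mem k

theorem Unchanged.trans {s s' s'' : State} (h : Unchanged s s') (h' : Unchanged s' s'') :
    Unchanged s s'' :=
  ⟨fun x hx => (h'.1 x hx).trans (h.1 x hx), fun k h1 h2 => (h'.2 k h1 h2).trans (h.2 k h1 h2)⟩

theorem Numbers.congr {r k : ℕ} {s s' : State} (h : Numbers r k s)
    (hr : ∀ x, regRadix ≤ x → x ≤ regM → s'.reg x = s.reg x) (hm : s'.mem arrPow = s.mem arrPow) :
    Numbers r k s' where
  radix := (hr _ (by norm_num) (by norm_num)).trans h.radix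
  profiles := (hr _ (by norm_num) (by norm_num)).trans h.profiles
  sets := (hr _ (by norm_num) (by norm_num)).trans h.sets
  pow p hp := by rw [hm, h.pow p hp]

theorem DpData.congr {n r k : ℕ} {G : SimpleGraph (Fin n)} {σ : Fin n → ℕ}
    {T T' : NiceTree (Fin n)} {s s' : State} (h : DpData r k G σ T s) (hs : Unchanged s s')
    (hT : ∀ p ∈ T'.forgets, p ∈ T.forgets) : DpData r k G σ T' s' where
  numbers := h.numbers.congr (fun x h1 h2 => hs.1 x (by omega)) (hs.2 _ (by norm_num) (by norm_num))
  slot v := by rw [hs.2 _ (by norm_num) (by norm_num)]; exact h.slot v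
  recorded p hp := (h.recorded p (hT p hp)).congr (hs.1 _ (by norm_num)) (hs.1 _ (by norm_num))
    fun k _ _ => hs.2 k (by omega) (by omega)
  marked p hp := by
    rw [hs.2 arrNb (by norm_num) (by norm_num), hs.2 arrStart (by norm_num) (by norm_num),
      hs.2 arrMark (by norm_num) (by norm_num)]
    exact h.marked p (hT p hp)

/-- The state `s'` after the subtree `T` has been processed, started in the state `s`. -/
structure DpPost {n r : ℕ} (k : ℕ) (H : SimpleGraph (Fin r)) (G : SimpleGraph (Fin n))
    (σ : Fin n → ℕ) (T : NiceTree (Fin n)) (s s' : State) : Prop where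
  pos : s'.reg regPos = s.reg regPos + T.code.length
  top : s'.reg regTop = s.reg regTop + 2 ^ (2 * (k + 2) ^ r)
  unchanged : Unchanged s s'
  below : ∀ a < s.reg regTop, s'.mem arrTab a = s.mem arrTab a
  table : IsTable H G σ k T fun q => s'.mem arrTab (s.reg regTop + q)

/-- The state in which the table at a node is computed, with base `b`. -/
structure DpStart (s s₁ : State) (b : ℕ) : Prop where
  reg : ∀ x, x ≤ 5 ∨ x = regTop ∨ x = regK ∨ (regRadix ≤ x ∧ x ≤ regM) → s₁.reg x = s.reg x
  mem : s₁.mem = s.mem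
  base : s₁.reg regB = b
  slot : s₁.reg regS = s.mem arrSlot (s.mem arrVert (s.reg regPos))
  start : s₁.reg regA = s.mem arrStart (s.mem arrVert (s.reg regPos))
  len : s₁.reg regZ = s.mem arrLen (s.mem arrVert (s.reg regPos))
  prev : s₁.reg regPrev = s.reg regTop - s.reg regM

/-- One step of the dynamic program: the expression and the base of the new table are given by the
type of the node. -/
theorem dpBody_run {r : ℕ} (H : SimpleGraph (Fin r)) (s : State) {e : Expr} {b : ℕ}
    (h : (s.mem arrType (s.reg regPos) = 0 ∧ e = leafE r ∧ b = s.reg regTop) ∨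
      (s.mem arrType (s.reg regPos) = 1 ∧ e = introE r ∧ b = s.reg regTop - s.reg regM) ∨
      (s.mem arrType (s.reg regPos) = 2 ∧ e = forgetE H ∧ b = s.reg regTop - s.reg regM) ∨
      (s.mem arrType (s.reg regPos) = 3 ∧ e = joinE r ∧
        b = s.reg regTop - s.reg regM - s.reg regM)) :
    ∃ s₁, DpStart s s₁ b ∧ ∃ s₂, s₂ = (dpFill e).run s₁ ∧ (dpBody H).run s =
      (s₂.setReg regTop (s₂.reg regB + s₂.reg regM)).setReg regPos (s₂.reg regPos + 1) := by
  refine ⟨(((((s.setReg regV (s.mem arrVert (s.reg regPos))).setReg regS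
    (s.mem arrSlot (s.mem arrVert (s.reg regPos)))).setReg regA
    (s.mem arrStart (s.mem arrVert (s.reg regPos)))).setReg regZ
    (s.mem arrLen (s.mem arrVert (s.reg regPos)))).setReg regPrev
    (s.reg regTop - s.reg regM)).setReg regB b, ?_, _, rfl, ?_⟩
  · refine ⟨fun x hx => ?_, rfl, ?_, ?_, ?_, ?_, ?_⟩
    · have : x ≠ 6 ∧ x ≠ 7 ∧ x ≠ 9 ∧ x ≠ 11 ∧ x ≠ 13 ∧ x ≠ 18 := by omega
      simp [this]
    all_goals simp
  · rcases h with ⟨h, rfl, rfl⟩ | ⟨h, rfl, rfl⟩ | ⟨h, rfl, rfl⟩ | ⟨h, rfl, rfl⟩ <;>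
    simp [dpBody, Cmd.run_seq, Cmd.run, Expr.eval, Op.fn, h]

/-- The last part of the induction step, common to all types of nodes: once the expression `e`
computes the table of `T` by means of the tables of the children, the step leads to the state
required in `DpPost`. -/
theorem dpPost_of_table {n r k : ℕ} {H : SimpleGraph (Fin r)} {G : SimpleGraph (Fin n)}
    {σ : Fin n → ℕ} {T : NiceTree (Fin n)} {s s₀ s₁ : State} {e : Expr} {b : ℕ} {P : ℕ → Prop}
    (hb : s₀.reg regTop = b) (h₀ : Unchanged s₀ s) (hbelow : ∀ a < b, s.mem arrTab a =
      s₀.mem arrTab a)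
    (hpos : s.reg regPos + 1 = s₀.reg regPos + T.code.length)
    (h₁ : DpStart s s₁ b) (hn : Numbers r k s)
    (he : ∀ s', Numbers r k s' → (∀ x, x ≠ regU → x ≠ regX → s'.reg x = s₁.reg x) →
      (∀ k, k ≠ arrTmp → s'.mem k = s.mem k) → (e.Tr s' ↔ P (s'.reg regX)))
    (hP : ∀ q, P q ↔ ∃ χ, Encodes H G σ k T χ q) {s₂ : State} (h₂ : s₂ = (dpFill e).run s₁) :
    DpPost k H G σ T s₀ ((s₂.setReg regTop (s₂.reg regB + s₂.reg regM)).setReg regPos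
      (s₂.reg regPos + 1)) := by
  have hM : s₁.reg regM = 2 ^ (2 * (k + 2) ^ r) := by
    rw [h₁.reg _ (by norm_num), hn.sets]
  obtain ⟨h3, h4, h5, h6⟩ := dpFill_run (e := e) (s := s₁) (P := P) fun s' h1 h2 _ => by
    refine he s' (hn.congr (fun x h3 h4 => ?_) ?_) h1 fun k hk => by rw [h2 k hk, h₁.mem]
    · rw [h1 x (by omega) (by omega), h₁.reg x (by omega)]
    · rw [h2 _ (by norm_num), h₁.mem]
  rw [← h₂] at h3 h4 h5 h6
  rw [h₁.base, hM] at h6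
  rw [h₁.base, h₁.mem] at h5
  rw [h₁.mem] at h4
  refine ⟨?_, ?_, h₀.trans ⟨fun x hx => ?_, fun k h7 h8 => ?_⟩, fun a ha => ?_, fun q hq => ?_⟩
  · simp [h3, h₁.reg, hpos]
  · simp [h3, h₁.base, hM, hb]
  · have h7 : x ≠ 3 ∧ x ≠ 8 ∧ x ≠ 10 ∧ x ≠ 14 := by omega
    simp only [State.setReg_reg, h7, if_false]
    rw [h3 x h7.2.2.1 h7.2.2.2, h₁.reg x (by omega)]
  · simp [h4 k h7 h8]
  · rw [hb] at ha
    simp [h5 a ha, hbelow a ha]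
  · rw [← hP, ← h6 q hq, hb]
    simp

/-- The adjacency test on the marked list of `v` is the one required in `encodes_forget_iff`. -/
theorem adjAt_iff {n : ℕ} {G : SimpleGraph (Fin n)} {s : State} {v : Fin n} {B : Finset (Fin n)}
    (hB : Recorded s v B) (hA : s.reg regA = s.mem arrStart v) (hZ : s.reg regZ = s.mem arrLen v)
    (hmark : ∀ i < B.card, ∀ u : Fin n, s.mem arrNb (s.mem arrStart v + i) = u →
      (s.mem arrMark (s.mem arrStart v + i) ≠ 0 ↔ G.Adj v u)) (d : ℕ) :
    AdjAt s d ↔ ∀ u ∈ B, d = s.mem arrSlot u + 2 → G.Adj v u := by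
  obtain ⟨e, he, hf⟩ := hB.frame
  rw [AdjAt, hA, hZ, hB.len]
  constructor
  · intro h u hu hd
    rw [← he] at hu
    obtain ⟨y, hy, rfl⟩ := Finset.mem_image.1 hu
    rw [Finset.mem_range] at hy
    exact (hmark y hy _ (hf y hy)).1 (h y hy (by rw [hf y hy, hd]))
  · intro h y hy hd
    refine (hmark y hy _ (hf y hy)).2 (h _ ?_ (by rw [← hf y hy, hd]))
    rw [← he]
    exact Finset.mem_image_of_mem e (Finset.mem_range.2 hy)

open NiceTree in
/-- The effect of the dynamic program on the code of a subtree: its table is put on the stack. The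
vertices in the bag of the root have different slots; at a forget node this is extended to the
forgotten vertex by the choice of the slots. -/
theorem dpBody_steps {n r k N τ : ℕ} [Nonempty (Fin n)] {H : SimpleGraph (Fin r)} (hr : 0 < r)
    {G : SimpleGraph (Fin n)} {σ : Fin n → ℕ} {T : NiceTree (Fin n)} (hT : T.Sep G)
    (hτ : ∀ s, SmallData N s → (dpBody H).cost s ≤ τ) {s : State} (hs : SmallData N s)
    (hcode : CodeAt s.mem (s.reg regPos) T.code) (hdata : DpData r k G σ T s)
    (hslots : ∀ p ∈ T.forgets, σ p.1 < k ∧ ∀ u ∈ p.2, u ≠ p.1 → σ u ≠ σ p.1)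
    (hσ : Set.InjOn σ T.rootBag) (hk : ∀ u ∈ T.rootBag, σ u < k) :
    ∃ s', Cmd.Steps (dpBody H) T.code.length τ s s' ∧ SmallData N s' ∧ DpPost k H G σ T s s' := by
  have hsmall := (tameData_dpBody H).small
  induction T generalizing s with
  | leaf =>
    obtain ⟨h2, h3⟩ := CodeAt.head hcode
    obtain ⟨s₁, h4, s₂, h5, h6⟩ := dpBody_run H s (.inl ⟨h2, rfl, rfl⟩)
    refine ⟨_, .one (hτ s hs) rfl, hsmall N s hs, ?_⟩
    rw [h6]
    exact dpPost_of_table rfl ⟨fun _ _ => rfl, fun _ _ _ => rfl⟩ (fun _ _ => rfl) rfl h4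
      hdata.numbers (fun s' h _ _ => tr_leafE h) (fun q => encodes_leaf_iff.symm) h5
  | introduce v T ih =>
    obtain ⟨s₀, h1, h2, h3⟩ := ih hT.2.2 hs hcode.left (hdata.congr ⟨fun _ _ => rfl,
      fun _ _ _ => rfl⟩ fun p hp => hp) hslots
      (hσ.mono fun u hu => by simp [rootBag, Finset.mem_coe.1 hu])
      (fun u hu => hk u (by simp [rootBag, hu]))
    have hnum := (hdata.congr h3.unchanged fun p hp => hp).numbers
    have hM := hnum.sets
    have hcode' : CodeAt s₀.mem (s₀.reg regPos) [(1, (v : ℕ))] := by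
      rw [h3.pos]
      exact hcode.right.congr (h3.unchanged.2 _ (by norm_num) (by norm_num))
        (h3.unchanged.2 _ (by norm_num) (by norm_num))
    obtain ⟨h4, h5⟩ := hcode'.head
    have hbase : s₀.reg regTop - s₀.reg regM = s.reg regTop := by
      rw [h3.top, hM]
      omega
    obtain ⟨s₁, h6, s₂, h7, h8⟩ := dpBody_run H s₀ (.inr (.inl ⟨h4, rfl, hbase.symm⟩))
    refine ⟨_, ?_, hsmall N s₀ h2, ?_⟩
    · rw [code, List.length_append]
      exact h1.add (.one (hτ s₀ h2) rfl)
    rw [h8]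
    refine dpPost_of_table rfl h3.unchanged h3.below (by rw [h3.pos]; simp [code]; omega) h6
      hnum (fun s' h h9 h10 => ?_) (fun q => (encodes_introduce_iff hT hσ h3.table).symm) h7
    rw [tr_introE h, h9 regB (by norm_num) (by norm_num), h9 regS (by norm_num) (by norm_num),
      h6.base, h6.slot, h5, h3.unchanged.2 _ (by norm_num) (by norm_num), hdata.slot,
      h10 _ (by norm_num)]
  | forget v T ih =>
    have hvT : (v, T.rootBag) ∈ (forget v T).forgets := by simp [forgets]
    obtain ⟨hv, hvσ⟩ := hslots _ hvT
    have hσ' : Set.InjOn σ T.rootBag := by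
      intro a ha b hb hab
      by_cases hav : a = v
      · subst hav
        by_contra hne
        exact hvσ b hb (Ne.symm hne) hab.symm
      · by_cases hbv : b = v
        · subst hbv
          exact absurd hab (hvσ a ha hav)
        · exact hσ (by simp [rootBag, hav, Finset.mem_coe.1 ha])
            (by simp [rootBag, hbv, Finset.mem_coe.1 hb]) hab
    obtain ⟨s₀, h1, h2, h3⟩ := ih hT.2.2 hs hcode.left (hdata.congr ⟨fun _ _ => rfl,
      fun _ _ _ => rfl⟩ fun p hp => by simp [forgets, hp])
      (fun p hp => hslots p (by simp [forgets, hp])) hσ'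
      (fun u hu => by
        by_cases huv : u = v
        · rw [huv]
          exact hv
        · exact hk u (by simp [rootBag, huv, hu]))
    have hdata₀ := hdata.congr h3.unchanged fun p hp => hp
    have hnum := hdata₀.numbers
    have hcode' : CodeAt s₀.mem (s₀.reg regPos) [(2, (v : ℕ))] := by
      rw [h3.pos]
      exact hcode.right.congr (h3.unchanged.2 _ (by norm_num) (by norm_num))
        (h3.unchanged.2 _ (by norm_num) (by norm_num))
    obtain ⟨h4, h5⟩ := hcode'.head
    have hbase : s₀.reg regTop - s₀.reg regM = s.reg regTop := by
      rw [h3.top, hnum.sets]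
      omega
    obtain ⟨s₁, h6, s₂, h7, h8⟩ := dpBody_run H s₀ (.inr (.inr (.inl ⟨h4, rfl, hbase.symm⟩)))
    have hA : ∀ d, AdjAt s₁ d ↔ ∀ u ∈ T.rootBag, d = σ u + 2 → G.Adj v u := by
      intro d
      have h9 := adjAt_iff (s := s₁) (G := G) ((hdata₀.recorded _ hvT).congr
        (h6.reg _ (by norm_num)) (h6.reg _ (by norm_num)) fun k _ _ => by rw [h6.mem])
        (by rw [h6.start, h5, h6.mem]) (by rw [h6.len, h5, h6.mem])
        (by rw [h6.mem]; exact hdata₀.marked _ hvT) d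
      rw [h9, h6.mem]
      simp only [hdata₀.slot]
    refine ⟨_, ?_, hsmall N s₀ h2, ?_⟩
    · rw [code, List.length_append]
      exact h1.add (.one (hτ s₀ h2) rfl)
    rw [h8]
    refine dpPost_of_table rfl h3.unchanged h3.below (by rw [h3.pos]; simp [code]; omega) h6
      hnum (fun s' h h9 h10 => ?_)
      (fun q => (encodes_forget_iff hT hσ' hv hA h3.table).symm) h7
    have hadj : AdjAt s' = AdjAt s₁ := by
      funext d
      rw [AdjAt, AdjAt, h9 _ (by norm_num) (by norm_num), h9 _ (by norm_num) (by norm_num), h6.mem,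
        h10 _ (by norm_num), h10 _ (by norm_num), h10 _ (by norm_num)]
    rw [tr_forgetE h, hadj, h9 regB (by norm_num) (by norm_num),
      h9 regS (by norm_num) (by norm_num), h6.base, h6.slot, h5, hdata₀.slot,
      h10 _ (by norm_num)]
  | join T₁ T₂ ih₁ ih₂ =>
    have hbag := hT.1
    obtain ⟨s₁, h1, h2, h3⟩ := ih₁ hT.2.2.1 hs hcode.left.left (hdata.congr ⟨fun _ _ => rfl,
      fun _ _ _ => rfl⟩ fun p hp => by simp [forgets, hp])
      (fun p hp => hslots p (by simp [forgets, hp])) hσ hk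
    obtain ⟨s₀, h1', h2', h3'⟩ := ih₂ hT.2.2.2 h2
      (by
        rw [h3.pos]
        exact hcode.left.right.congr (h3.unchanged.2 _ (by norm_num) (by norm_num))
          (h3.unchanged.2 _ (by norm_num) (by norm_num)))
      (hdata.congr h3.unchanged fun p hp => by simp [forgets, hp])
      (fun p hp => hslots p (by simp [forgets, hp])) (hbag ▸ hσ) (hbag ▸ hk)
    have hun := h3.unchanged.trans h3'.unchanged
    have hnum := (hdata.congr hun fun p hp => hp).numbers
    have hcode' : CodeAt s₀.mem (s₀.reg regPos) [(3, 0)] := by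
      have := hcode.right.congr (hun.2 _ (by norm_num) (by norm_num))
        (hun.2 _ (by norm_num) (by norm_num))
      rwa [List.length_append, ← Nat.add_assoc, ← h3.pos, ← h3'.pos] at this
    obtain ⟨h4, h5⟩ := hcode'.head
    have hprev : s₀.reg regTop - s₀.reg regM = s₁.reg regTop := by
      rw [h3'.top, hnum.sets]
      omega
    have hbase : s₀.reg regTop - s₀.reg regM - s₀.reg regM = s.reg regTop := by
      rw [hprev, h3.top, hnum.sets]
      omega
    obtain ⟨s₃, h6, s₂, h7, h8⟩ := dpBody_run H s₀ (.inr (.inr (.inr ⟨h4, rfl, hbase.symm⟩)))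
    have htab : IsTable H G σ k T₁ fun q => s₀.mem arrTab (s.reg regTop + q) :=
      h3.table.congr fun q hq => h3'.below _ (by rw [h3.top]; omega)
    refine ⟨_, ?_, hsmall N s₀ h2', ?_⟩
    · rw [code, List.length_append, List.length_append]
      exact (h1.add h1').add (.one (hτ s₀ h2') rfl)
    rw [h8]
    refine dpPost_of_table rfl hun
      (fun a ha => (h3'.below a (by rw [h3.top]; exact Nat.lt_add_right _ ha)).trans
        (h3.below a ha))
      (by rw [h3'.pos, h3.pos]; simp [code]; omega) h6
      hnum (fun s' h h9 h10 => ?_)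
      (fun q => (encodes_join_iff hr hT hσ hk htab h3'.table).symm) h7
    rw [tr_joinE h, h9 regB (by norm_num) (by norm_num), h9 regPrev (by norm_num) (by norm_num),
      h6.base, h6.prev, hprev, h10 _ (by norm_num)]

/-! ### The algorithm -/

namespace RAM

/-- Running `c` from `s` leads to `s'`, with cost at most `τ`. -/
def Cmd.Reach (c : Cmd) (s : State) (τ : ℕ) (s' : State) : Prop := c.run s = s' ∧ c.cost s ≤ τ

theorem Cmd.Reach.seq {c c' : Cmd} {s s' s'' : State} {τ τ' : ℕ} (h : c.Reach s τ s')
    (h' : c'.Reach s' τ' s'') : (Cmd.seq c c').Reach s (τ + τ') s'' := by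
  obtain ⟨rfl, h2⟩ := h
  exact ⟨(Cmd.run_seq _ _ _).trans h'.1, Nat.add_le_add h2 h'.2⟩

theorem Cmd.Reach.assign {x : ℕ} {e : Expr} {s : State} {a τ : ℕ} (h : e.eval s = a)
    (hτ : e.cost s + 1 ≤ τ) : (Cmd.assign x e).Reach s τ (s.setReg x a) :=
  ⟨by rw [Cmd.run_assign, h], hτ⟩

theorem Cmd.Steps.reach {c : Cmd} {j τ x : ℕ} {s s' : State} (h : Cmd.Steps c j τ s s')
    (hx : s.reg x = j) : (Cmd.rep (.var x) c).Reach s (j * (τ + 2) + 3) s' := by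
  refine ⟨h.rep_run (e := .var x) hx, (h.rep_cost (e := .var x) hx).trans ?_⟩
  simp only [Expr.cost]
  omega

end RAM

/-- The pass over the bags. -/
def bagPass : Cmd :=
  .seq (.assign regPos (.const 0)) (.seq (.assign regDepth (.const 0)) (.rep (.var regL) bagBody))

/-- Append forget nodes for the vertices in the bag of the root, which the pass over the bags has
left on the stack. -/
def appendForgets : Cmd :=
  .seq (.fill arrType regL regX regZ (.const 2))
  (.seq (.fill arrVert regL regX regZ (.load arrStack (.var regX)))
    (.assign regL (.op .add (.var regL) (.var regZ))))

/-- Compute all records, for the tree extended to one whose root has an empty bag. -/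
def bagStage : Cmd :=
  .seq bagPass (.seq (.assign regZ (.load arrSize (.const 1))) (.seq appendForgets bagPass))

theorem bagPass_reach {n t N τ : ℕ} [Nonempty (Fin n)] {G : SimpleGraph (Fin n)}
    {T : NiceTree (Fin n)} (hT : T.Sep G) (ht : T.WidthLE t) (hN : t + 1 ≤ N)
    (hτ : ∀ s, SmallRegs N s → s.mem arrSize (s.reg regDepth) ≤ N → bagBody.cost s ≤ τ)
    {s : State} (hs : SmallRegs N s) (hsz : s.mem arrSize 0 ≤ N) (hcode : CodeAt s.mem 0 T.code)
    (hL : s.reg regL = T.code.length) :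
    ∃ s', bagPass.Reach s (T.code.length * (τ + 2) + 7) s' ∧ SmallRegs N s' ∧
      BagPost t T ((s.setReg regPos 0).setReg regDepth 0) s' := by
  obtain ⟨s', h1, h2, h3⟩ := bagBody_steps (s := (s.setReg regPos 0).setReg regDepth 0) hT ht hN hτ
    ((hs.setReg (.inl (by norm_num))).setReg (.inl (by norm_num))) (by simpa using hsz)
    (by simpa using hcode)
  refine ⟨s', ⟨?_, ?_⟩, h2, h3⟩
  · exact ((Cmd.Reach.assign (τ := 2) rfl le_rfl).seq ((Cmd.Reach.assign (τ := 2) rfl le_rfl).seq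
      (h1.reach (by simpa using hL)))).1
  · refine ((Cmd.Reach.assign (τ := 2) rfl le_rfl).seq ((Cmd.Reach.assign (τ := 2) rfl le_rfl).seq
      (h1.reach (by simpa using hL)))).2.trans ?_
    omega

theorem tame_appendForgets : appendForgets.Tame := by
  refine .seq (.fill ?_ ?_ ?_ ?_ ?_) (.seq (.fill ?_ ?_ ?_ ?_ ?_) (.assign ?_ ?_))
  all_goals simp [Expr.Ok, Expr.Sm]

theorem appendForgets_run {n : ℕ} {s : State} {l : List (Fin n)} {c : List (ℕ × ℕ)}
    (hc : CodeAt s.mem 0 c) (hL : s.reg regL = c.length) (hZ : s.reg regZ = l.length)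
    (hl : ∀ i (h : i < l.length), s.mem arrStack i = l[i]) :
    CodeAt (appendForgets.run s).mem 0 (c ++ l.map fun v : Fin n => (2, (v : ℕ))) ∧
    (appendForgets.run s).reg regL = c.length + l.length ∧
    (∀ x, x ≠ regL → x ≠ regX → (appendForgets.run s).reg x = s.reg x) ∧
    ∀ k, k ≠ arrType → k ≠ arrVert → (appendForgets.run s).mem k = s.mem k := by
  obtain ⟨g, hg⟩ : ∃ g : ℕ → ℕ, g = fun i => s.mem arrStack i := ⟨_, rfl⟩
  have hrun : appendForgets.run s = ((⟨Function.update s.reg regX l.length,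
      Function.update (Function.update s.mem arrType
        (Cmd.segment (s.mem arrType) c.length l.length fun _ => 2)) arrVert
        (Cmd.segment (s.mem arrVert) c.length l.length g)⟩ : State).setReg regL
        (c.length + l.length)) := by
    rw [appendForgets, Cmd.run_seq, Cmd.run_seq, Cmd.run_assign,
      Cmd.fill_run (k := arrType) (g := fun _ => 2) (by norm_num) (by norm_num)]
    · rw [Cmd.fill_run (g := g) (by norm_num) (by norm_num)]
      · simp [Expr.eval, Op.fn, hL, hZ]
      · intro j _
        simp [Expr.eval, hg]
    · intro j _
      rfl
  rw [hrun]
  refine ⟨fun i hi => ?_, by simp, fun x h1 h2 => by simp [h1, h2], fun k h1 h2 => by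
    simp [h1, h2]⟩
  simp only [State.setReg_mem, Nat.zero_add]
  by_cases hic : i < c.length
  · rw [List.getElem_append_left hic]
    have := hc i hic
    simpa [Cmd.segment_of_not (.inl hic)] using this
  · obtain ⟨j, rfl⟩ := Nat.exists_eq_add_of_le (not_lt.1 hic)
    have hj : j < l.length := by simpa using hi
    rw [List.getElem_append_right (by omega)]
    simp [Cmd.segment_of_lt hj, hg, hl j hj]

/-- The state after the records have been computed, for the extended tree `T`. -/
structure BagDone {n : ℕ} (t N : ℕ) (T : NiceTree (Fin n)) (s s' : State) : Prop where
  small : SmallRegs N s'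
  code : CodeAt s'.mem 0 T.code
  nodes : s'.reg regL = T.code.length
  k_le : s'.reg regK ≤ t + 1
  len_le : ∀ a, s'.mem arrLen a ≤ t + 1
  reg : ∀ x < 2, s'.reg x = s.reg x
  mem : ∀ k, k < 2 ∨ 10 < k → s'.mem k = s.mem k
  recorded : ∀ p ∈ T.forgets, Recorded s' p.1 p.2

theorem bagStage_wf : bagStage.WF 32 := by
  have h := bagBody_polyOn.1
  have h' := tame_appendForgets.wf
  simp [bagStage, bagPass, Cmd.WF, Expr.WF, h, h']

/-- After the two passes over the bags there are records for all vertices: the extended tree forgets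
all of them. -/
theorem bagStage_reach {n t N τ : ℕ} [Nonempty (Fin n)] {G : SimpleGraph (Fin n)}
    {T : NiceTree (Fin n)} (hT : T.Sep G) (hV : ∀ v, v ∈ T.rootBag ∪ T.forg) (ht : T.WidthLE t)
    (hN : t + 1 ≤ N)
    (hτ : ∀ s, SmallRegs N s → s.mem arrSize (s.reg regDepth) ≤ N → bagBody.cost s ≤ τ)
    (hτ' : ∀ s, SmallRegs N s → appendForgets.cost s ≤ τ)
    {s : State} (hs : SmallRegs N s) (hsz : ∀ a, s.mem arrSize a = 0)
    (hbase : ∀ a, s.mem arrBase a = 0)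
    (hlen : ∀ a, s.mem arrLen a = 0) (hk : s.reg regK = 0)
    (hcode : CodeAt s.mem 0 T.code) (hL : s.reg regL = T.code.length) :
    ∃ s' l, l.Nodup ∧ (∀ v ∈ l, v ∈ T.rootBag) ∧ (∀ v, v ∈ (T.forgetAll l).forg) ∧
      bagStage.Reach s ((T.forgetAll l).code.length * (3 * (τ + 2)) + 20) s' ∧
      BagDone t N (T.forgetAll l) s s' := by
  obtain ⟨s₁, h1, hs₁, h2⟩ := bagPass_reach hT ht hN hτ hs (by simp [hsz]) hcode hL
  have hfr := h2.frame
  have hsize := h2.size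
  simp only [State.setReg_reg, State.setReg_mem] at hfr hsize
  norm_num [hsz, hbase] at hfr hsize
  obtain ⟨e, he, hf⟩ := hfr
  simp only [Nat.zero_add] at hf
  obtain ⟨l, hl⟩ : ∃ l, l = (List.range T.rootBag.card).map e := ⟨_, rfl⟩
  have hlen' : l.length = T.rootBag.card := by simp [hl]
  have hmem : ∀ v, v ∈ l ↔ v ∈ T.rootBag := by
    intro v
    rw [← he]
    simp [hl]
  have hnodup : l.Nodup := by
    rw [hl]
    refine List.Nodup.map_on (fun x hx y hy h => ?_) List.nodup_range
    have : Set.InjOn e (Finset.range T.rootBag.card) := by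
      rw [← Finset.card_image_iff, he, Finset.card_range]
    exact this (by simpa using hx) (by simpa using hy) h
  have hcode₁ : CodeAt s₁.mem 0 T.code := hcode.congr (h2.mem _ (by norm_num))
    (h2.mem _ (by norm_num))
  have hcard : T.rootBag.card ≤ t + 1 := ht.rootBag
  obtain ⟨s₂, hs₂⟩ : ∃ s₂, s₂ = s₁.setReg regZ T.rootBag.card := ⟨_, rfl⟩
  have hsm₂ : SmallRegs N s₂ := by
    rw [hs₂]
    exact hs₁.setReg (.inr (hcard.trans hN))
  obtain ⟨a1, a2, a3, a4⟩ := appendForgets_run (s := s₂) (l := l) (c := T.code)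
    (by rw [hs₂]; exact hcode₁) (by
      have := h2.reg regL (by norm_num)
      simp [hs₂, this, hL]) (by simp [hs₂, hlen']) (by
      intro i hi
      rw [hs₂, State.setReg_mem, hf i (by omega)]
      simp [hl])
  obtain ⟨s₃, hs₃⟩ : ∃ s₃, s₃ = appendForgets.run s₂ := ⟨_, rfl⟩
  rw [← hs₃] at a1 a2 a3 a4
  have hsm₃ : SmallRegs N s₃ := by
    rw [hs₃]
    exact tame_appendForgets.small N s₂ hsm₂
  have hm : ∀ k, k < 2 ∨ k = 8 ∨ 10 < k → s₃.mem k = s₁.mem k := fun k hk => by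
    rw [a4 k (by omega) (by omega), hs₂]
    rfl
  rw [← NiceTree.code_forgetAll] at a1
  have hL₃ : s₃.reg regL = (T.forgetAll l).code.length := by
    rw [a2, NiceTree.code_forgetAll]
    simp
  have hT' : (T.forgetAll l).Sep G := hT.forgetAll hV hnodup fun v hv => (hmem v).1 hv
  have hb0 := h2.below 0 (by simp)
  simp only [State.setReg_mem, hsz, hbase] at hb0
  have hsz₃ : s₃.mem arrSize 0 ≤ N := by
    rw [a4 _ (by norm_num) (by norm_num), hs₂, State.setReg_mem, hb0.2]
    exact Nat.zero_le _
  obtain ⟨s₄, h3, hs₄, h4⟩ := bagPass_reach hT' (ht.forgetAll l) hN hτ hsm₃ hsz₃ a1 hL₃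
  have hreg₃ : ∀ x, x < 2 ∨ x = 12 → s₃.reg x = s₁.reg x := fun x hx => by
    have : x ≠ 13 := by omega
    rw [a3 x (by omega) (by omega), hs₂]
    simp [this]
  have hk₁ : s₁.reg regK ≤ t + 1 := h2.k_le (by simp [hk])
  have hlen₁ : ∀ a, s₁.mem arrLen a ≤ t + 1 := h2.len_le (by simp [hlen])
  refine ⟨s₄, l, hnodup, fun v hv => (hmem v).1 hv, fun v => ?_, ?_, hs₄, ?_, ?_, ?_, ?_, ?_, ?_,
    h4.recorded⟩
  · have := hV v
    rw [NiceTree.forg_forgetAll]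
    simp only [Finset.mem_union, List.mem_toFinset, hmem] at this ⊢
    tauto
  · have h5 := h1.seq ((Cmd.Reach.assign (x := regZ) (e := .load arrSize (.const 1)) (τ := 3)
      hsize le_rfl).seq (Cmd.Reach.seq (c := appendForgets) ⟨by rw [← hs₂, ← hs₃],
        hτ' _ (hs₂ ▸ hsm₂)⟩ h3))
    refine ⟨h5.1, h5.2.trans ?_⟩
    have h6 := NiceTree.code_length_pos (T.forgetAll l)
    have h7 : T.code.length ≤ (T.forgetAll l).code.length := by
      rw [NiceTree.code_forgetAll]
      simp
    generalize (T.forgetAll l).code.length = a at h6 h7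
    generalize T.code.length = b at h7
    nlinarith
  · exact a1.congr (h4.mem _ (by norm_num)) (h4.mem _ (by norm_num))
  · have := h4.reg regL (by norm_num)
    simpa [hL₃] using this
  · refine h4.k_le ?_
    simpa [hreg₃] using hk₁
  · refine h4.len_le ?_
    simpa [hm] using hlen₁
  · intro x hx
    have h5 := h4.reg x (by omega)
    have h6 := h2.reg x (by omega)
    have h7 : x ≠ 3 := by omega
    have h8 : x ≠ 4 := by omega
    simp only [State.setReg_reg, h7, h8, if_false] at h5 h6
    rw [h5, hreg₃ x (.inl hx), h6]
  · intro k hk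
    have h5 := h4.mem k (by omega)
    have h6 := h2.mem k (by omega)
    simp only [State.setReg_mem] at h5 h6
    rw [h5, hm k (by omega), h6]

/-- The pass over the edges. -/
def markPass : Cmd := .seq (.assign regPos (.const 0)) (.rep (.var regE) markBody)

/-- The pass that assigns slots, from the last node to the first. -/
def slotPass : Cmd := .seq (.assign regPos (.var regL)) (.rep (.var regL) slotBody)

/-- Store a power of two and double it. -/
def powBody : Cmd :=
  .seq (.store arrPow (.var regX) (.var regM))
  (.seq (.assign regM (.op .add (.var regM) (.var regM)))
    (.assign regX (.op .add (.var regX) (.const 1))))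

/-- The numbers from which the powers of two are computed. -/
def initNumbers (r : ℕ) : Cmd :=
  .seq (.assign regRadix (.op .add (.var regK) (.const 2)))
  (.seq (.assign regQ (.op .mul (.const 2) (powE r)))
  (.seq (.assign regM (.const 1)) (.assign regX (.const 0))))

/-- Compute the numbers in `Numbers`, for slots below `regK`. -/
def numbersPass (r : ℕ) : Cmd := .seq (initNumbers r) (.rep (.var regQ) powBody)

/-- The pass of the dynamic program. -/
noncomputable def dpPass {r : ℕ} (H : SimpleGraph (Fin r)) : Cmd :=
  .seq (.assign regPos (.const 0)) (.seq (.assign regTop (.const 0)) (.rep (.var regL) (dpBody H)))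

/-- The algorithm. -/
noncomputable def solve {r : ℕ} (H : SimpleGraph (Fin r)) : Cmd :=
  .seq bagStage (.seq markPass (.seq slotPass (.seq (numbersPass r) (.seq (dpPass H)
    (.assign regN (.cond (answerE r) (.const 1) (.const 0)))))))

theorem powBody_iterate {s : State} (hX : s.reg regX = 0) (hM : s.reg regM = 1) (j : ℕ) :
    powBody.run^[j] s = ⟨Function.update (Function.update s.reg regX j) regM (2 ^ j),
      Function.update s.mem arrPow (Cmd.segment (s.mem arrPow) 0 j fun p => 2 ^ p)⟩ := by
  induction j with
  | zero =>
    have h1 : Function.update s.reg regX 0 = s.reg := by rw [← hX, Function.update_eq_self]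
    have h2 : Function.update s.reg regM 1 = s.reg := by rw [← hM, Function.update_eq_self]
    simp [h1, h2, Cmd.segment_zero]
  | succ j ih =>
    rw [Function.iterate_succ_apply', ih]
    simp only [powBody, Cmd.run, State.setReg, State.setMem, Expr.eval, Op.fn, Cmd.segment_succ]
    norm_num
    funext x
    simp only [Function.update_apply]
    split_ifs <;> first | rfl | omega

theorem powBody_polyOn : powBody.WF 32 ∧ PolyOn SmallRegs powBody.cost := by
  refine ⟨by simp [powBody, Cmd.WF, Expr.WF], ?_⟩
  refine Cmd.polyOn_seq (J := SmallRegs) (Cmd.polyOn_store ?_ ?_)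
    (Cmd.polyOn_seq (J := fun _ _ => True) (Cmd.polyOn_assign ?_)
      ((PolyOn.const 20).mono fun N s _ => ?_) fun _ _ _ => trivial) fun N s hs => hs.of_reg rfl
  all_goals simp [Expr.Ok, Expr.Sm, Cmd.cost, Expr.cost, Op.cost, Expr.eval]

theorem initNumbers_polyOn (r : ℕ) : (initNumbers r).WF 32 ∧
    PolyOn (fun N s => SmallRegs N s ∧ s.reg regK + 2 ≤ N ∧ 2 * (s.reg regK + 2) ^ r ≤ N)
      (initNumbers r).cost := by
  have h1 : Expr.Ok (.op .mul (.const 2) (powE r)) := by simp [Expr.Ok, Expr.Sm]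
  refine ⟨by simp [initNumbers, Cmd.WF, Expr.WF, (ok_powE r).1.wf], ?_⟩
  refine Cmd.polyOn_seq (J := fun N s => SmallRegs N s ∧ 2 * (s.reg regRadix) ^ r ≤ N)
    ((Cmd.polyOn_assign ?_).weaken fun _ _ h => h.1)
    (Cmd.polyOn_seq (J := SmallRegs) ((Cmd.polyOn_assign h1).weaken fun _ _ h => h.1)
      ((PolyOn.const 4).mono fun N s _ => ?_) fun N s hs => ?_) fun N s hs => ⟨?_, ?_⟩
  · simp [Expr.Ok, Expr.Sm]
  · simp [Cmd.cost, Expr.cost]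
  · rw [Cmd.run_assign]
    exact hs.1.setReg (.inr (by simpa [Expr.eval, Op.fn, eval_powE] using hs.2))
  · rw [Cmd.run_assign]
    exact hs.1.setReg (.inr (by simpa [Expr.eval, Op.fn] using hs.2.1))
  · rw [Cmd.run_assign]
    simpa [Expr.eval, Op.fn] using hs.2.2

theorem numbersPass_reach {r N τ : ℕ} {s : State} (hs : SmallRegs N s) (hN : s.reg regK + 2 ≤ N)
    (hM : 2 ^ (2 * (s.reg regK + 2) ^ r) ≤ N)
    (hτ : ∀ s, SmallRegs N s → powBody.cost s ≤ τ)
    (hτ' : (initNumbers r).cost s ≤ τ) :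
    ∃ s', (numbersPass r).Reach s (τ + (N * (τ + 2) + 3)) s' ∧ SmallRegs N s' ∧
      Numbers r (s.reg regK) s' ∧ (∀ x, x ≤ 12 → s'.reg x = s.reg x) ∧
      ∀ k, k ≠ arrPow → s'.mem k = s.mem k := by
  obtain ⟨Q, hQ⟩ : ∃ Q, Q = 2 * (s.reg regK + 2) ^ r := ⟨_, rfl⟩
  rw [← hQ] at hM
  have hQN : Q ≤ N := Nat.lt_two_pow_self.le.trans hM
  obtain ⟨s₁, hs₁⟩ : ∃ s₁, s₁ = (((s.setReg regRadix (s.reg regK + 2)).setReg regQ Q).setReg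
      regM 1).setReg regX 0 := ⟨_, rfl⟩
  have hrun : (initNumbers r).run s = s₁ := by
    simp [initNumbers, Cmd.run_seq, Cmd.run_assign, Expr.eval, Op.fn, eval_powE, hs₁, hQ]
  have hsm₁ : ∀ j ≤ Q, SmallRegs N (powBody.run^[j] s₁) := by
    intro j hj
    have h1 : SmallRegs N s₁ := by
      rw [hs₁]
      exact (((hs.setReg (.inr hN)).setReg (.inr hQN)).setReg (.inr (by omega))).setReg
        (.inr (by omega))
    rw [powBody_iterate (by simp [hs₁]) (by simp [hs₁])]
    refine SmallRegs.of_reg (s := (s₁.setReg regX j).setReg regM (2 ^ j)) ?_ rfl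
    exact (h1.setReg (.inr (hj.trans hQN))).setReg
      (.inr ((Nat.pow_le_pow_right (by norm_num) hj).trans hM))
  have hsteps : Cmd.Steps powBody Q τ s₁ (powBody.run^[Q] s₁) := by
    refine ⟨rfl, ?_⟩
    have := Finset.sum_le_card_nsmul (Finset.range Q)
      (fun i => powBody.cost (powBody.run^[i] s₁)) τ fun i hi =>
        hτ _ (hsm₁ i (Finset.mem_range.1 hi).le)
    simpa using this
  have h1 := Cmd.Reach.seq (c := initNumbers r) ⟨hrun, hτ'⟩ (hsteps.reach (x := regQ)
    (by simp [hs₁]))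
  refine ⟨_, ⟨h1.1, h1.2.trans ?_⟩, hsm₁ Q le_rfl, ?_⟩
  · have := Nat.mul_le_mul_right (τ + 2) hQN
    omega
  · rw [powBody_iterate (by simp [hs₁]) (by simp [hs₁])]
    refine ⟨⟨?_, ?_, ?_, fun p hp => ?_⟩, fun x hx => ?_, fun k hk => ?_⟩
    · simp [hs₁]
    · simp [hs₁, hQ]
    · simp [hQ]
    · have := Cmd.segment_of_lt (f := s₁.mem arrPow) (a := 0) (g := fun p => 2 ^ p) (hQ ▸ hp)
      simpa using this
    · have h2 : x ≠ 14 ∧ x ≠ 15 ∧ x ≠ 16 ∧ x ≠ 17 := by omega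
      simp [hs₁, h2]
    · simp [hs₁, hk]

theorem Recorded.unique {n : ℕ} {s : State} {v : Fin n} {B B' : Finset (Fin n)}
    (h : Recorded s v B) (h' : Recorded s v B') : B = B' := by
  obtain ⟨e, he, hf⟩ := h.frame
  obtain ⟨e', he', hf'⟩ := h'.frame
  have hc : B.card = B'.card := h.len.symm.trans h'.len
  rw [← he, ← he', hc]
  refine Finset.image_congr fun i hi => ?_
  have hi' : i < B'.card := by simpa using hi
  exact Fin.ext ((hf i (hc ▸ hi')).symm.trans (hf' i hi'))

theorem adj_iff_of_listsEdges {n : ℕ} {G : SimpleGraph (Fin n)} {es : List (Fin n × Fin n)}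
    (hes : ListsEdges es G) (u v : Fin n) :
    G.Adj v u ↔ ∃ e ∈ es, (v = e.1 ∧ u = e.2) ∨ (v = e.2 ∧ u = e.1) := by
  rw [hes.2, List.mem_map]
  refine exists_congr fun e => and_congr_right fun _ => ?_
  rw [Sym2.eq_iff]
  constructor <;> rintro (⟨h1, h2⟩ | ⟨h1, h2⟩) <;> simp [h1, h2]

/-- Correctness and cost of the algorithm, for a common bound `τ` on the costs of the bodies of the
loops. -/
theorem solve_reach {n r t N τ : ℕ} [Nonempty (Fin n)] {H : SimpleGraph (Fin r)} (hr : 2 ≤ r)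
    {G : SimpleGraph (Fin n)} {es : List (Fin n × Fin n)} (hes : ListsEdges es G)
    {D : NiceTree (Fin n)} (hD : D.IsNiceTreeDecomposition G) (ht : D.WidthLE t)
    (hN : t + 3 ≤ N) (hM : 2 ^ (2 * (t + 3) ^ r) ≤ N)
    (h₁ : ∀ s, SmallRegs N s → s.mem arrSize (s.reg regDepth) ≤ N → bagBody.cost s ≤ τ)
    (h₂ : ∀ s, SmallRegs N s → appendForgets.cost s ≤ τ)
    (h₃ : ∀ s, SmallData N s → markBody.cost s ≤ τ)
    (h₄ : ∀ s, SmallData N s → slotBody.cost s ≤ τ)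
    (h₅ : ∀ s, SmallRegs N s → s.reg regK + 2 ≤ N ∧ 2 * (s.reg regK + 2) ^ r ≤ N →
      (initNumbers r).cost s ≤ τ)
    (h₆ : ∀ s, SmallRegs N s → powBody.cost s ≤ τ)
    (h₇ : ∀ s, SmallData N s → (dpBody H).cost s ≤ τ)
    (h₈ : ∀ s, SmallRegs N s →
      (Cmd.assign regN (.cond (answerE r) (.const 1) (.const 0))).cost s ≤ τ) :
    (solve H).cost (inputState es D) ≤ 60 * ((D.code.length + t + 1 + es.length) * (N * (τ + 2))) ∧
    (((solve H).run (inputState es D)).reg regN = 1 ↔ BWS H G) ∧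
    (((solve H).run (inputState es D)).reg regN = 0 ↔ ¬ BWS H G) := by
  obtain ⟨s₀, hs₀⟩ : ∃ s₀, s₀ = inputState es D := ⟨_, rfl⟩
  have hreg₀ : ∀ x, 2 < x → s₀.reg x = 0 := by
    intro x hx
    rw [hs₀]
    exact List.getD_eq_default _ _ (by simp; omega)
  have hmem₀ : ∀ k, 3 < k → ∀ a, s₀.mem k a = 0 := by
    intro k hk a
    obtain ⟨k', rfl⟩ := Nat.exists_eq_add_of_lt hk
    rw [hs₀, show 3 + k' + 1 = k' + 4 by omega]
    rfl
  have hsm₀ : SmallRegs N s₀ := fun x h1 _ => by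
    rw [hreg₀ x (by omega)]
    exact Nat.zero_le _
  have hcode₀ : CodeAt s₀.mem 0 D.code := by
    intro i hi
    rw [hs₀]
    simp [inputState, hi]
  -- the bags
  obtain ⟨s₁, l, hl, hlD, hforg, hr₁, hb⟩ := bagStage_reach (N := N) hD.sep hD.mem ht (by omega) h₁
    h₂ hsm₀ (hmem₀ _ (by norm_num)) (hmem₀ _ (by norm_num)) (hmem₀ _ (by norm_num))
    (hreg₀ _ (by norm_num)) hcode₀ (by rw [hs₀]; rfl)
  obtain ⟨T, hTl⟩ : ∃ T, T = D.forgetAll l := ⟨_, rfl⟩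
  have hT : T.Sep G := hTl ▸ hD.sep.forgetAll hD.mem hl hlD
  have hlen : T.code.length ≤ D.code.length + (t + 1) := by
    rw [hTl, NiceTree.code_forgetAll, List.length_append, List.length_map,
      ← List.toFinset_card_of_nodup hl]
    refine Nat.add_le_add_left (le_trans (Finset.card_le_card fun v hv => ?_) ht.rootBag) _
    exact hlD v (List.mem_toFinset.1 hv)
  rw [← hTl] at hforg hr₁ hb
  have hroot : T.rootBag = ∅ := by
    refine Finset.eq_empty_of_forall_notMem fun v hv => ?_
    exact Finset.disjoint_left.1 hT.disjoint hv (hforg v)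
  choose B hBT using fun v => NiceTree.exists_mem_forgets (hforg v)
  have hB₁ : AllRecorded s₁ B := fun v => hb.recorded _ (hBT v)
  have hsd₁ : SmallData N s₁ := ⟨hb.small, fun a => (hb.len_le a).trans (by omega), fun a => by
    rw [hb.mem _ (by norm_num), hmem₀ _ (by norm_num)]
    exact Nat.zero_le _⟩
  -- the edges
  obtain ⟨s₂, hr₂, hsd₂, hreg₂, hptr₂, hk₂, hmem₂, hmark₂⟩ := markBody_steps (es := es) h₃
    (s := s₁.setReg regPos 0) (B := B)
    ⟨hsd₁.regs.setReg (.inl (by norm_num)), hsd₁.len, hsd₁.slot⟩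
    (fun v => (hB₁ v).congr (by simp) (by simp) fun _ _ _ => rfl) (by
      intro i hi
      simp only [State.setReg_mem, State.setReg_reg, if_true, Nat.zero_add]
      rw [hb.mem _ (by norm_num), hb.mem _ (by norm_num), hs₀]
      simp [inputState, hi])
  have hreg₁₂ : ∀ x < 3, s₂.reg x = s₁.reg x := fun x hx => by
    have : x ≠ 3 := by omega
    simp [hreg₂ x hx, this]
  have hmem₁₂ : ∀ k, k ≠ arrMark → s₂.mem k = s₁.mem k := fun k hk => by simp [hmem₂ k hk]
  -- the slots
  obtain ⟨s₃, hr₃, hsd₃, hp₃⟩ := slotBody_steps hT h₄ (s := s₂.setReg regPos T.code.length) (p := 0)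
    ⟨hsd₂.regs.setReg (.inl (by norm_num)), hsd₂.len, hsd₂.slot⟩ (by simp)
    (by simpa using hb.code.congr (hmem₁₂ _ (by norm_num)) (hmem₁₂ _ (by norm_num)))
    (fun q hq => (hb.recorded q hq).congr (by simp [hk₂]) (by simp [hptr₂]) fun k _ _ => by
      simp [hmem₁₂ k (by omega)])
  have hreg₃ : ∀ x, x < 3 ∨ x = regPtr ∨ x = regK → s₃.reg x = s₁.reg x := by
    intro x hx
    have : x ≠ 3 := by omega
    rw [hp₃.reg x hx]
    rcases hx with hx | rfl | rfl
    · simp [this, hreg₁₂ x hx]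
    · simp [hptr₂]
    · simp [hk₂]
  have hmem₃ : ∀ k, k ≠ arrSlot → s₃.mem k = s₂.mem k := fun k hk => by simp [hp₃.mem k hk]
  -- the numbers
  have hk₃ : s₃.reg regK ≤ t + 1 := by
    rw [hreg₃ _ (by norm_num)]
    exact hb.k_le
  have hpow : (s₃.reg regK + 2) ^ r ≤ (t + 3) ^ r := Nat.pow_le_pow_left (by omega) r
  have hMk : 2 ^ (2 * (s₃.reg regK + 2) ^ r) ≤ N :=
    (Nat.pow_le_pow_right (by norm_num) (Nat.mul_le_mul_left 2 hpow)).trans hM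
  obtain ⟨s₄, hr₄, hsm₄, hnum₄, hreg₄, hmem₄⟩ := numbersPass_reach (r := r) hsd₃.regs (by omega) hMk
    h₆ (h₅ _ hsd₃.regs ⟨by omega, Nat.lt_two_pow_self.le.trans hMk⟩)
  have hreg₁₄ : ∀ x, x < 3 ∨ x = regPtr ∨ x = regK → s₄.reg x = s₁.reg x := fun x hx =>
    (hreg₄ x (by omega)).trans (hreg₃ x hx)
  have hmem₁₄ : ∀ k, k ≤ 10 → s₄.mem k = s₁.mem k := fun k hk => by
    rw [hmem₄ k (by omega), hmem₃ k (by omega), hmem₁₂ k (by omega)]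
  -- the dynamic program
  obtain ⟨σ, hσ⟩ : ∃ σ : Fin n → ℕ, σ = fun v : Fin n => s₃.mem arrSlot v := ⟨_, rfl⟩
  have hrec₄ : ∀ p ∈ T.forgets, Recorded s₄ p.1 p.2 := fun p hp =>
    (hb.recorded p hp).congr (hreg₁₄ _ (by norm_num)) (hreg₁₄ _ (by norm_num)) fun k _ h =>
      hmem₁₄ k h
  obtain ⟨s₅, hr₅, hsd₅, hp₅⟩ := dpBody_steps (k := s₃.reg regK) (σ := σ) (by omega) hT h₇
    (s := (s₄.setReg regPos 0).setReg regTop 0)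
    ⟨(hsm₄.setReg (.inl (by norm_num))).setReg (.inl (by norm_num)),
      by simpa [hmem₄] using hsd₃.len, by simpa [hmem₄] using hsd₃.slot⟩
    (by simpa using hb.code.congr (hmem₁₄ _ (by norm_num)) (hmem₁₄ _ (by norm_num)))
    ⟨hnum₄.congr (fun x h1 h2 => by
        have h3 : x ≠ 3 ∧ x ≠ 8 := by omega
        simp [h3]) rfl,
      fun v => by simp [hmem₄, hσ],
      fun p hp => (hrec₄ p hp).congr (by simp) (by simp) fun _ _ _ => rfl,
      fun p hp i hi u hu => by
        obtain ⟨v, Bv⟩ := p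
        obtain rfl : Bv = B v := (hrec₄ _ hp).unique (hrec₄ _ (hBT v))
        simp only [State.setReg_mem] at hu ⊢
        rw [hmem₁₄ arrNb (by norm_num), hmem₁₄ arrStart (by norm_num)] at hu
        have h9 := hmark₂ v i hi
        rw [hmem₄ arrMark (by norm_num), hmem₃ arrMark (by norm_num),
          hmem₁₄ arrStart (by norm_num)]
        simp only [State.setReg_mem, hu] at h9
        rw [h9, hb.mem arrMark (by norm_num), hmem₀ _ (by norm_num), adj_iff_of_listsEdges hes]
        simp [Fin.val_inj]⟩
    (by
      have h1 := hp₃.slots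
      have h2 := hp₃.reg regK (by norm_num)
      rw [← h2] at h1
      simpa [hσ] using h1)
    (by simp [hroot]) (by simp [hroot])
  have htab := hp₅.table
  have hn₅ : s₅.reg regN = n := by
    rw [hp₅.unchanged.1 _ (by norm_num)]
    have := hb.reg regN (by norm_num)
    simp only [State.setReg_reg]
    norm_num
    rw [hreg₁₄ _ (by norm_num), this, hs₀]
    rfl
  have hnum₅ : Numbers r (s₃.reg regK) s₅ := by
    refine hnum₄.congr (fun x h1 h2 => ?_) ?_
    · have h3 : x ≠ 3 ∧ x ≠ 8 := by omega
      rw [hp₅.unchanged.1 x (by omega)]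
      simp [h3]
    · rw [hp₅.unchanged.2 _ (by norm_num) (by norm_num)]
      rfl
  have hans : (answerE r).Tr s₅ ↔ BWS H G := by
    rw [tr_answerE hnum₅, htab.bws_iff hr hforg, hn₅]
    simp
  -- all passes
  have hE : s₁.reg regE = es.length := by
    rw [hb.reg _ (by norm_num), hs₀]
    rfl
  have hL₂ : s₂.reg regL = T.code.length := (hreg₁₂ _ (by norm_num)).trans hb.nodes
  have hL₄ : s₄.reg regL = T.code.length := (hreg₁₄ _ (by norm_num)).trans hb.nodes
  have hall := hr₁.seq (((Cmd.Reach.assign (x := regPos) (e := .const 0) (a := 0) (τ := 2) rfl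
    le_rfl).seq (hr₂.reach (x := regE) (by simp [hE]))).seq
    (((Cmd.Reach.assign (x := regPos) (e := .var regL) (τ := 2) hL₂ le_rfl).seq
      (hr₃.reach (x := regL) (by simp [hL₂]))).seq (hr₄.seq
    (((Cmd.Reach.assign (x := regPos) (e := .const 0) (a := 0) (τ := 2) rfl le_rfl).seq
      ((Cmd.Reach.assign (x := regTop) (e := .const 0) (a := 0) (τ := 2) rfl le_rfl).seq
      (hr₅.reach (x := regL) (by simp [hL₄])))).seq
    (Cmd.Reach.assign (x := regN) rfl (h₈ s₅ hsd₅.regs))))))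
  have hrun : (solve H).run s₀ = _ := hall.1
  have hcost : (solve H).cost s₀ ≤ _ := hall.2
  rw [← hs₀, hrun]
  refine ⟨hcost.trans ?_, ?_, ?_⟩
  · have h9 := NiceTree.code_length_pos T
    have h10 : τ + 2 ≤ N * (τ + 2) := Nat.le_mul_of_pos_left _ (by omega)
    have h11 : 3 * 2 ≤ N * (τ + 2) := Nat.mul_le_mul (by omega) (by omega)
    generalize N * (τ + 2) = X at h10 h11
    have h12 : T.code.length * (τ + 2) ≤ T.code.length * X := Nat.mul_le_mul_left _ h10
    have h13 : es.length * (τ + 2) ≤ es.length * X := Nat.mul_le_mul_left _ h10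
    have h14 : (T.code.length + es.length) * X ≤ (D.code.length + t + 1 + es.length) * X :=
      Nat.mul_le_mul_right _ (by omega)
    have h15 : 1 * X ≤ T.code.length * X := Nat.mul_le_mul_right _ h9
    rw [Nat.add_mul] at h14
    rw [show T.code.length * (3 * (τ + 2)) = 3 * (T.code.length * (τ + 2)) by ring]
    omega
  · rw [← hans]
    simp [Expr.eval, Expr.Tr]
  · rw [← hans]
    simp [Expr.eval, Expr.Tr]

theorem solve_wf {r : ℕ} (H : SimpleGraph (Fin r)) : (solve H).WF 32 := by
  have h1 := tameData_markBody.wf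
  have h2 := tameData_slotBody.wf
  have h3 := (tameData_dpBody H).wf
  have h4 := (initNumbers_polyOn r).1
  have h5 := powBody_polyOn.1
  have h6 := (ok_answerE r).wf
  simp [solve, markPass, slotPass, numbersPass, dpPass, Cmd.WF, Expr.WF, bagStage_wf, h1, h2, h3,
    h4, h5, h6]

/-! ### The running time -/

/-- The running time of the algorithm, with a polynomial in the number of states of a table in
front of the number of nodes and edges. -/
theorem exists_solve_cost {r : ℕ} (hr : 2 ≤ r) (H : SimpleGraph (Fin r)) : ∃ K, ∀ {n t N : ℕ}
    [Nonempty (Fin n)] {G : SimpleGraph (Fin n)} {es : List (Fin n × Fin n)}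
    {D : NiceTree (Fin n)}, ListsEdges es G → D.IsNiceTreeDecomposition G → D.WidthLE t →
    t + 3 ≤ N → 2 ^ (2 * (t + 3) ^ r) ≤ N →
    (solve H).cost (inputState es D) ≤ (D.code.length + t + 1 + es.length) * N ^ K ∧
    (((solve H).run (inputState es D)).reg regN = 1 ↔ BWS H G) ∧
    (((solve H).run (inputState es D)).reg regN = 0 ↔ ¬ BWS H G) := by
  obtain ⟨K₁, h₁⟩ := bagBody_polyOn.2.1
  obtain ⟨K₂, h₂⟩ := tame_appendForgets.cost
  obtain ⟨K₃, h₃⟩ := tameData_markBody.cost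
  obtain ⟨K₄, h₄⟩ := tameData_slotBody.cost
  obtain ⟨K₅, h₅⟩ := (initNumbers_polyOn r).2
  obtain ⟨K₆, h₆⟩ := powBody_polyOn.2
  obtain ⟨K₇, h₇⟩ := (tameData_dpBody H).cost
  obtain ⟨K₈, h₈⟩ := Cmd.polyOn_assign (x := regN)
    (e := .cond (answerE r) (.const 1) (.const 0)) ⟨ok_answerE r, trivial, trivial⟩
  obtain ⟨K, hK⟩ : ∃ K, K = K₁ + K₂ + K₃ + K₄ + K₅ + K₆ + K₇ + K₈ := ⟨_, rfl⟩
  refine ⟨K + 9, fun {n t N} _ {G es D} hes hD ht hN hM => ?_⟩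
  have hN2 : 2 ≤ N := by omega
  have hpow : ∀ j ≤ K, N ^ j ≤ N ^ K := fun j hj => Nat.pow_le_pow_right (by omega) hj
  have h := solve_reach (τ := N ^ K) hr hes hD ht hN hM
    (fun s h h' => (h₁ N hN2 s ⟨h, h'⟩).trans (hpow _ (by omega)))
    (fun s h => (h₂ N hN2 s h).trans (hpow _ (by omega)))
    (fun s h => (h₃ N hN2 s h).trans (hpow _ (by omega)))
    (fun s h => (h₄ N hN2 s h).trans (hpow _ (by omega)))
    (fun s h h' => (h₅ N hN2 s ⟨h, h'⟩).trans (hpow _ (by omega)))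
    (fun s h => (h₆ N hN2 s h).trans (hpow _ (by omega)))
    (fun s h => (h₇ N hN2 s h).trans (hpow _ (by omega)))
    (fun s h => (h₈ N hN2 s h).trans (hpow _ (by omega)))
  refine ⟨h.1.trans ?_, h.2⟩
  have h9 : 60 ≤ N ^ 6 := le_trans (by norm_num) (Nat.pow_le_pow_left hN2 6)
  have h10 : N ^ K + 2 ≤ N ^ K * N ^ 2 := by
    have h11 : 1 ≤ N ^ K := Nat.one_le_pow _ _ (by omega)
    have h12 : 4 ≤ N ^ 2 := le_trans (by norm_num) (Nat.pow_le_pow_left hN2 2)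
    nlinarith
  calc 60 * ((D.code.length + t + 1 + es.length) * (N * (N ^ K + 2)))
      ≤ N ^ 6 * ((D.code.length + t + 1 + es.length) * (N * (N ^ K * N ^ 2))) := by gcongr
    _ = (D.code.length + t + 1 + es.length) * N ^ (K + 9) := by ring

theorem not_bws_of_le_one {r n : ℕ} (hr : r ≤ 1) (H : SimpleGraph (Fin r))
    (G : SimpleGraph (Fin n)) : ¬ BWS H G := by
  rintro ⟨A, B, ⟨a, ha⟩, -, -, -, hA, -⟩
  have : Subsingleton (Fin r) := Fin.subsingleton_iff_le_one.2 hr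
  exact hA ⟨⟨⟨fun _ => ⟨a, ha⟩, fun {u v} h => absurd (Subsingleton.elim u v) h.ne⟩,
    Function.injective_of_subsingleton _⟩⟩

theorem add_three_pow_le (t r : ℕ) : (t + 3) ^ r ≤ 4 ^ r * t ^ r + 4 ^ r := by
  rcases Nat.eq_zero_or_pos t with rfl | ht
  · exact (Nat.pow_le_pow_left (by norm_num) r).trans (Nat.le_add_left _ _)
  · rw [← Nat.mul_pow]
    exact (Nat.pow_le_pow_left (by omega) r).trans (Nat.le_add_right _ _)

theorem mainTheorem1 {r : ℕ} (H : SimpleGraph (Fin r)) :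
    ∃ P : RAM.Prog, ∀ c : ℕ, ∃ C : ℕ,
      ∀ (n t : ℕ) (G : SimpleGraph (Fin n)) (es : List (Fin n × Fin n)) (D : NiceTree (Fin n)),
        ListsEdges es G → D.IsNiceTreeDecomposition G → D.WidthLE t →
        Nat.card D.Node ≤ c * (t + 1) * n →
          SolvesWithin P H G es D (C * 2 ^ (C * t ^ r) * n) := by
  -- the tree has a node, so the bound on the number of nodes excludes the graph without vertices
  have hpos : ∀ {c n t : ℕ} {D : NiceTree (Fin n)}, Nat.card D.Node ≤ c * (t + 1) * n → 0 < n := by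
    intro c n t D h
    rw [(NiceTree.finite_node_and_card D).2] at h
    have := NiceTree.code_length_pos D
    by_contra hn
    obtain rfl : n = 0 := by omega
    omega
  rcases Nat.lt_or_ge r 2 with hr | hr
  · -- a graph with at most one vertex is contained in every non-empty graph
    refine ⟨.instr (.const 0 0), fun c => ⟨1, fun n t G es D _ _ _ hcard => ?_⟩⟩
    have hn := hpos hcard
    refine ⟨1, _, .instr _ _, ?_, fun h => absurd h (not_bws_of_le_one (by omega) H G), fun _ => ?_⟩
    · exact Nat.mul_pos (Nat.mul_pos one_pos (by positivity)) hn
    · simp [Instr.apply]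
  obtain ⟨K, hK⟩ := exists_solve_cost hr H
  refine ⟨(solve H).compile 32, fun c => ?_⟩
  obtain ⟨a, ha⟩ : ∃ a, a = 2 * (K + 3) * 4 ^ r := ⟨_, rfl⟩
  refine ⟨(2 * c + 2) * 2 ^ a, fun n t G es D hes hD ht hcard => ?_⟩
  have hn := hpos hcard
  have : Nonempty (Fin n) := ⟨⟨0, hn⟩⟩
  obtain ⟨N, hN⟩ : ∃ N, N = 2 ^ (2 * (t + 3) ^ r) := ⟨_, rfl⟩
  have htN : t + 3 ≤ N := by
    have h1 : t + 3 ≤ (t + 3) ^ r := Nat.le_self_pow (by omega) _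
    have h2 : 2 * (t + 3) ^ r < 2 ^ (2 * (t + 3) ^ r) := Nat.lt_two_pow_self
    omega
  obtain ⟨h1, h2, h3⟩ := hK hes hD ht htN hN.ge
  obtain ⟨T, s, hexec, hT, hs, -⟩ := (solve H).compile_runs (solve_wf H) le_rfl
    (Agree.refl 32 (inputState es D))
  have hreg : s.reg 0 = ((solve H).run (inputState es D)).reg 0 := hs.1 0 (by norm_num)
  refine ⟨T, s, hexec, hT.trans (h1.trans ?_), fun h => ?_, fun h => ?_⟩
  · have hE := NiceTree.edges_length_le hes hD ht
    rw [(NiceTree.finite_node_and_card D).2] at hcard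
    -- the numbers of nodes and edges are bounded by `n` times a polynomial in `t`
    have h4 : D.code.length + t + 1 + es.length ≤ n * ((2 * c + 2) * N ^ 3) := by
      calc D.code.length + t + 1 + es.length
          ≤ c * (t + 1) * n + t + 1 + c * (t + 1) * n * (t + 1) ^ 2 := by
            have := hE.trans (Nat.mul_le_mul_right _ hcard)
            omega
        _ ≤ n * ((2 * c + 2) * (t + 1) ^ 3) := by
            have h5 : 1 ≤ n := hn
            have h6 : t + 1 ≤ (t + 1) ^ 3 := Nat.le_self_pow (by norm_num) _
            have h7 : c * n * (t + 1) ≤ c * n * (t + 1) ^ 3 := Nat.mul_le_mul_left _ h6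
            have h8 : 1 * (t + 1) ≤ n * (t + 1) ^ 3 := Nat.mul_le_mul h5 h6
            nlinarith
        _ ≤ n * ((2 * c + 2) * N ^ 3) := by
            gcongr
            omega
    have h5 : N ^ (K + 3) ≤ 2 ^ a * 2 ^ (a * t ^ r) := by
      rw [hN, ← pow_mul, ← pow_add]
      refine Nat.pow_le_pow_right (by norm_num) ?_
      calc 2 * (t + 3) ^ r * (K + 3) ≤ 2 * (4 ^ r * t ^ r + 4 ^ r) * (K + 3) := by
            gcongr
            exact add_three_pow_le t r
        _ = a + a * t ^ r := by rw [ha]; ring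
    have h6 : a ≤ (2 * c + 2) * 2 ^ a :=
      Nat.lt_two_pow_self.le.trans (Nat.le_mul_of_pos_left _ (by omega))
    calc (D.code.length + t + 1 + es.length) * N ^ K
        ≤ n * ((2 * c + 2) * N ^ 3) * N ^ K := Nat.mul_le_mul_right _ h4
      _ = (2 * c + 2) * N ^ (K + 3) * n := by ring
      _ ≤ (2 * c + 2) * (2 ^ a * 2 ^ (a * t ^ r)) * n := by gcongr
      _ = (2 * c + 2) * 2 ^ a * 2 ^ (a * t ^ r) * n := by ring
      _ ≤ (2 * c + 2) * 2 ^ a * 2 ^ ((2 * c + 2) * 2 ^ a * t ^ r) * n := by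
        gcongr
        norm_num
  · rw [hreg]
    exact h2.2 h
  · rw [hreg]
    exact h3.2 h
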